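/- **Setting.** Let $f$ be a transcendental entire function. $S(f)$ is the closure of the set of critical and finite asymptotic values of $f$, $AV(f)$ the set of finite asymptotic values, $I(f)=\{z: f^n(z)\to\infty\}$ the escaping set, $J(f)$ the Julia set, and $P(f)=\overline{\bigcup_{n\ge0}f^n(S(f))}$. A *ray tail* of $f$ with finite endpoint $z$ is (the trace of) an injective curve $\gamma:[t_0,\infty)\to I(f)$, $t_0>0$, $\gamma(t_0)=z$, such that for every $n\ge1$ the map $t\mapsto f^n(\gamma(t))$ is injective with $f^n(\gamma(t))\to\infty$ as $t\to\infty$, and such that $f^n(\gamma(t))\to\infty$ uniformly in $t$ as $n\to\infty$. The function $f$ is *criniferous* if for every $z\in I(f)$ there is $N$ such that $f^n(z)$ lies in a ray tail for all $n\ge N$. Assume that $S(f)$ is bounded, that $f$ is criniferous, that $J(f)\cap AV(f)=\emptyset$, that $P(f)\setminus I(f)$ is bounded, and that $S_I:=S(f)\cap I(f)$ is finite. For each $z\in S_I$ let $\gamma_z$ be a ray tail with finite endpoint $z$. Let $D\supset S(f)\cup(P(f)\setminus I(f))$ be a bounded Jordan domain and let $\delta\subset\mathbb C\setminus\overline{f^{-1}(\mathbb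 C\setminus D)}$ be an arc that connects a point of $\overline D$ to infinity and meets $\overline D$ only in that point. Put $W_{-1}=\mathbb C\setminus(\overline D\cup\delta)$ and assume that $D,\delta$ are chosen so that, whenever a connected component $\tau$ of $f^{-n}(W_{-1})$, $n\ge1$, contains a point $z\in S_I$, then $\gamma_z\subset\tau$. For $n\ge0$ define inductively $$X_n=\bigcup_{z\in W_{n-1}\cap S_I}\gamma_z,\qquad W_n=f^{-1}(W_{n-1}\setminus X_n).$$ The connected components of $W_n$ are the *fundamental hands* of level $n$. **Proposition.** Every fundamental hand (of any level $n\ge0$) is unbounded and simply connected, and any two distinct fundamental hands of the same level are disjoint. Moreover, for each $n\ge1$, $f$ maps each fundamental hand $\tau$ of level $n$ univalently into a fundamental hand $\tilde\tau$ of level $n-1$; more precisely, $f$ is injective on $\tau$ and $f(\tau)$ is a connected component of $\tilde\tau\setminus X_n$ (in particular $f(\tau)=\tilde\tau$ if $\tilde\tau\cap X_n=\emptyset$). -/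

import Mathlib

open Set Filter Topology

/-! ### Entire functions: singular values, escaping set, Julia set -/

/-- `f` is a transcendental entire function. -/
def IsTranscendentalEntire (f : ℂ → ℂ) : Prop :=
  Differentiable ℂ f ∧ ¬ ∃ p : Polynomial ℂ, ∀ z, f z = p.eval z

/-- `CV(f)`: the set of critical values of `f`. -/
def criticalValues (f : ℂ → ℂ) : Set ℂ := f '' {z | deriv f z = 0}

/-- `AV(f)`: the (finite) asymptotic values of `f`, i.e. the limits of `f` along curves
that tend to infinity. -/
def asymptoticValues (f : ℂ → ℂ) : Set ℂ :=
  {a | ∃ c : ℝ → ℂ, ContinuousOn c (Ici 0) ∧ Tendsto c atTop (Bornology.cobounded ℂ) ∧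
    Tendsto (fun t => f (c t)) atTop (𝓝 a)}

/-- `S(f)`: the singular set of `f`. -/
def singularSet (f : ℂ → ℂ) : Set ℂ := closure (criticalValues f ∪ asymptoticValues f)

/-- `P(f)`: the postsingular set of `f`. -/
def postsingularSet (f : ℂ → ℂ) : Set ℂ := closure (⋃ n : ℕ, f^[n] '' singularSet f)

/-- The Eremenko-Lyubich class `𝓑`. -/
def ClassB (f : ℂ → ℂ) : Prop :=
  IsTranscendentalEntire f ∧ Bornology.IsBounded (singularSet f)

/-- `I(f)`: the escaping set of `f`. -/
def escapingSet (f : ℂ → ℂ) : Set ℂ :=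
  {z | Tendsto (fun n : ℕ => f^[n] z) atTop (Bornology.cobounded ℂ)}

/-- The Fatou set of `f`: the points with a neighbourhood on which the iterates of `f` form a
normal family, i.e. every subsequence of the iterates has a further subsequence that converges
locally uniformly, either to a finite function or to infinity. -/
def fatouSet (f : ℂ → ℂ) : Set ℂ :=
  {z | ∃ r > 0, ∀ φ : ℕ → ℕ, StrictMono φ → ∃ ψ : ℕ → ℕ, StrictMono ψ ∧
    ((∃ g : ℂ → ℂ, TendstoLocallyUniformlyOn (fun k => f^[φ (ψ k)]) g atTop (Metric.ball z r)) ∨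
      ∀ K ⊆ Metric.ball z r, IsCompact K → ∀ R : ℝ, ∀ᶠ k in atTop,
        ∀ w ∈ K, R < ‖f^[φ (ψ k)] w‖)}

/-- `J(f)`: the Julia set of `f`. -/
def juliaSet (f : ℂ → ℂ) : Set ℂ := (fatouSet f)ᶜ

/-! ### Ray tails and criniferous functions -/

/-- The curve `c : [t₀, ∞) → I(f)` is a ray tail of `f`. -/
def IsRayTailCurve (f : ℂ → ℂ) (t₀ : ℝ) (c : ℝ → ℂ) : Prop :=
  0 < t₀ ∧ ContinuousOn c (Ici t₀) ∧ InjOn c (Ici t₀) ∧ MapsTo c (Ici t₀) (escapingSet f) ∧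
  (∀ n : ℕ, 1 ≤ n → InjOn (fun t => f^[n] (c t)) (Ici t₀) ∧
    Tendsto (fun t => f^[n] (c t)) atTop (Bornology.cobounded ℂ)) ∧
  ∀ R : ℝ, ∃ N : ℕ, ∀ n ≥ N, ∀ t ∈ Ici t₀, R < ‖f^[n] (c t)‖

/-- The set `T` is (the trace of) a ray tail of `f` with finite endpoint `z`. -/
def IsRayTailFrom (f : ℂ → ℂ) (z : ℂ) (T : Set ℂ) : Prop :=
  ∃ (t₀ : ℝ) (c : ℝ → ℂ), IsRayTailCurve f t₀ c ∧ c t₀ = z ∧ T = c '' Ici t₀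

/-- `f` is criniferous: every escaping point is eventually mapped into ray tails. -/
def Criniferous (f : ℂ → ℂ) : Prop :=
  ∀ z ∈ escapingSet f, ∃ N : ℕ, ∀ n ≥ N, ∃ (w : ℂ) (T : Set ℂ),
    IsRayTailFrom f w T ∧ f^[n] z ∈ T

/-- `S_I = S(f) ∩ I(f)`: the escaping singular values. -/
def escapingSingularSet (f : ℂ → ℂ) : Set ℂ := singularSet f ∩ escapingSet f

/-! ### The domain `W₋₁` -/

/-- `D` is a bounded Jordan domain: a bounded domain whose boundary is a Jordan curve. -/
def IsJordanDomain (D : Set ℂ) : Prop :=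
  IsOpen D ∧ IsConnected D ∧ Bornology.IsBounded D ∧
    ∃ c : Circle → ℂ, Continuous c ∧ Function.Injective c ∧ range c = frontier D

/-- `δ` is an arc that connects a point of the closure of `D` to infinity, lies otherwise outside
the closure of `D`, and avoids the closure of `f⁻¹(ℂ \ D)`. -/
def IsCutArc (f : ℂ → ℂ) (D δ : Set ℂ) : Prop :=
  ∃ c : ℝ → ℂ, ContinuousOn c (Ici 0) ∧ InjOn c (Ici 0) ∧
    Tendsto c atTop (Bornology.cobounded ℂ) ∧ c 0 ∈ closure D ∧ (∀ t > 0, c t ∉ closure D) ∧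
    δ = c '' Ici 0 ∧ δ ⊆ (closure (f ⁻¹' Dᶜ))ᶜ

/-- `W₋₁ = ℂ \ (closure D ∪ δ)`. -/
def baseDomain (D δ : Set ℂ) : Set ℂ := (closure D ∪ δ)ᶜ

/-- The choice of `D` and `δ` is compatible with the tails `γ z`, `z ∈ S_I`: `D` is a Jordan domain
containing `S(f)` and `P(f) \ I(f)`, `δ` is an arc as above, and every component of `f⁻ⁿ(W₋₁)`,
`n ≥ 1`, that contains a point `z ∈ S_I` contains the whole tail `γ z`. -/
def IsCompatibleChoice (f : ℂ → ℂ) (γ : ℂ → Set ℂ) (D δ : Set ℂ) : Prop :=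
  IsJordanDomain D ∧ singularSet f ∪ (postsingularSet f \ escapingSet f) ⊆ D ∧
    IsCutArc f D δ ∧
    ∀ n : ℕ, 1 ≤ n → ∀ z ∈ escapingSingularSet f, z ∈ f^[n] ⁻¹' baseDomain D δ →
      γ z ⊆ connectedComponentIn (f^[n] ⁻¹' baseDomain D δ) z

/-! ### Fundamental hands -/

/-- The union of the tails `γ z` over the points `z ∈ V ∩ S_I`. -/
def tailsOver (f : ℂ → ℂ) (γ : ℂ → Set ℂ) (V : Set ℂ) : Set ℂ :=
  ⋃ z ∈ V ∩ escapingSingularSet f, γ z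

/-- `handStage f γ W n` is the set `W_{n-1}` (so the index is shifted by one): `W_{-1} = W` and
`W_n = f⁻¹(W_{n-1} \ X_n)`, where `X_n` is the union of the tails `γ z` over
`z ∈ W_{n-1} ∩ S_I`. -/
def handStage (f : ℂ → ℂ) (γ : ℂ → Set ℂ) (W : Set ℂ) : ℕ → Set ℂ
  | 0 => W
  | n + 1 => f ⁻¹' (handStage f γ W n \ tailsOver f γ (handStage f γ W n))

/-- `X_n`: the union of the tails `γ z` over `z ∈ W_{n-1} ∩ S_I`. -/
def removedTails (f : ℂ → ℂ) (γ : ℂ → Set ℂ) (W : Set ℂ) (n : ℕ) : Set ℂ :=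
  tailsOver f γ (handStage f γ W n)

/-- `U` is a connected component of the set `V`. -/
def IsComponentOf (U V : Set ℂ) : Prop := ∃ z ∈ V, U = connectedComponentIn V z

/-- `τ` is a fundamental hand of level `n`: a connected component of `W_n`. -/
def IsFundamentalHand (f : ℂ → ℂ) (γ : ℂ → Set ℂ) (W : Set ℂ) (n : ℕ) (τ : Set ℂ) : Prop :=
  IsComponentOf τ (handStage f γ W (n + 1))

/-! Hands arise by alternately deleting tails and taking preimages under `f`, so the point is that
neither operation destroys simple connectivity. The sets involved have many components; simple
connectivity of all of them at once is encoded by `HasLogBranches`. This property passes to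
intersections, holds for every set whose complement is a union of unbounded connected sets
(`hasLogBranches_of_unbounded`), hence for the base domain and for the complement of the tails, and
makes the components of an open set simply connected
(`HasLogBranches.isSimplyConnected_connectedComponentIn`).

The set W_{n-1} \ X_n contains no singular value: an escaping one lies on its own deleted tail, and
a nonescaping one has its orbit in D after passing to P(f) \ I(f). Paths off S(f) lift through `f`,
so over each simply connected component there are inverse branches (`exists_inverse_branch`). Thus
`f` maps every component of W_n homeomorphically onto a component of W_{n-1} \ X_n, and W_n inherits
logarithm branches (`hasLogBranches_preimage`).

For unboundedness, let C be a bounded component of W_{n-1} \ X_n. Then f^n(C) contains a whole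
component of W_{-1} \ Z, where Z is the finite union of the forward images of the deleted tails. The
set Z is closed, escapes uniformly, and by the compatibility of D and δ is disjoint from the closure
of D and from δ. By Borsuk's criterion, logarithms on the disjoint closed sets ∂D ∪ δ and Z glue and
exclude bounded components of W_{-1} \ Z (`not_isBounded_component_baseDomain_diff`). A bounded hand
would have a bounded image, so hands are unbounded too.

That Z separates nothing from infinity is where class B enters: tracts are parametrised injectively
by half-planes, which gives expansion near infinity (`norm_le_of_lt_norm`); consequently no open set
escapes uniformly (`ClassB.not_escapesUniformly`), while a bounded complementary component of Z
would do so. -/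

/-! ### Continuous logarithms in the plane -/

/-- Over every compact subset of `S`, and for every point `c` outside `S`, the function
`z ↦ z - c` has a continuous logarithm. -/
def HasLogBranches (S : Set ℂ) : Prop :=
  ∀ K ⊆ S, IsCompact K → ∀ c ∉ S, ∃ L : ℂ → ℂ, ContinuousOn L K ∧ ∀ z ∈ K, Complex.exp (L z) = z - c

/-- A point outside the intersection is outside one of the two sets, and that set supplies the
logarithm. Deleting tails from a stage is such an intersection. -/
theorem HasLogBranches.inter {S T : Set ℂ} (hS : HasLogBranches S) (hT : HasLogBranches T) :
    HasLogBranches (S ∩ T) := by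
  intro K hK hKc c hc
  by_cases h : c ∈ S
  · exact hT K (hK.trans inter_subset_right) hKc c fun h' => hc ⟨h, h'⟩
  · exact hS K (hK.trans inter_subset_left) hKc c h

/-- Two continuous logarithms of a function on a preconnected set differ by a constant. -/
theorem log_sub_log_eq_of_isPreconnected {X : Type*} [TopologicalSpace X] {S : Set X}
    (hS : IsPreconnected S) {L M : X → ℂ} (hL : ContinuousOn L S) (hM : ContinuousOn M S)
    (h : ∀ x ∈ S, Complex.exp (L x) = Complex.exp (M x)) {x y : X} (hx : x ∈ S) (hy : y ∈ S) :
    L x - L y = M x - M y := by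
  have key := Complex.isCoveringMap_exp.eqOn_of_comp_eqOn (g₁ := L)
    (g₂ := fun z => M z + (L y - M y)) hS hL (hM.add continuousOn_const) ?_ hy (by simp)
  · have := key hx
    simp only at this
    rw [this]; ring
  · intro z hz
    have e : Complex.exp (L y - M y) = 1 := by
      rw [Complex.exp_sub, h y hy, div_self (Complex.exp_ne_zero _)]
    ext
    simp [Complex.exp_add, e, h z hz]

/-- A continuous function without zeros on a convex open set has a continuous logarithm. -/
theorem exists_continuousOn_log_of_convex {E : Type*} [NormedAddCommGroup E] [NormedSpace ℝ E]
    {U : Set E} (hU : Convex ℝ U) (hUo : IsOpen U) (hne : U.Nonempty) {g : E → ℂ}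
    (hg : ContinuousOn g U) (h0 : ∀ z ∈ U, g z ≠ 0) :
    ∃ G : E → ℂ, ContinuousOn G U ∧ ∀ z ∈ U, Complex.exp (G z) = g z := by
  have : ContractibleSpace U := hU.contractibleSpace hne
  have hs : IsSimplyConnected U := SimplyConnectedSpace.ofContractible U
  obtain ⟨G, hG, hG'⟩ := Complex.exists_continuousOn_eqOn_exp_comp hs hUo hg (by
    rintro ⟨z, hz, h⟩; exact h0 z hz h)
  exact ⟨G, hG, fun z hz => hG' hz⟩

theorem exists_continuous_log {E : Type*} [NormedAddCommGroup E] [NormedSpace ℝ E] {g : E → ℂ}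
    (hg : Continuous g) (h0 : ∀ z, g z ≠ 0) :
    ∃ G : E → ℂ, Continuous G ∧ ∀ z, Complex.exp (G z) = g z := by
  obtain ⟨G, hG, h⟩ := exists_continuousOn_log_of_convex (U := (univ : Set E)) convex_univ isOpen_univ
    univ_nonempty hg.continuousOn fun z _ => h0 z
  exact ⟨G, continuousOn_univ.1 hG, fun z => h z (mem_univ z)⟩

/-- On a circle around `a`, only the trivial power of `z - a` has a continuous logarithm. -/
theorem eq_zero_of_log_zpow_sphere {a : ℂ} {r : ℝ} (hr : 0 < r) {m : ℤ} {L : ℂ → ℂ}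
    (hL : ContinuousOn L (Metric.sphere a r))
    (h : ∀ z ∈ Metric.sphere a r, Complex.exp (L z) = (z - a) ^ m) : m = 0 := by
  have hmem : ∀ θ : ℝ, circleMap a r θ ∈ Metric.sphere a r := fun θ => circleMap_mem_sphere a hr.le θ
  have key := log_sub_log_eq_of_isPreconnected (X := ℝ) (S := univ) isPreconnected_univ
    (L := fun θ : ℝ => L (circleMap a r θ))
    (M := fun θ : ℝ => m * (Real.log r + θ * Complex.I))
    ((hL.comp_continuous (continuous_circleMap a r) hmem).continuousOn)
    (Continuous.continuousOn (by fun_prop)) (fun θ _ => by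
      have e : Complex.exp (Real.log r : ℂ) = r := by
        rw [← Complex.ofReal_exp, Real.exp_log hr]
      rw [h _ (hmem θ), Complex.exp_int_mul, Complex.exp_add, e]
      simp [circleMap]) (mem_univ (2 * Real.pi)) (mem_univ 0)
  have h2 : circleMap a r (2 * Real.pi) = circleMap a r 0 := by
    simpa using periodic_circleMap a r 0
  simp only [h2, sub_self] at key
  have : (m : ℂ) * (2 * Real.pi * Complex.I) = 0 := by
    rw [eq_comm] at key
    push_cast at key
    linear_combination key
  simpa [Real.pi_ne_zero] using this

theorem exists_continuous_extension_of_isClosed {S : Set ℂ} (hS : IsClosed S) {L : ℂ → ℂ}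
    (hL : ContinuousOn L S) : ∃ M : ℂ → ℂ, Continuous M ∧ EqOn M L S := by
  obtain ⟨g, hg⟩ := ContinuousMap.exists_restrict_eq hS ⟨_, continuousOn_iff_continuous_domRestrict.1 hL⟩
  exact ⟨g, g.continuous, fun z hz => congr($hg ⟨z, hz⟩)⟩

/-- A continuous function without zeros on the closure of a bounded open set `Y` that agrees with
`(z - a) ^ m` on the boundary, where `a ∈ Y`, forces `m = 0`. -/
theorem eq_zero_of_eqOn_frontier_zpow {Y : Set ℂ} (hY : IsOpen Y) (hYb : Bornology.IsBounded Y)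
    {a : ℂ} (ha : a ∈ Y) {m : ℤ} {F : ℂ → ℂ} (hF : ContinuousOn F (closure Y))
    (hF0 : ∀ z ∈ closure Y, F z ≠ 0) (hFm : ∀ z ∈ frontier Y, F z = (z - a) ^ m) : m = 0 := by
  classical
  -- Extending `F` by the power outside `Y` gives a zero-free function on the whole plane. It has a
  -- global logarithm, which on a large circle is a logarithm of the power.
  let G : ℂ → ℂ := fun z => if z ∈ closure Y then F z else (z - a) ^ m
  have hG1 : EqOn G F (closure Y) := fun z hz => if_pos hz
  have hG2 : EqOn G (fun z => (z - a) ^ m) Yᶜ := by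
    intro z hz
    by_cases hz' : z ∈ closure Y
    · rw [hG1 hz']
      exact hFm z ⟨hz', by rwa [hY.interior_eq]⟩
    · exact if_neg hz'
  have hne : ∀ z ∈ Yᶜ, z - a ≠ 0 := fun z hz h => hz (by rwa [sub_eq_zero.1 h])
  have hcont : Continuous G := by
    have h1 : ContinuousOn G (closure Y) := hF.congr hG1
    have h2 : ContinuousOn G Yᶜ :=
      ContinuousOn.congr (fun z hz => ((continuous_id.sub continuous_const).continuousAt.zpow₀ m
        (Or.inl (hne z hz))).continuousWithinAt) hG2
    have h3 := h1.union_of_isClosed h2 isClosed_closure hY.isClosed_compl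
    have hu : closure Y ∪ Yᶜ = univ :=
      eq_univ_of_forall fun z => (em (z ∈ Y)).imp (fun h => subset_closure h) id
    rwa [hu, continuousOn_univ] at h3
  have hG0 : ∀ z, G z ≠ 0 := by
    intro z
    by_cases hz : z ∈ closure Y
    · rw [hG1 hz]; exact hF0 z hz
    · have hz' : z ∈ Yᶜ := fun h => hz (subset_closure h)
      rw [hG2 hz']; exact zpow_ne_zero _ (hne z hz')
  obtain ⟨H, hH, hHe⟩ := exists_continuous_log hcont hG0
  obtain ⟨r, hr⟩ := hYb.subset_ball a
  have hr0 : 0 < r := Metric.pos_of_mem_ball (hr ha)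
  refine eq_zero_of_log_zpow_sphere (a := a) (L := H) hr0 hH.continuousOn (fun z hz => ?_)
  rw [hHe]
  refine hG2 fun h => ?_
  have := hr h
  rw [Metric.mem_ball] at this
  rw [Metric.mem_sphere] at hz
  exact this.ne hz

/-- **Borsuk's separation criterion**: for a bounded open set `Y` and `a ∈ Y` there is no continuous
logarithm of `z - a` on the boundary of `Y`. -/
theorem not_exists_log_frontier {Y : Set ℂ} (hY : IsOpen Y) (hYb : Bornology.IsBounded Y)
    {a : ℂ} (ha : a ∈ Y) {L : ℂ → ℂ} (hL : ContinuousOn L (frontier Y)) :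
    ¬ ∀ z ∈ frontier Y, Complex.exp (L z) = z - a := by
  intro h
  -- A Tietze extension of the logarithm makes `exp ∘ M` a zero-free extension of z - a from the
  -- boundary: the case m = 1.
  obtain ⟨M, hM, hML⟩ := exists_continuous_extension_of_isClosed isClosed_frontier hL
  have := eq_zero_of_eqOn_frontier_zpow hY hYb ha (m := 1) (F := fun z => Complex.exp (M z))
    (by fun_prop) (fun _ _ => Complex.exp_ne_zero _) (fun z hz => by simp [hML hz, h z hz])
  exact one_ne_zero this

theorem isCompact_frontier_of_isBounded {Y : Set ℂ} (hYb : Bornology.IsBounded Y) :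
    IsCompact (frontier Y) :=
  hYb.isCompact_closure.of_isClosed_subset isClosed_frontier frontier_subset_closure

/-- A point of `Y` outside `S` would contradict Borsuk's criterion. Applied to `S` = {R < |f|}, this
acts as a minimum principle for |f|. -/
theorem HasLogBranches.subset_of_frontier_subset {S Y : Set ℂ} (hS : HasLogBranches S)
    (hY : IsOpen Y) (hYb : Bornology.IsBounded Y) (hfr : frontier Y ⊆ S) : Y ⊆ S := by
  intro a ha
  by_contra haS
  obtain ⟨L, hL, hLe⟩ := hS _ hfr (isCompact_frontier_of_isBounded hYb) a haS
  exact not_exists_log_frontier hY hYb ha hL hLe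

/-- If every point outside `S` is joined to infinity by a preconnected unbounded set outside `S`,
then `S` has logarithm branches. -/
theorem hasLogBranches_of_unbounded {S : Set ℂ}
    (h : ∀ c ∉ S, ∃ C ⊆ Sᶜ, IsPreconnected C ∧ c ∈ C ∧ ¬ Bornology.IsBounded C) :
    HasLogBranches S := by
  intro K hK hKc c hc
  obtain ⟨C, hCS, hC, hcC, hCb⟩ := h c hc
  let P : ℂ → Prop := fun c =>
    ∃ L : ℂ → ℂ, ContinuousOn L K ∧ ∀ z ∈ K, Complex.exp (L z) = z - c
  -- The quotient (z - c₁)/(z - c₀) lies within distance 1 of 1, so its principal logarithm corrects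
  -- `L`.
  have step : ∀ c₀ c₁ : ℂ, (∀ z ∈ K, ‖c₁ - c₀‖ < ‖z - c₀‖) → P c₀ → P c₁ := by
    rintro c₀ c₁ hlt ⟨L, hL, hLe⟩
    have hne : ∀ z ∈ K, z - c₀ ≠ 0 := fun z hz => by
      rw [← norm_pos_iff]; exact (norm_nonneg _).trans_lt (hlt z hz)
    have hslit : ∀ z ∈ K, 1 + (c₀ - c₁) / (z - c₀) ∈ Complex.slitPlane := fun z hz =>
      Complex.mem_slitPlane_of_norm_lt_one (by
        rw [norm_div, norm_sub_rev c₀ c₁, div_lt_one ((norm_nonneg _).trans_lt (hlt z hz))]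
        exact hlt z hz)
    refine ⟨fun z => L z + Complex.log (1 + (c₀ - c₁) / (z - c₀)), hL.add ?_, fun z hz => ?_⟩
    · refine ContinuousOn.clog ?_ hslit
      exact continuousOn_const.add (continuousOn_const.div (by fun_prop) hne)
    · rw [Complex.exp_add, hLe z hz, Complex.exp_log (Complex.slitPlane_ne_zero (hslit z hz))]
      have := hne z hz
      field_simp
      ring
  -- Off `K`, having a logarithm and lacking one are both open conditions. The connected set `C`
  -- therefore carries the logarithm from a point far away, where z - c' = -c'(1 - z/c'), back to
  -- `c`.
  have hopen : IsOpen {c | c ∉ K ∧ P c} := by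
    rw [Metric.isOpen_iff]
    rintro c ⟨hcK, hcP⟩
    obtain ⟨ε, hε, hball⟩ := Metric.isOpen_iff.1 hKc.isClosed.isOpen_compl c hcK
    refine ⟨ε, hε, fun c' hc' => ⟨hball hc', step c c' (fun z hz => ?_) hcP⟩⟩
    have h1 : ε ≤ dist z c := not_lt.1 fun h => hball (Metric.mem_ball.2 h) hz
    rw [← dist_eq_norm, ← dist_eq_norm]
    exact (Metric.mem_ball.1 hc').trans_le h1
  have hopen' : IsOpen {c | c ∉ K ∧ ¬ P c} := by
    rw [Metric.isOpen_iff]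
    rintro c ⟨hcK, hcP⟩
    obtain ⟨ε, hε, hball⟩ := Metric.isOpen_iff.1 hKc.isClosed.isOpen_compl c hcK
    -- Here the moving point is the centre of comparison; halving the radius keeps `K` at distance
    -- at least ε/2 from it.
    refine ⟨ε / 2, half_pos hε, fun c' hc' => ⟨hball (Metric.ball_subset_ball (by linarith) hc'),
      fun hP => hcP (step c' c (fun z hz => ?_) hP)⟩⟩
    have h1 : ε ≤ dist z c := not_lt.1 fun h => hball (Metric.mem_ball.2 h) hz
    have h2 := Metric.mem_ball.1 hc'
    have h3 := dist_triangle z c' c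
    rw [← dist_eq_norm, ← dist_eq_norm, dist_comm c c']
    linarith
  obtain ⟨R, hR⟩ := hKc.isBounded.exists_norm_le
  obtain ⟨c', hc'C, hc'R⟩ : ∃ c' ∈ C, max R 0 < ‖c'‖ := by
    by_contra! hcon
    exact hCb (Bornology.IsBounded.subset (Metric.isBounded_closedBall (x := (0 : ℂ)) (r := max R 0))
      fun z hz => by simpa using hcon z hz)
  have hPc' : P c' := by
    have hc'0 : c' ≠ 0 := norm_pos_iff.1 ((le_max_right _ _).trans_lt hc'R)
    have hslit : ∀ z ∈ K, 1 + -(z / c') ∈ Complex.slitPlane := fun z hz =>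
      Complex.mem_slitPlane_of_norm_lt_one (by
        rw [norm_neg, norm_div, div_lt_one (norm_pos_iff.2 hc'0)]
        exact ((hR z hz).trans (le_max_left _ _)).trans_lt hc'R)
    refine ⟨fun z => Complex.log (-c') + Complex.log (1 + -(z / c')),
      continuousOn_const.add (ContinuousOn.clog (by fun_prop) hslit), fun z hz => ?_⟩
    rw [Complex.exp_add, Complex.exp_log (neg_ne_zero.2 hc'0),
      Complex.exp_log (Complex.slitPlane_ne_zero (hslit z hz))]
    field_simp
    ring
  by_contra hPc
  have hcov : C ⊆ {c | c ∉ K ∧ P c} ∪ {c | c ∉ K ∧ ¬ P c} := fun x hx => by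
    have : x ∉ K := fun h => hCS hx (hK h)
    by_cases hp : P x
    · exact Or.inl ⟨this, hp⟩
    · exact Or.inr ⟨this, hp⟩
  have hnK : ∀ x ∈ C, x ∉ K := fun x hx h => hCS hx (hK h)
  obtain ⟨x, _, hx1, hx2⟩ := hC _ _ hopen hopen' hcov ⟨c', hc'C, hnK _ hc'C, hPc'⟩
    ⟨c, hcC, hnK _ hcC, hPc⟩
  exact hx2.2 hx1.2

/-! ### Logarithms on Jordan curves and arcs -/

theorem exists_continuousOn_glue {X Y : Type*} [TopologicalSpace X] [TopologicalSpace Y]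
    {A B : Set X} (hA : IsClosed A) (hB : IsClosed B) {f g : X → Y}
    (hf : ContinuousOn f A) (hg : ContinuousOn g B) (h : EqOn f g (A ∩ B)) :
    ∃ k : X → Y, ContinuousOn k (A ∪ B) ∧ EqOn k f A ∧ EqOn k g B := by
  classical
  have h1 : EqOn (fun z => if z ∈ A then f z else g z) f A := fun z hz => if_pos hz
  have h2 : EqOn (fun z => if z ∈ A then f z else g z) g B := by
    intro z hz
    by_cases hz' : z ∈ A
    · rw [h1 hz', h ⟨hz', hz⟩]
    · exact if_neg hz'
  exact ⟨_, (hf.congr h1).union_of_isClosed (hg.congr h2) hA hB, h1, h2⟩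

/-- A periodic function descends to a Jordan curve. -/
theorem exists_continuous_comp_circle_eq {c : Circle → ℂ} (hc : Continuous c)
    (hinj : Function.Injective c) {H : ℝ → ℂ} (hH : Continuous H)
    (hper : Function.Periodic H (2 * Real.pi)) :
    ∃ h : ℂ → ℂ, Continuous h ∧ ∀ θ, h (c (Circle.exp θ)) = H θ := by
  have hq := Circle.isCoveringMap_exp.isQuotientMap Circle.exp_surjective
  have hfac : Function.FactorsThrough H Circle.exp := by
    intro x y hxy
    obtain ⟨m, hm⟩ := Circle.exp_eq_exp.1 hxy
    rw [hm]
    exact hper.int_mul m y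
  let g := hq.lift (f := ⟨Circle.exp, Circle.exp.continuous⟩) ⟨H, hH⟩ hfac
  have hg : ∀ θ, g (Circle.exp θ) = H θ := fun θ =>
    congr($(hq.lift_comp (f := ⟨Circle.exp, Circle.exp.continuous⟩) ⟨H, hH⟩ hfac) θ)
  obtain ⟨h, hh⟩ := ContinuousMap.exists_extension (hc.isClosedEmbedding hinj) g
  exact ⟨h, h.continuous, fun θ => by rw [← hg]; exact congr($hh (Circle.exp θ))⟩

/-- A point outside the closure of a Jordan domain is not separated by the boundary curve from
infinity: there is a logarithm of `z - a` along the curve. -/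
theorem IsJordanDomain.exists_log_frontier {D : Set ℂ} (hD : IsJordanDomain D) {a : ℂ}
    (ha : a ∉ closure D) :
    ∃ L : ℂ → ℂ, Continuous L ∧ ∀ z ∈ frontier D, Complex.exp (L z) = z - a := by
  obtain ⟨hDo, ⟨⟨d, hd⟩, -⟩, hDb, c, hc, hinj, hrange⟩ := hD
  have hcf : ∀ θ : ℝ, c (Circle.exp θ) ∈ frontier D := fun θ => hrange ▸ mem_range_self _
  have hγ : Continuous fun θ : ℝ => c (Circle.exp θ) := hc.comp Circle.exp.continuous
  -- The integer m is the winding number of the boundary curve about b.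
  have main : ∀ b ∉ frontier D, ∃ (l : ℝ → ℂ) (m : ℤ), Continuous l ∧
      (∀ θ, Complex.exp (l θ) = c (Circle.exp θ) - b) ∧
      ∀ θ, l (θ + 2 * Real.pi) - l θ = m * (2 * Real.pi * Complex.I) := by
    intro b hb
    obtain ⟨l, hl, hle⟩ := exists_continuous_log
      (g := fun θ : ℝ => c (Circle.exp θ) - b) (hγ.sub continuous_const) (fun θ => sub_ne_zero.2 fun h => hb (h ▸ hcf θ))
    have hexp : ∀ θ, Complex.exp (l (θ + 2 * Real.pi)) = Complex.exp (l θ) := fun θ => by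
      rw [hle, hle, Circle.exp_add, Circle.exp_two_pi, mul_one]
    obtain ⟨m, hm⟩ := Complex.exp_eq_exp_iff_exists_int.1 (hexp 0)
    refine ⟨l, m, hl, hle, fun θ => ?_⟩
    have := log_sub_log_eq_of_isPreconnected (isPreconnected_univ (α := ℝ))
      (L := fun θ => l (θ + 2 * Real.pi)) (M := l) (Continuous.continuousOn (by fun_prop))
      hl.continuousOn (fun θ _ => hexp θ) (mem_univ θ) (mem_univ 0)
    linear_combination this + hm
  obtain ⟨l, m, hl, hle, hlm⟩ := main a fun h => ha (frontier_subset_closure h)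
  obtain ⟨l', k, hl', hle', hlk⟩ := main d fun h => h.2 (by rwa [hDo.interior_eq])
  -- With m, k the winding numbers about `a` and about `d ∈ D`, the combination m·l' - k·l is
  -- periodic, so (z - d)^m = exp(h)(z - a)^k on the curve. The right side is zero-free on the
  -- closure of `D`, which forces m = 0 without knowing k.
  have hm : m = 0 := by
    obtain ⟨h, hh, hhe⟩ := exists_continuous_comp_circle_eq hc hinj
      (H := fun θ => m * l' θ - k * l θ) (by fun_prop) (fun θ => by
        have h1 := hlm θ
        have h2 := hlk θ
        linear_combination (m : ℂ) * h2 - (k : ℂ) * h1)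
    refine eq_zero_of_eqOn_frontier_zpow hDo hDb hd (m := m)
      (F := fun z => Complex.exp (h z) * (z - a) ^ k) ?_ ?_ ?_
    · refine (by fun_prop : ContinuousOn (fun z => Complex.exp (h z)) _).mul fun z hz => ?_
      exact ((continuous_id.sub continuous_const).continuousAt.zpow₀ k
        (Or.inl (sub_ne_zero.2 (ne_of_mem_of_not_mem hz ha)))).continuousWithinAt
    · exact fun z hz => mul_ne_zero (Complex.exp_ne_zero _)
        (zpow_ne_zero _ (sub_ne_zero.2 (ne_of_mem_of_not_mem hz ha)))
    · intro z hz
      rw [← hrange] at hz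
      obtain ⟨w, rfl⟩ := hz
      obtain ⟨θ, rfl⟩ := Circle.exp_surjective w
      rw [hhe, ← hle θ, ← hle' θ, ← Complex.exp_int_mul, ← Complex.exp_int_mul, ← Complex.exp_add]
      ring_nf
  obtain ⟨L, hL, hLe⟩ := exists_continuous_comp_circle_eq hc hinj hl (fun θ => by
    have h1 := hlm θ
    rw [hm] at h1
    linear_combination h1)
  refine ⟨L, hL, fun z hz => ?_⟩
  rw [← hrange] at hz
  obtain ⟨w, rfl⟩ := hz
  obtain ⟨θ, rfl⟩ := Circle.exp_surjective w
  rw [hLe, hle]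

/-- Tending to infinity makes the curve proper, hence a closed map. This yields closedness of arcs
and tails and lets functions of the parameter be extended to the plane. -/
theorem isClosedEmbedding_of_tendsto_cobounded {c : ℝ → ℂ} {t₀ : ℝ} (hc : ContinuousOn c (Ici t₀))
    (hinj : InjOn c (Ici t₀)) (ht : Tendsto c atTop (Bornology.cobounded ℂ)) :
    IsClosedEmbedding (fun t : Ici t₀ => c t) := by
  have hcont : Continuous (fun t : Ici t₀ => c t) := continuousOn_iff_continuous_domRestrict.1 hc
  refine .of_continuous_injective_isClosedMap hcont (fun x y h => Subtype.ext (hinj x.2 y.2 h)) ?_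
  refine IsProperMap.isClosedMap (isProperMap_iff_tendsto_cocompact.2 ⟨hcont, ?_⟩)
  rw [← Metric.cobounded_eq_cocompact (α := ℂ)]
  intro s hs
  obtain ⟨T, hT⟩ := mem_atTop_sets.1 (ht hs)
  rw [Filter.mem_map, mem_cocompact]
  refine ⟨Subtype.val ⁻¹' Icc t₀ T, ?_, fun t htm => ?_⟩
  · rw [Subtype.isCompact_iff, Subtype.image_preimage_coe]
    exact isCompact_Icc.inter_left isClosed_Ici
  · refine hT _ ?_
    by_contra hlt
    exact htm ⟨t.2, (not_le.1 hlt).le⟩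

theorem image_Ici_eq_range {c : ℝ → ℂ} {t₀ : ℝ} : c '' Ici t₀ = range (fun t : Ici t₀ => c t) := by
  rw [image_eq_range]

theorem IsCutArc.isClosed {f : ℂ → ℂ} {D δ : Set ℂ} (h : IsCutArc f D δ) : IsClosed δ := by
  obtain ⟨c, hc, hinj, ht, -, -, rfl, -⟩ := h
  rw [image_Ici_eq_range]
  exact (isClosedEmbedding_of_tendsto_cobounded hc hinj ht).isClosed_range

/-- A Jordan curve with an arc to infinity attached does not separate the points outside. -/
theorem IsJordanDomain.exists_log_frontier_union {f : ℂ → ℂ} {D δ : Set ℂ} (hD : IsJordanDomain D)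
    (hδ : IsCutArc f D δ) {a : ℂ} (ha : a ∉ closure D ∪ δ) :
    ∃ L : ℂ → ℂ, ContinuousOn L (frontier D ∪ δ) ∧
      ∀ z ∈ frontier D ∪ δ, Complex.exp (L z) = z - a := by
  have hδc := hδ.isClosed
  obtain ⟨L, hL, hLe⟩ := hD.exists_log_frontier fun h => ha (Or.inl h)
  obtain ⟨c, hc, hinj, ht, hc0, hc1, rfl, -⟩ := hδ
  have hDo := hD.1
  have hc0' : c 0 ∈ frontier D := by
    refine ⟨hc0, fun h => ?_⟩
    have h1 : ∀ᶠ t in 𝓝[>] (0 : ℝ), c t ∈ interior D :=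
      ((hc 0 self_mem_Ici).mono Ioi_subset_Ici_self) (isOpen_interior.mem_nhds h)
    obtain ⟨t, ht1, ht2⟩ := (h1.and self_mem_nhdsWithin).exists
    exact hc1 t ht2 (subset_closure (interior_subset ht1))
  have hg : Continuous fun t : ℝ => c (max t 0) - a :=
    (hc.comp_continuous (by fun_prop) fun t => mem_Ici.2 (le_max_right _ _)).sub continuous_const
  obtain ⟨M, hM, hMe⟩ := exists_continuous_log hg fun t => sub_ne_zero.2 fun h =>
    ha (Or.inr ⟨_, le_max_right t 0, h⟩)
  -- The logarithm along the arc is shifted by a constant to agree with `L` at the attaching point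
  -- `c 0`, the only point common to the arc and the boundary curve.
  obtain ⟨N, hN⟩ := ContinuousMap.exists_extension
    (isClosedEmbedding_of_tendsto_cobounded hc hinj ht)
    ⟨fun t : Ici (0 : ℝ) => M t - M 0 + L (c 0), by fun_prop⟩
  have hN' : ∀ t ∈ Ici (0 : ℝ), N (c t) = M t - M 0 + L (c 0) := fun t ht => congr($hN ⟨t, ht⟩)
  obtain ⟨k, hk, hk1, hk2⟩ := exists_continuousOn_glue (isClosed_frontier (s := D)) hδc
    hL.continuousOn N.continuous.continuousOn (by
      rintro z ⟨hz, t, ht, rfl⟩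
      obtain rfl : t = 0 := by
        by_contra h
        exact hc1 t (lt_of_le_of_ne ht (Ne.symm h)) (frontier_subset_closure hz)
      rw [hN' 0 self_mem_Ici]
      ring)
  refine ⟨k, hk, ?_⟩
  rintro z (hz | ⟨t, ht, rfl⟩)
  · rw [hk1 hz, hLe z hz]
  · have h0 := hMe 0
    have h1 := hMe t
    rw [max_self] at h0
    rw [max_eq_left ht] at h1
    rw [hk2 ⟨t, ht, rfl⟩, hN' t ht, Complex.exp_add, Complex.exp_sub, h0, h1, hLe _ hc0',
      div_mul_cancel₀]
    exact sub_ne_zero.2 fun h => ha (Or.inr ⟨0, self_mem_Ici, h⟩)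

/-! ### Lifting through an entire function away from its singular values -/

theorem deriv_ne_zero_of_notMem_singularSet {f : ℂ → ℂ} {z : ℂ} (h : f z ∉ singularSet f) :
    deriv f z ≠ 0 := fun h' => h (subset_closure (Or.inl ⟨z, h', rfl⟩))

theorem isOpen_preimage_compl_singularSet {f : ℂ → ℂ} (hf : Differentiable ℂ f) :
    IsOpen (f ⁻¹' (singularSet f)ᶜ) :=
  isClosed_closure.isOpen_compl.preimage hf.continuous

theorem isLocalHomeomorphOn_compl_singularSet {f : ℂ → ℂ} (hf : Differentiable ℂ f) :
    IsLocalHomeomorphOn f (f ⁻¹' (singularSet f)ᶜ) := by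
  intro z hz
  have h1 : HasStrictDerivAt f (deriv f z) z := (hf.analyticAt z).hasStrictDerivAt
  have h2 := h1.hasStrictFDerivAt_equiv (deriv_ne_zero_of_notMem_singularSet hz)
  exact ⟨h2.toOpenPartialHomeomorph f, h2.mem_toOpenPartialHomeomorph_source, rfl⟩

/-- The restriction of `f` to the preimage of the complement of its singular set. -/
def unramifiedMap (f : ℂ → ℂ) (z : ↥(f ⁻¹' (singularSet f)ᶜ)) : ℂ := f z

theorem isLocalHomeomorph_unramifiedMap {f : ℂ → ℂ} (hf : Differentiable ℂ f) :
    IsLocalHomeomorph (unramifiedMap f) := by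
  rw [isLocalHomeomorph_iff_isLocalHomeomorphOn_univ]
  exact (isLocalHomeomorphOn_compl_singularSet hf).comp
    (isOpen_preimage_compl_singularSet hf).isOpenEmbedding_subtypeVal.isLocalHomeomorph.isLocalHomeomorphOn
    (fun z _ => z.2)

theorem isSeparatedMap_unramifiedMap (f : ℂ → ℂ) : IsSeparatedMap (unramifiedMap f) :=
  T2Space.isSeparatedMap _

/-- Uniqueness of lifts through `f` outside the singular set. -/
theorem eqOn_of_comp_eqOn_of_notMem_singularSet {f : ℂ → ℂ} (hf : Differentiable ℂ f)
    {X : Type*} [TopologicalSpace X] {T : Set X} (hT : IsPreconnected T) {g₁ g₂ : X → ℂ}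
    (h₁ : ContinuousOn g₁ T) (h₂ : ContinuousOn g₂ T) (h : EqOn (f ∘ g₁) (f ∘ g₂) T)
    (hs : ∀ x ∈ T, f (g₁ x) ∉ singularSet f) {a : X} (ha : a ∈ T) (hga : g₁ a = g₂ a) :
    EqOn g₁ g₂ T := by
  have := Subtype.preconnectedSpace hT
  have hs' : ∀ x ∈ T, f (g₂ x) ∉ singularSet f := fun x hx => by
    have : f (g₁ x) = f (g₂ x) := h hx
    rw [← this]; exact hs x hx
  let G₁ : T → ↥(f ⁻¹' (singularSet f)ᶜ) := fun x => ⟨g₁ x, hs x x.2⟩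
  let G₂ : T → ↥(f ⁻¹' (singularSet f)ᶜ) := fun x => ⟨g₂ x, hs' x x.2⟩
  have key : G₁ = G₂ := (isSeparatedMap_unramifiedMap f).eq_of_comp_eq
    (isLocalHomeomorph_unramifiedMap hf).isLocallyInjective
    ((continuousOn_iff_continuous_domRestrict.1 h₁).subtype_mk _)
    ((continuousOn_iff_continuous_domRestrict.1 h₂).subtype_mk _)
    (funext fun x => h x.2) ⟨a, ha⟩ (Subtype.ext hga)
  exact fun x hx => congr($key ⟨x, hx⟩)

/-- A lift of a path on a half-open interval converges at the end point, because the end point is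
not an asymptotic value. -/
theorem exists_tendsto_lift {f : ℂ → ℂ} (hf : Differentiable ℂ f) {b G : ℝ → ℂ} {T : ℝ} (hT : 0 < T)
    (hb : ContinuousAt b T) (hbT : b T ∉ singularSet f) (hG : ContinuousOn G (Ico 0 T))
    (hGb : ∀ t ∈ Ico 0 T, f (G t) = b t) : ∃ w, f w = b T ∧ Tendsto G (𝓝[<] T) (𝓝 w) := by
  have hfG : Tendsto (fun t => f (G t)) (𝓝[<] T) (𝓝 (b T)) := by
    refine (hb.tendsto.mono_left nhdsWithin_le_nhds).congr' ?_
    filter_upwards [Ico_mem_nhdsLT hT] with t ht using (hGb t ht).symm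
  -- If the lift tended to infinity, its reparametrisation over [0, ∞) would exhibit `b T` as an
  -- asymptotic value.
  have hncob : ¬ Tendsto G (𝓝[<] T) (Bornology.cobounded ℂ) := by
    intro hGc
    have hmaps : MapsTo (fun s : ℝ => T * (1 - (1 + s)⁻¹)) (Ici 0) (Ico 0 T) := by
      intro s hs
      have hs : 0 ≤ s := hs
      have h1 : 0 < (1 + s)⁻¹ := by positivity
      have h2 : (1 + s)⁻¹ ≤ 1 := inv_le_one_of_one_le₀ (by linarith)
      constructor <;> nlinarith
    have hlim : Tendsto (fun s : ℝ => T * (1 - (1 + s)⁻¹)) atTop (𝓝[<] T) := by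
      refine tendsto_nhdsWithin_iff.2 ⟨?_, ?_⟩
      · have : Tendsto (fun s : ℝ => (1 + s)⁻¹) atTop (𝓝 0) :=
          tendsto_inv_atTop_zero.comp (tendsto_atTop_add_const_left _ _ tendsto_id)
        simpa using (this.const_sub 1).const_mul T
      · filter_upwards [eventually_ge_atTop 0] with s hs using (hmaps hs).2
    refine hbT (subset_closure (Or.inr
      ⟨fun s => G (T * (1 - (1 + s)⁻¹)), hG.comp ?_ hmaps, hGc.comp hlim, hfG.comp hlim⟩))
    refine continuousOn_const.mul (continuousOn_const.sub (ContinuousOn.inv₀ (by fun_prop) ?_))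
    intro s hs
    have hs : 0 ≤ s := hs
    positivity
  obtain ⟨M, hM⟩ : ∃ M : ℝ, ∃ᶠ t in 𝓝[<] T, G t ∈ Metric.closedBall 0 M := by
    by_contra! hcon
    refine hncob ?_
    rw [← tendsto_norm_atTop_iff_cobounded, tendsto_atTop]
    intro M
    filter_upwards [hcon M] with t ht
    simpa using (not_le.1 fun h => ht (by simpa using h)).le
  obtain ⟨w, -, hw⟩ := (isCompact_closedBall (0 : ℂ) M).exists_mapClusterPt_of_frequently hM
  have hfw : f w = b T := by
    have h1 : MapClusterPt (f w) (𝓝[<] T) (fun t => f (G t)) :=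
      hw.continuousAt_comp hf.continuous.continuousAt
    by_contra hne
    obtain ⟨u, v, hu, hv, hwu, hbv, huv⟩ := t2_separation hne
    obtain ⟨t, ht1, ht2⟩ := ((h1.frequently (hu.mem_nhds hwu)).and_eventually
      (hfG (hv.mem_nhds hbv))).exists
    exact huv.le_bot ⟨ht1, ht2⟩
  refine ⟨w, hfw, ?_⟩
  -- The cluster point `w` is isolated in its fibre, so small circles about it miss that fibre. Near
  -- time `T` the lift avoids such a circle, yet it visits the disc inside; hence it is trapped
  -- there.
  have hd : deriv f w ≠ 0 := deriv_ne_zero_of_notMem_singularSet (hfw ▸ hbT)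
  have hne : ∀ᶠ z in 𝓝[≠] w, f z ≠ f w := (hf w).hasDerivAt.eventually_ne hd
  obtain ⟨r, hr, hball⟩ := Metric.mem_nhdsWithin_iff.1 hne
  rw [Metric.tendsto_nhds]
  intro ε₀ hε₀
  obtain ⟨ε, hε, hεr, hεε⟩ : ∃ ε > 0, ε < r ∧ ε ≤ ε₀ :=
    ⟨min (r / 2) ε₀, by positivity, (min_le_left _ _).trans_lt (by linarith), min_le_right _ _⟩
  have hsph : ∀ z ∈ Metric.sphere w ε, f z ≠ b T := fun z hz => hfw ▸ hball
    ⟨Metric.mem_ball.2 ((Metric.mem_sphere.1 hz).trans_lt hεr), fun h => by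
      rw [mem_singleton_iff.1 h, Metric.mem_sphere, dist_self] at hz
      exact hε.ne hz⟩
  have hout : ∀ᶠ t in 𝓝[<] T, G t ∉ Metric.sphere w ε := by
    have hcl : IsClosed (f '' Metric.sphere w ε) :=
      ((isCompact_sphere w ε).image hf.continuous).isClosed
    filter_upwards [hfG (hcl.isOpen_compl.mem_nhds fun ⟨z, hz, h⟩ => hsph z hz h)] with t ht h
    exact ht ⟨_, h, rfl⟩
  obtain ⟨t₁, ht₁, hout⟩ := (mem_nhdsLT_iff_exists_mem_Ico_Ioo_subset hT).1
    (hout : {t | G t ∉ Metric.sphere w ε} ∈ _)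
  obtain ⟨t₂, ht₂, ht₂'⟩ := ((hw.frequently (Metric.ball_mem_nhds w hε)).and_eventually
    (Ioo_mem_nhdsLT ht₁.2)).exists
  filter_upwards [Ioo_mem_nhdsLT ht₂'.2] with t ht
  refine lt_of_lt_of_le ?_ hεε
  by_contra hge
  have hGt : ContinuousOn G (Icc t₂ t) :=
    hG.mono fun s hs => ⟨ht₁.1.trans (ht₂'.1.le.trans hs.1), hs.2.trans_lt ht.2⟩
  have hcont : ContinuousOn (fun t => dist (G t) w) (Icc t₂ t) := by fun_prop
  obtain ⟨s, hs, hse⟩ := intermediate_value_Icc ht.1.le hcont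
    (⟨(Metric.mem_ball.1 ht₂).le, not_lt.1 hge⟩ : ε ∈ Icc _ _)
  exact hout ⟨ht₂'.1.trans_le hs.1, hs.2.trans_lt ht.2⟩ hse

/-- Paths that avoid the singular set can be lifted through `f`. -/
theorem exists_lift_Icc {f : ℂ → ℂ} (hf : Differentiable ℂ f) {b : ℝ → ℂ} (hb : Continuous b)
    (hbS : ∀ t, b t ∉ singularSet f) {z₀ : ℂ} (hz₀ : f z₀ = b 0) :
    ∃ g : ℝ → ℂ, ContinuousOn g (Icc 0 1) ∧ (∀ t ∈ Icc (0 : ℝ) 1, f (g t) = b t) ∧ g 0 = z₀ := by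
  -- Continuity method: the times up to which a lift exists include their supremum by
  -- `exists_tendsto_lift`, and a local inverse of `f` extends the lift past any supremum below 1.
  let B : Set ℝ := {T | T ∈ Icc (0 : ℝ) 1 ∧ ∃ g : ℝ → ℂ, ContinuousOn g (Icc 0 T) ∧
    (∀ t ∈ Icc (0 : ℝ) T, f (g t) = b t) ∧ g 0 = z₀}
  have h0B : (0 : ℝ) ∈ B := by
    refine ⟨⟨le_rfl, zero_le_one⟩, fun _ => z₀, continuousOn_const, fun t ht => ?_, rfl⟩
    rw [Icc_self, mem_singleton_iff] at ht
    rw [ht, hz₀]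
  have hBbdd : BddAbove B := ⟨1, fun T hT => hT.1.2⟩
  set T := sSup B with hTdef
  have hT0 : 0 ≤ T := le_csSup hBbdd h0B
  have hT1 : T ≤ 1 := csSup_le ⟨0, h0B⟩ fun T hT => hT.1.2
  have hTB : T ∈ B := by
    rcases hT0.eq_or_lt with h | hTpos
    · rwa [← h]
    have hex : ∀ t, t < T → ∃ s ∈ B, t < s := fun t ht => exists_lt_of_lt_csSup ⟨0, h0B⟩ ht
    have hchoice : ∀ s ∈ B, ∃ g : ℝ → ℂ, ContinuousOn g (Icc 0 s) ∧
      (∀ t ∈ Icc (0 : ℝ) s, f (g t) = b t) ∧ g 0 = z₀ := fun s hs => hs.2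
    choose! g hg hgb hg0 using hchoice
    choose! σ hσB hσ using hex
    let G : ℝ → ℂ := fun t => g (σ t) t
    have hagree : ∀ s ∈ B, ∀ s' ∈ B, ∀ t, 0 ≤ t → t ≤ s → t ≤ s' → g s t = g s' t := by
      intro s hs s' hs' t ht hts hts'
      refine eqOn_of_comp_eqOn_of_notMem_singularSet hf (isPreconnected_Icc (a := (0 : ℝ)) (b := t))
        ((hg s hs).mono (Icc_subset_Icc_right hts)) ((hg s' hs').mono (Icc_subset_Icc_right hts'))
        (fun x hx => ?_) (fun x hx => ?_) ⟨le_rfl, ht⟩ ((hg0 s hs).trans (hg0 s' hs').symm)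
        ⟨ht, le_rfl⟩
      · exact (hgb s hs x ⟨hx.1, hx.2.trans hts⟩).trans (hgb s' hs' x ⟨hx.1, hx.2.trans hts'⟩).symm
      · rw [hgb s hs x ⟨hx.1, hx.2.trans hts⟩]; exact hbS x
    have hG : ∀ s ∈ B, ∀ t, 0 ≤ t → t < T → t ≤ s → G t = g s t := fun s hs t ht htT hts =>
      hagree _ (hσB t htT) s hs t ht (hσ t htT).le hts
    have hGc : ContinuousOn G (Ico 0 T) := by
      intro t ht
      have h1 : ContinuousWithinAt (g (σ t)) (Icc 0 (σ t)) t :=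
        hg _ (hσB t ht.2) t ⟨ht.1, (hσ t ht.2).le⟩
      have h2 : ContinuousWithinAt (g (σ t)) (Ico 0 T) t := by
        refine h1.mono_of_mem_nhdsWithin ?_
        filter_upwards [self_mem_nhdsWithin, mem_nhdsWithin_of_mem_nhds (Iio_mem_nhds (hσ t ht.2))]
          with x hx hx' using ⟨hx.1, le_of_lt hx'⟩
      refine h2.congr_of_eventuallyEq ?_ rfl
      filter_upwards [self_mem_nhdsWithin, mem_nhdsWithin_of_mem_nhds (Iio_mem_nhds (hσ t ht.2))]
        with x hx hx' using hG _ (hσB t ht.2) x hx.1 hx.2 (le_of_lt hx')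
    have hGb : ∀ t ∈ Ico 0 T, f (G t) = b t := fun t ht =>
      hgb _ (hσB t ht.2) t ⟨ht.1, (hσ t ht.2).le⟩
    obtain ⟨w, hw, hlim⟩ := exists_tendsto_lift hf hTpos hb.continuousAt (hbS T) hGc hGb
    refine ⟨⟨hT0, hT1⟩, Function.update G T w, ?_, fun t ht => ?_, ?_⟩
    · rw [continuousOn_update_iff]
      have hdiff : Icc 0 T \ {T} = Ico 0 T := Icc_sdiff_right
      rw [hdiff]
      refine ⟨hGc, fun _ => hlim.mono_left (nhdsWithin_mono _ fun x hx => hx.2)⟩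
    · rcases ht.2.eq_or_lt with rfl | h
      · rw [Function.update_self, hw]
      · rw [Function.update_of_ne h.ne, hGb t ⟨ht.1, h⟩]
    · rw [Function.update_of_ne hTpos.ne]
      exact hg0 _ (hσB 0 hTpos)
  obtain ⟨-, g, hg, hgb, hg0⟩ := hTB
  rcases hT1.eq_or_lt with h | hlt
  · rw [h] at hg hgb
    exact ⟨g, hg, hgb, hg0⟩
  exfalso
  have hgT : f (g T) = b T := hgb T ⟨hT0, le_rfl⟩
  obtain ⟨φ, hφ, hfφ⟩ := isLocalHomeomorphOn_compl_singularSet hf (g T)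
    (by rw [mem_preimage, hgT]; exact hbS T)
  have hbT : b T ∈ φ.target := by
    rw [← hgT, hfφ]; exact φ.map_source hφ
  have hnear : ∀ᶠ t in 𝓝 T, b t ∈ φ.target := hb.continuousAt (φ.open_target.mem_nhds hbT)
  obtain ⟨ε, hε, hnear⟩ := Metric.eventually_nhds_iff.1 hnear
  obtain ⟨T', hTT', hT'1, hT'ε⟩ : ∃ T', T < T' ∧ T' ≤ 1 ∧ T' < T + ε :=
    ⟨min 1 (T + ε / 2), lt_min hlt (by linarith), min_le_left _ _,
      (min_le_right _ _).trans_lt (by linarith)⟩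
  have htar : ∀ t ∈ Icc T T', b t ∈ φ.target := fun t ht => hnear (by
    rw [Real.dist_eq, abs_lt]; constructor <;> linarith [ht.1, ht.2])
  obtain ⟨k, hk, hk1, hk2⟩ := exists_continuousOn_glue (isClosed_Icc (a := 0) (b := T))
    (isClosed_Icc (a := T) (b := T')) hg
    (φ.continuousOn_symm.comp hb.continuousOn htar) (by
      rintro t ⟨ht1, ht2⟩
      obtain rfl : t = T := le_antisymm ht1.2 ht2.1
      simp only [Function.comp_apply]
      rw [← hgT, hfφ, φ.left_inv hφ])
  rw [Icc_union_Icc_eq_Icc hT0 hTT'.le] at hk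
  have : T' ∈ B := by
    refine ⟨⟨hT0.trans hTT'.le, hT'1⟩, k, hk, fun t ht => ?_, ?_⟩
    · rcases le_total t T with h | h
      · rw [hk1 ⟨ht.1, h⟩, hgb t ⟨ht.1, h⟩]
      · rw [hk2 ⟨h, ht.2⟩, Function.comp_apply, hfφ, φ.right_inv (htar t ⟨h, ht.2⟩)]
    · rw [hk1 ⟨le_rfl, hT0⟩, hg0]
  exact absurd (le_csSup hBbdd this) (not_le.2 hTT')

open unitInterval in
theorem exists_path_lift_unramifiedMap {f : ℂ → ℂ} (hf : Differentiable ℂ f) (γ : C(I, ℂ))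
    (hγ : ∀ t, γ t ∉ singularSet f) (e : ↥(f ⁻¹' (singularSet f)ᶜ)) (he : f e = γ 0) :
    ∃ Γ : C(I, ↥(f ⁻¹' (singularSet f)ᶜ)), Γ 0 = e ∧ unramifiedMap f ∘ Γ = γ := by
  obtain ⟨g, hg, hgb, hg0⟩ := exists_lift_Icc hf (b := fun t => γ (projIcc 0 1 zero_le_one t))
    (by fun_prop) (fun t => hγ _) (z₀ := e) (by rw [he]; simp)
  have hgb' : ∀ t : I, f (g t) = γ t := fun t => by
    rw [hgb t t.2]; simp
  have hmem : ∀ t : I, g t ∈ f ⁻¹' (singularSet f)ᶜ := fun t => by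
    rw [mem_preimage, hgb']; exact hγ t
  have hcont : Continuous fun t : I => g t :=
    hg.comp_continuous continuous_subtype_val fun t => t.2
  exact ⟨⟨fun t => ⟨g t, hmem t⟩, hcont.subtype_mk _⟩, Subtype.ext hg0, funext hgb'⟩

open unitInterval in
/-- Continuous maps from simply connected spaces into the complement of the singular set can be
lifted through `f`. -/
theorem exists_lift_of_simplyConnected {f : ℂ → ℂ} (hf : Differentiable ℂ f) {A : Type*}
    [TopologicalSpace A] [SimplyConnectedSpace A] [LocallyPathConnectedSpace A] (g : C(A, ℂ))
    (hg : ∀ a, g a ∉ singularSet f) {a₀ : A} {z₀ : ℂ} (h : f z₀ = g a₀) :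
    ∃ F : C(A, ℂ), F a₀ = z₀ ∧ ∀ a, f (F a) = g a := by
  have homeo := isLocalHomeomorph_unramifiedMap hf
  have sep := isSeparatedMap_unramifiedMap f
  let e₀ : ↥(f ⁻¹' (singularSet f)ᶜ) := ⟨z₀, by rw [mem_preimage, h]; exact hg a₀⟩
  have uniq : ∀ {Γ Γ' : C(I, ↥(f ⁻¹' (singularSet f)ᶜ))}, Γ 0 = Γ' 0 →
      unramifiedMap f ∘ Γ = unramifiedMap f ∘ Γ' → Γ = Γ' := fun h0 h1 =>
    DFunLike.coe_injective (sep.eq_of_comp_eq homeo.isLocallyInjective (map_continuous _)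
      (map_continuous _) h1 0 h0)
  obtain ⟨F, ⟨hF0, hF⟩, -⟩ := homeo.existsUnique_continuousMap_lifts g a₀ e₀ h (fun γ hγ =>
    exists_path_lift_unramifiedMap hf (g.comp γ) (fun t => hg _) e₀ (by simp [hγ, e₀, h])) (by
      intro γ γ' Γ Γ' γ0 γ'0 Γ0 Γ'0 hΓ hΓ' h1
      let pγ : Path a₀ (γ 1) := ⟨γ, γ0, rfl⟩
      let pγ' : Path a₀ (γ 1) := ⟨γ', γ'0, h1.symm⟩
      obtain ⟨H⟩ := SimplyConnectedSpace.paths_homotopic pγ pγ'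
      -- Lifting each intermediate path of a homotopy and applying monodromy shows that the endpoint
      -- of a lifted path depends only on the endpoint downstairs.
      have hlift : ∀ t : I, ∃ Λ : C(I, ↥(f ⁻¹' (singularSet f)ᶜ)), Λ 0 = e₀ ∧
          unramifiedMap f ∘ Λ = g.comp ⟨fun s => H (t, s), by fun_prop⟩ := fun t =>
        exists_path_lift_unramifiedMap hf _ (fun s => hg _) e₀ (by simp [e₀, h])
      choose Λ hΛ0 hΛ using hlift
      have hmon := homeo.monodromy_theorem sep (γ₀ := g.comp pγ.toContinuousMap)
        (γ₁ := g.comp pγ'.toContinuousMap) (H.compContinuousMap g) Λ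
        (fun t s => congr($(hΛ t) s)) (fun t => (hΛ0 t).trans (hΛ0 0).symm) 1
      have e1 : Γ = Λ 0 := uniq (Γ0.trans (hΛ0 0).symm) (by
        rw [hΓ, hΛ]; ext s; simp [pγ])
      have e2 : Γ' = Λ 1 := uniq (Γ'0.trans (hΛ0 1).symm) (by
        rw [hΓ', hΛ]; ext s; simp [pγ'])
      rw [e1, e2, hmon])
  exact ⟨⟨fun a => F a, by fun_prop⟩, congr_arg Subtype.val hF0, fun a => congr($hF a)⟩

/-! ### Inverse branches on simply connected sets -/

theorem connectedComponentIn_eq_of_mem {X : Type*} [TopologicalSpace X] {S : Set X} {x y : X}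
    (h : y ∈ connectedComponentIn S x) : connectedComponentIn S y = connectedComponentIn S x :=
  (connectedComponentIn_eq h).symm

/-- Components of an open set are open, so logarithms chosen separately on each of them fit together
continuously. -/
theorem hasLogBranches_of_components {S : Set ℂ} (hS : IsOpen S)
    (h : ∀ z ∈ S, ∀ c ∉ S, ∃ L : ℂ → ℂ, ContinuousOn L (connectedComponentIn S z) ∧
      ∀ x ∈ connectedComponentIn S z, Complex.exp (L x) = x - c) : HasLogBranches S := by
  intro K hK _ c hc
  have h' : ∀ T : Set ℂ, IsComponentOf T S → ∃ L : ℂ → ℂ, ContinuousOn L T ∧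
      ∀ x ∈ T, Complex.exp (L x) = x - c := by
    rintro T ⟨z, hz, rfl⟩
    exact h z hz c hc
  choose! Λ hΛ hΛe using h'
  refine ⟨fun x => Λ (connectedComponentIn S x) x, ContinuousOn.mono (fun x hx => ?_) hK,
    fun x hx => hΛe _ ⟨x, hK hx, rfl⟩ x (mem_connectedComponentIn (hK hx))⟩
  have hnhds : connectedComponentIn S x ∈ 𝓝 x :=
    hS.connectedComponentIn.mem_nhds (mem_connectedComponentIn hx)
  refine (((hΛ _ ⟨x, hx, rfl⟩).continuousAt hnhds).congr ?_).continuousWithinAt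
  filter_upwards [hnhds] with y hy
  rw [connectedComponentIn_eq_of_mem hy]

theorem exists_log_of_isSimplyConnected {T : Set ℂ} (hT : IsOpen T) (hs : IsSimplyConnected T)
    {g : ℂ → ℂ} (hg : ContinuousOn g T) (h0 : ∀ z ∈ T, g z ≠ 0) :
    ∃ L : ℂ → ℂ, ContinuousOn L T ∧ ∀ z ∈ T, Complex.exp (L z) = g z := by
  obtain ⟨G, hG, hG'⟩ := Complex.exists_continuousOn_eqOn_exp_comp hs hT hg (by
    rintro ⟨z, hz, h⟩; exact h0 z hz h)
  exact ⟨G, hG, fun z hz => hG' hz⟩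

theorem exists_lift_on_isSimplyConnected {f : ℂ → ℂ} (hf : Differentiable ℂ f) {A : Set ℂ}
    (hA : IsOpen A) (hs : IsSimplyConnected A) {g : ℂ → ℂ} (hg : ContinuousOn g A)
    (hgS : ∀ a ∈ A, g a ∉ singularSet f) {a₀ z₀ : ℂ} (ha₀ : a₀ ∈ A) (h : f z₀ = g a₀) :
    ∃ F : ℂ → ℂ, ContinuousOn F A ∧ F a₀ = z₀ ∧ ∀ a ∈ A, f (F a) = g a := by
  classical
  have := hs.simplyConnectedSpace
  have := hA.locallyPathConnectedSpace
  obtain ⟨F, hF0, hF⟩ := exists_lift_of_simplyConnected hf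
    (⟨A.domRestrict g, continuousOn_iff_continuous_domRestrict.1 hg⟩ : C(A, ℂ))
    (fun a => hgS a a.2) (a₀ := ⟨a₀, ha₀⟩) (z₀ := z₀) h
  obtain ⟨F', hF'⟩ : ∃ F' : ℂ → ℂ, ∀ a : A, F' a = F a :=
    ⟨fun a => if ha : a ∈ A then F ⟨a, ha⟩ else 0, fun a => dif_pos a.2⟩
  refine ⟨F', ?_, (hF' ⟨a₀, ha₀⟩).trans hF0, fun a ha => ?_⟩
  · rw [continuousOn_iff_continuous_domRestrict]
    exact F.continuous.congr fun a => (hF' a).symm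
  · rw [hF' ⟨a, ha⟩, hF]
    rfl

/-- Over a simply connected component without singular values, `f` is a homeomorphism on every
component of the preimage. -/
theorem exists_inverse_branch {f : ℂ → ℂ} (hf : Differentiable ℂ f) {V : Set ℂ} (hV : IsOpen V)
    (hVS : ∀ v ∈ V, v ∉ singularSet f) {z : ℂ} (hz : f z ∈ V)
    (hs : IsSimplyConnected (connectedComponentIn V (f z))) :
    ∃ ψ : ℂ → ℂ, ContinuousOn ψ (connectedComponentIn V (f z)) ∧
      MapsTo ψ (connectedComponentIn V (f z)) (connectedComponentIn (f ⁻¹' V) z) ∧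
      MapsTo f (connectedComponentIn (f ⁻¹' V) z) (connectedComponentIn V (f z)) ∧
      (∀ w ∈ connectedComponentIn V (f z), f (ψ w) = w) ∧
      ∀ x ∈ connectedComponentIn (f ⁻¹' V) z, ψ (f x) = x := by
  set V₀ := connectedComponentIn V (f z)
  set τ := connectedComponentIn (f ⁻¹' V) z
  have hV₀V : V₀ ⊆ V := connectedComponentIn_subset _ _
  have hτV : τ ⊆ f ⁻¹' V := connectedComponentIn_subset _ _
  have hzτ : z ∈ τ := mem_connectedComponentIn hz
  have hzV₀ : f z ∈ V₀ := mem_connectedComponentIn hz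
  obtain ⟨ψ, hψ, hψ0, hψf⟩ := exists_lift_on_isSimplyConnected hf hV.connectedComponentIn hs
    (g := id) continuousOn_id (fun a ha => hVS a (hV₀V ha)) hzV₀ rfl
  have hmf : MapsTo f τ V₀ := by
    rw [mapsTo_iff_image_subset]
    exact (isPreconnected_connectedComponentIn.image f hf.continuous.continuousOn).subset_connectedComponentIn
      ⟨z, hzτ, rfl⟩ (image_subset_iff.2 hτV)
  have hmψ : MapsTo ψ V₀ τ := by
    rw [mapsTo_iff_image_subset]
    refine (isPreconnected_connectedComponentIn.image ψ hψ).subset_connectedComponentIn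
      ⟨f z, hzV₀, hψ0⟩ ?_
    rintro _ ⟨w, hw, rfl⟩
    rw [mem_preimage, hψf w hw]
    exact hV₀V hw
  refine ⟨ψ, hψ, hmψ, hmf, hψf, ?_⟩
  -- Both ψ ∘ f and the identity lift `f` on τ and agree at `z`.
  refine eqOn_of_comp_eqOn_of_notMem_singularSet hf isPreconnected_connectedComponentIn
    (hψ.comp hf.continuous.continuousOn hmf) continuousOn_id (fun x hx => hψf _ (hmf hx))
    (fun x hx => ?_) hzτ hψ0
  rw [hψf _ (hmf hx)]
  exact hVS _ (hτV hx)

theorem isSimplyConnected_component_preimage {f : ℂ → ℂ} (hf : Differentiable ℂ f) {V : Set ℂ}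
    (hV : IsOpen V) (hVS : ∀ v ∈ V, v ∉ singularSet f) {z : ℂ} (hz : f z ∈ V)
    (hs : IsSimplyConnected (connectedComponentIn V (f z))) :
    IsSimplyConnected (connectedComponentIn (f ⁻¹' V) z) := by
  obtain ⟨ψ, hψ, hmψ, hmf, hψf, hfψ⟩ := exists_inverse_branch hf hV hVS hz hs
  have e : connectedComponentIn (f ⁻¹' V) z ≃ₜ connectedComponentIn V (f z) :=
    { toFun := hmf.restrict
      invFun := hmψ.restrict
      left_inv := fun x => Subtype.ext (hfψ x x.2)
      right_inv := fun x => Subtype.ext (hψf x x.2)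
      continuous_toFun := hf.continuous.continuousOn.mapsToRestrict hmf
      continuous_invFun := hψ.mapsToRestrict hmψ }
  have := hs.simplyConnectedSpace
  exact e.toHomotopyEquiv.simplyConnectedSpace

theorem injOn_component_preimage {f : ℂ → ℂ} (hf : Differentiable ℂ f) {V : Set ℂ}
    (hV : IsOpen V) (hVS : ∀ v ∈ V, v ∉ singularSet f) {z : ℂ} (hz : f z ∈ V)
    (hs : IsSimplyConnected (connectedComponentIn V (f z))) :
    InjOn f (connectedComponentIn (f ⁻¹' V) z) ∧
      f '' connectedComponentIn (f ⁻¹' V) z = connectedComponentIn V (f z) := by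
  obtain ⟨ψ, hψ, hmψ, hmf, hψf, hfψ⟩ := exists_inverse_branch hf hV hVS hz hs
  refine ⟨fun x hx y hy h => by rw [← hfψ x hx, h, hfψ y hy],
    (mapsTo_iff_image_subset.1 hmf).antisymm fun w hw => ⟨ψ w, hmψ hw, hψf w hw⟩⟩

/-- Each component of the preimage is a homeomorphic copy of a simply connected set, and z - c has
no zero on it when c is outside the preimage. -/
theorem hasLogBranches_preimage {f : ℂ → ℂ} (hf : Differentiable ℂ f) {V : Set ℂ}
    (hV : IsOpen V) (hVS : ∀ v ∈ V, v ∉ singularSet f)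
    (hs : ∀ v ∈ V, IsSimplyConnected (connectedComponentIn V v)) : HasLogBranches (f ⁻¹' V) := by
  have ho := hV.preimage hf.continuous
  refine hasLogBranches_of_components ho fun z hz c hc => ?_
  exact exists_log_of_isSimplyConnected ho.connectedComponentIn
    (isSimplyConnected_component_preimage hf hV hVS hz (hs _ hz)) (by fun_prop) fun x hx =>
      sub_ne_zero.2 (ne_of_mem_of_not_mem (connectedComponentIn_subset _ _ hx) hc)

/-! ### Closed lattice walks -/

theorem Complex.mem_slitPlane_neg_of_forall_ne {w : ℂ} (h : ∀ t : ℝ, 0 ≤ t → w ≠ t) :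
    -w ∈ Complex.slitPlane := by
  rw [Complex.mem_slitPlane_iff]
  by_contra! hcon
  obtain ⟨h1, h2⟩ := hcon
  simp only [Complex.neg_re, Complex.neg_im, Left.neg_nonpos_iff, neg_eq_zero] at h1 h2
  exact h w.re h1 (Complex.ext rfl (by simpa using h2))

/-- If a connected compact set in `U` joins the two ends of the top side of a unit square from
outside, the top and left side lie in `U`, and `U` has logarithm branches, then the whole square
lies in `U`. -/
theorem HasLogBranches.square_subset {U : Set ℂ} (hU : HasLogBranches U) {x y : ℝ} {T : Set ℂ}
    (hTU : T ⊆ U) (hTc : IsCompact T) (hT : IsPreconnected T) (hb : (⟨x, y⟩ : ℂ) ∈ T)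
    (hr : (⟨x + 1, y⟩ : ℂ) ∈ T) (htop : ∀ s ∈ Icc x (x + 1), (⟨s, y⟩ : ℂ) ∈ U)
    (hleft : ∀ s ∈ Icc (y - 1) y, (⟨x, s⟩ : ℂ) ∈ U) (him : ∀ z ∈ T, z.im ≤ y)
    (hT1 : ∀ z ∈ T, z.re ∈ Ioo x (x + 1) → z.im ≤ y - 1) :
    Icc x (x + 1) ×ℂ Icc (y - 1) y ⊆ U := by
  intro q hq
  obtain ⟨⟨hq1, hq2⟩, hq3, hq4⟩ := hq
  by_contra hqU
  have hqy : q.im < y := lt_of_le_of_ne hq4 fun h => hqU (by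
    have := htop q.re ⟨hq1, hq2⟩
    rwa [← h] at this)
  have hqx : x < q.re := lt_of_le_of_ne hq1 fun h => hqU (by
    have := hleft q.im ⟨hq3, hq4⟩
    rwa [h] at this)
  -- `M` is the midpoint of the top side. The ray from `q` through `M` misses `T`, while the
  -- opposite ray misses the top side. Cutting the logarithm along each of these rays computes the
  -- change of arg(z - q) between the two corners along `T` and along the top side.
  set M : ℂ := ⟨x + 1 / 2, y⟩ with hM
  have hMq : M - q ≠ 0 := fun h => by
    have := congr_arg Complex.im h
    simp [hM] at this
    linarith
  set top : Set ℂ := (fun s : ℝ => (⟨s, y⟩ : ℂ)) '' Icc x (x + 1) with htopdef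
  have hmk : Continuous fun s : ℝ => (⟨s, y⟩ : ℂ) :=
    Complex.equivRealProdCLM.symm.continuous.comp (continuous_id.prodMk continuous_const)
  have htopc : IsCompact top := isCompact_Icc.image hmk
  have htopp : IsPreconnected top := isPreconnected_Icc.image _ hmk.continuousOn
  obtain ⟨L, hL, hLe⟩ := hU (T ∪ top) (union_subset hTU (by
    rintro _ ⟨s, hs, rfl⟩; exact htop s hs)) (hTc.union htopc) q hqU
  have hslit1 : ∀ z ∈ T, -((z - q) / (M - q)) ∈ Complex.slitPlane := by
    intro z hz
    refine Complex.mem_slitPlane_neg_of_forall_ne fun t ht he => ?_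
    rw [div_eq_iff hMq] at he
    have hre : z.re = q.re + t * (x + 1 / 2 - q.re) := by
      have := congr_arg Complex.re he
      simp [hM] at this
      linarith
    have hime : z.im = q.im + t * (y - q.im) := by
      have := congr_arg Complex.im he
      simp [hM] at this
      linarith
    rcases ht.eq_or_lt with rfl | ht0
    · have : z = q := Complex.ext (by linarith) (by linarith)
      exact hqU (this ▸ hTU hz)
    rcases le_or_gt t 1 with ht1 | ht1
    · have := hT1 z hz ⟨by nlinarith, by nlinarith⟩
      nlinarith
    · have := him z hz
      nlinarith
  have hslit2 : ∀ z ∈ top, (z - q) / (M - q) ∈ Complex.slitPlane := by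
    rintro _ ⟨s, hs, rfl⟩
    rw [← neg_neg ((_ : ℂ) / _)]
    rw [← neg_div, neg_sub]
    refine Complex.mem_slitPlane_neg_of_forall_ne fun t ht he => ?_
    rw [div_eq_iff hMq] at he
    have := congr_arg Complex.im he
    simp [hM] at this
    nlinarith
  have e1 := log_sub_log_eq_of_isPreconnected hT (L := L)
    (M := fun z => Complex.log (-((z - q) / (M - q))) + Complex.log (-(M - q)))
    (hL.mono subset_union_left)
    ((ContinuousOn.clog (by fun_prop) hslit1).add continuousOn_const) (fun z hz => by
      rw [hLe z (Or.inl hz), Complex.exp_add, Complex.exp_log (Complex.slitPlane_ne_zero (hslit1 z hz)),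
        Complex.exp_log (neg_ne_zero.2 hMq)]
      field_simp) hr hb
  have hbt : (⟨x, y⟩ : ℂ) ∈ top := ⟨x, ⟨le_rfl, by linarith⟩, rfl⟩
  have hrt : (⟨x + 1, y⟩ : ℂ) ∈ top := ⟨x + 1, ⟨by linarith, le_rfl⟩, rfl⟩
  have e2 := log_sub_log_eq_of_isPreconnected htopp (L := L)
    (M := fun z => Complex.log ((z - q) / (M - q)) + Complex.log (M - q))
    (hL.mono subset_union_right)
    ((ContinuousOn.clog (by fun_prop) hslit2).add continuousOn_const) (fun z hz => by
      rw [hLe z (Or.inr hz), Complex.exp_add, Complex.exp_log (Complex.slitPlane_ne_zero (hslit2 z hz)),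
        Complex.exp_log hMq]
      field_simp) hrt hbt
  rw [e1] at e2
  have hnorm : 0 < Complex.normSq (M - q) := Complex.normSq_pos.2 hMq
  have hu : 0 < (((⟨x, y⟩ : ℂ) - q) / (M - q)).im := by
    rw [Complex.div_im, ← sub_div]
    apply div_pos _ hnorm
    simp [hM]
    nlinarith
  have hv : (((⟨x + 1, y⟩ : ℂ) - q) / (M - q)).im < 0 := by
    rw [Complex.div_im, ← sub_div]
    apply div_neg_of_neg_of_pos _ hnorm
    simp [hM]
    nlinarith
  -- The corners lie on opposite sides of the line through `q` and `M`, so the two computations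
  -- differ by 2π, although both equal the change of `L`.
  have e3 := congr_arg Complex.im e2
  simp only [Complex.add_im, Complex.sub_im, Complex.log_im] at e3
  rw [Complex.arg_neg_eq_arg_sub_pi_of_im_pos hu, Complex.arg_neg_eq_arg_add_pi_of_im_neg hv] at e3
  have := Real.pi_pos
  linarith

/-- The product of `e` over the consecutive pairs of the list `a :: l`. -/
def chainProd {α G : Type*} [Group G] (e : α → α → G) : α → List α → G
  | _, [] => 1
  | a, b :: l => e a b * chainProd e b l

theorem chainProd_append {α G : Type*} [Group G] (e : α → α → G) (a b : α) (l₁ l₂ : List α) :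
    chainProd e a (l₁ ++ b :: l₂) = chainProd e a (l₁ ++ [b]) * chainProd e b l₂ := by
  induction l₁ generalizing a with
  | nil => simp [chainProd]
  | cons c l ih => simp [chainProd, ih c, mul_assoc]

/-- The lattice point with the given coordinates. -/
def latticePt (p : ℤ × ℤ) : ℂ := ⟨p.1, p.2⟩

/-- Two lattice points are neighbours, and the segment between them lies in `U`. -/
def LatticeAdj (U : Set ℂ) (p q : ℤ × ℤ) : Prop :=
  ((q.1 = p.1 ∧ (q.2 = p.2 + 1 ∨ p.2 = q.2 + 1)) ∨ (q.2 = p.2 ∧ (q.1 = p.1 + 1 ∨ p.1 = q.1 + 1))) ∧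
    segment ℝ (latticePt p) (latticePt q) ⊆ U

/-- The union of the segments between consecutive points of `a :: l`. -/
def latticeTrace : ℤ × ℤ → List (ℤ × ℤ) → Set ℂ
  | a, [] => {latticePt a}
  | a, b :: l => segment ℝ (latticePt a) (latticePt b) ∪ latticeTrace b l

theorem mem_latticeTrace_head (a : ℤ × ℤ) (l : List (ℤ × ℤ)) : latticePt a ∈ latticeTrace a l := by
  cases l with
  | nil => rfl
  | cons b l => exact Or.inl (left_mem_segment _ _ _)

theorem mem_latticeTrace_of_mem {a b : ℤ × ℤ} {l : List (ℤ × ℤ)} (h : b ∈ l) :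
    latticePt b ∈ latticeTrace a l := by
  induction l generalizing a with
  | nil => simp at h
  | cons c l ih =>
    rcases List.mem_cons.1 h with rfl | h
    · exact Or.inr (mem_latticeTrace_head _ _)
    · exact Or.inr (ih h)

theorem isCompact_segment_complex (x y : ℂ) : IsCompact (segment ℝ x y) := by
  rw [segment_eq_image_lineMap]
  exact isCompact_Icc.image AffineMap.lineMap_continuous

theorem isCompact_latticeTrace (a : ℤ × ℤ) (l : List (ℤ × ℤ)) : IsCompact (latticeTrace a l) := by
  induction l generalizing a with
  | nil => exact isCompact_singleton
  | cons b l ih => exact (isCompact_segment_complex _ _).union (ih b)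

theorem isPreconnected_latticeTrace (a : ℤ × ℤ) (l : List (ℤ × ℤ)) :
    IsPreconnected (latticeTrace a l) := by
  induction l generalizing a with
  | nil => exact isPreconnected_singleton
  | cons b l ih =>
    exact IsPreconnected.union _ (right_mem_segment _ _ _) (mem_latticeTrace_head b l)
      (convex_segment _ _).isPreconnected (ih b)

theorem exists_segment_of_mem_latticeTrace {U : Set ℂ} {a : ℤ × ℤ} {l : List (ℤ × ℤ)} (hl : l ≠ [])
    (hc : List.IsChain (LatticeAdj U) (a :: l)) {z : ℂ} (hz : z ∈ latticeTrace a l) :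
    ∃ p ∈ a :: l, ∃ q ∈ a :: l, LatticeAdj U p q ∧ z ∈ segment ℝ (latticePt p) (latticePt q) := by
  induction l generalizing a with
  | nil => exact absurd rfl hl
  | cons b l ih =>
    rw [List.isChain_cons_cons] at hc
    rcases hz with hz | hz
    · exact ⟨a, by simp, b, by simp, hc.1, hz⟩
    · rcases eq_or_ne l [] with rfl | hl'
      · rw [latticeTrace, mem_singleton_iff] at hz
        exact ⟨a, by simp, b, by simp, hc.1, hz ▸ right_mem_segment _ _ _⟩
      · obtain ⟨p, hp, q, hq, h⟩ := ih hl' hc.2 hz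
        exact ⟨p, List.mem_cons_of_mem _ hp, q, List.mem_cons_of_mem _ hq, h⟩

theorem im_le_of_mem_segment {p q : ℤ × ℤ} {h : ℤ} (hp : p.2 ≤ h) (hq : q.2 ≤ h) {z : ℂ}
    (hz : z ∈ segment ℝ (latticePt p) (latticePt q)) : z.im ≤ h := by
  obtain ⟨s, t, hs, ht, hst, rfl⟩ := hz
  have hp' : (p.2 : ℝ) ≤ h := by exact_mod_cast hp
  have hq' : (q.2 : ℝ) ≤ h := by exact_mod_cast hq
  have h1 := mul_le_mul_of_nonneg_left hp' hs
  have h2 := mul_le_mul_of_nonneg_left hq' ht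
  have h3 : s * (h : ℝ) + t * h = h := by rw [← add_mul, hst, one_mul]
  simp [latticePt]
  linarith

/-- A lattice edge over the open interval `(i, i + 1)` is horizontal between `i` and `i + 1`. -/
theorem LatticeAdj.eq_of_re_mem_Ioo {U : Set ℂ} {p q : ℤ × ℤ} (h : LatticeAdj U p q) {z : ℂ}
    (hz : z ∈ segment ℝ (latticePt p) (latticePt q)) {i : ℤ} (hi : z.re ∈ Ioo (i : ℝ) (i + 1)) :
    q.2 = p.2 ∧ z.im = p.2 ∧ (p.1 = i ∨ q.1 = i) := by
  obtain ⟨s, t, hs, ht, hst, rfl⟩ := hz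
  obtain ⟨hi1, hi2⟩ := hi
  simp [latticePt] at hi1 hi2 ⊢
  rcases h.1 with ⟨h1, -⟩ | ⟨h1, h2⟩
  · exfalso
    rw [h1, ← add_mul, hst, one_mul] at hi1 hi2
    have h3 : i < p.1 := by exact_mod_cast hi1
    have h4 : p.1 < i + 1 := by exact_mod_cast hi2
    omega
  · refine ⟨h1, by rw [h1, ← add_mul, hst, one_mul], ?_⟩
    rcases h2 with h2 | h2 <;> rw [h2] at hi1 hi2 <;> push_cast at hi1 hi2
    · have e : s * (p.1 : ℝ) + t * (p.1 + 1) = p.1 + t := by linear_combination (p.1 : ℝ) * hst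
      have h3 : (i : ℝ) < p.1 + 1 := by linarith
      have h4 : (p.1 : ℝ) < i + 1 := by linarith
      have h3' : i < p.1 + 1 := by exact_mod_cast h3
      have h4' : p.1 < i + 1 := by exact_mod_cast h4
      omega
    · have e : s * ((q.1 : ℝ) + 1) + t * q.1 = q.1 + s := by linear_combination (q.1 : ℝ) * hst
      have h3 : (i : ℝ) < q.1 + 1 := by linarith
      have h4 : (q.1 : ℝ) < i + 1 := by linarith
      have h3' : i < q.1 + 1 := by exact_mod_cast h3
      have h4' : q.1 < i + 1 := by exact_mod_cast h4
      omega

theorem mk_mem_segment_vertical {x y s : ℝ} (hs : s ∈ Icc (y - 1) y) :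
    (⟨x, s⟩ : ℂ) ∈ segment ℝ (⟨x, y⟩ : ℂ) ⟨x, y - 1⟩ := by
  refine ⟨s - (y - 1), y - s, by linarith [hs.1], by linarith [hs.2], by ring, ?_⟩
  apply Complex.ext <;> simp <;> ring

theorem mk_mem_segment_horizontal {x y s : ℝ} (hs : s ∈ Icc x (x + 1)) :
    (⟨s, y⟩ : ℂ) ∈ segment ℝ (⟨x, y⟩ : ℂ) ⟨x + 1, y⟩ := by
  refine ⟨x + 1 - s, s - x, by linarith [hs.2], by linarith [hs.1], by ring, ?_⟩
  apply Complex.ext <;> simp <;> ring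

theorem LatticeAdj.symm {U : Set ℂ} {p q : ℤ × ℤ} (h : LatticeAdj U p q) : LatticeAdj U q p := by
  refine ⟨?_, by rw [segment_symm]; exact h.2⟩
  rcases h.1 with ⟨h1, h2⟩ | ⟨h1, h2⟩
  · exact Or.inl ⟨h1.symm, h2.symm⟩
  · exact Or.inr ⟨h1.symm, h2.symm⟩

/-- The unit square below and to the right of the lattice point `b`. -/
def latticeSquare (b : ℤ × ℤ) : Set ℂ :=
  Icc (b.1 : ℝ) (b.1 + 1) ×ℂ Icc ((b.2 : ℝ) - 1) b.2

theorem convex_latticeSquare (b : ℤ × ℤ) : Convex ℝ (latticeSquare b) :=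
  ((convex_Icc (b.1 : ℝ) (b.1 + 1)).linear_preimage Complex.reLm).inter
    ((convex_Icc ((b.2 : ℝ) - 1) b.2).linear_preimage Complex.imLm)

/-- At a top-left corner of a closed lattice walk in `U`, the adjacent square lies in `U`. -/
theorem HasLogBranches.latticeSquare_subset {U : Set ℂ} (hU : HasLogBranches U) {b c : ℤ × ℤ}
    {l : List (ℤ × ℤ)} (hl : l ≠ []) (hc : List.IsChain (LatticeAdj U) (c :: l)) (hb : b ∉ c :: l)
    (htop : ∀ v ∈ c :: l, v.2 ≤ b.2) (hr : (b.1 + 1, b.2) ∈ c :: l) (hd : (b.1, b.2 - 1) ∈ c :: l)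
    (hbr : LatticeAdj U b (b.1 + 1, b.2)) (hbd : LatticeAdj U b (b.1, b.2 - 1)) :
    latticeSquare b ⊆ U := by
  have hbd' : latticePt (b.1, b.2 - 1) = ⟨b.1, b.2 - 1⟩ := by simp [latticePt]
  have hbr' : latticePt (b.1 + 1, b.2) = ⟨b.1 + 1, b.2⟩ := by simp [latticePt]
  have htr : ∀ v ∈ c :: l, latticePt v ∈ latticeTrace c l := fun v hv => by
    rcases List.mem_cons.1 hv with rfl | h
    · exact mem_latticeTrace_head _ _
    · exact mem_latticeTrace_of_mem h
  -- The walk itself omits `b`; adjoining the left side of the square makes it a connected set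
  -- joining both upper corners.
  refine hU.square_subset (T := latticeTrace c l ∪
    segment ℝ (latticePt b) (latticePt (b.1, b.2 - 1))) ?_ ?_ ?_ ?_ ?_ ?_ ?_ ?_ ?_
  · refine union_subset (fun z hz => ?_) hbd.2
    obtain ⟨p, -, q, -, hpq, hz⟩ := exists_segment_of_mem_latticeTrace hl hc hz
    exact hpq.2 hz
  · exact (isCompact_latticeTrace _ _).union (isCompact_segment_complex _ _)
  · exact IsPreconnected.union _ (htr _ hd) (right_mem_segment _ _ _)
      (isPreconnected_latticeTrace _ _) (convex_segment _ _).isPreconnected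
  · exact Or.inr (left_mem_segment _ _ _)
  · exact Or.inl (hbr' ▸ htr _ hr)
  · intro s hs
    refine hbr.2 ?_
    rw [hbr']
    exact mk_mem_segment_horizontal hs
  · intro s hs
    refine hbd.2 ?_
    rw [hbd']
    exact mk_mem_segment_vertical hs
  · rintro z (hz | hz)
    · obtain ⟨p, hp, q, hq, hpq, hz⟩ := exists_segment_of_mem_latticeTrace hl hc hz
      exact im_le_of_mem_segment (htop p hp) (htop q hq) hz
    · exact im_le_of_mem_segment le_rfl (by simp) hz
  · rintro z (hz | hz) hre
    · obtain ⟨p, hp, q, hq, hpq, hz⟩ := exists_segment_of_mem_latticeTrace hl hc hz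
      obtain ⟨h1, h2, h3⟩ := hpq.eq_of_re_mem_Ioo hz hre
      -- An edge over the open interval at height `b.2` would have `b` as an endpoint.
      have h4 : p.2 ≤ b.2 - 1 := by
        by_contra hlt
        have h5 : p.2 = b.2 := by have := htop p hp; omega
        rcases h3 with h3 | h3
        · exact hb (by rwa [show b = p from Prod.ext h3.symm h5.symm])
        · exact hb (by rwa [show b = q from Prod.ext h3.symm (by rw [h1, h5])])
      rw [h2]
      exact_mod_cast h4
    · exfalso
      obtain ⟨s, t, hs, ht, hst, rfl⟩ := hz
      have : (s • latticePt b + t • latticePt (b.1, b.2 - 1)).re = b.1 := by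
        simp [latticePt, ← add_mul, hst]
      rw [this] at hre
      exact lt_irrefl _ hre.1

/-- `e` is multiplicative on triples contained in a common convex subset of `U`. -/
def IsConvexCocycle {G : Type*} [Group G] (U : Set ℂ) (e : ℂ → ℂ → G) : Prop :=
  ∀ C ⊆ U, Convex ℝ C → ∀ x ∈ C, ∀ y ∈ C, ∀ z ∈ C, e x y * e y z = e x z

theorem List.exists_append_of_not_nodup {α : Type*} {l : List α} (h : ¬ l.Nodup) :
    ∃ x l₁ l₂ l₃, l = l₁ ++ x :: (l₂ ++ x :: l₃) := by
  induction l with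
  | nil => simp at h
  | cons a l ih =>
    by_cases ha : a ∈ l
    · obtain ⟨s, t, rfl⟩ := List.append_of_mem ha
      exact ⟨a, [], s, t, rfl⟩
    · obtain ⟨x, l₁, l₂, l₃, rfl⟩ := ih fun hl => h (List.nodup_cons.2 ⟨ha, hl⟩)
      exact ⟨x, a :: l₁, l₂, l₃, rfl⟩

theorem List.IsChain.rotate_closed {α : Type*} {R : α → α → Prop} {a b : α} {l₁ l₂ : List α}
    (h : List.IsChain R (a :: (l₁ ++ b :: l₂) ++ [a])) :
    List.IsChain R (b :: (l₂ ++ a :: l₁) ++ [b]) := by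
  have h1 : List.IsChain R ((a :: l₁) ++ b :: (l₂ ++ [a])) := by simpa using h
  rw [List.isChain_split] at h1
  have h2 : b :: (l₂ ++ a :: l₁) ++ [b] = (b :: l₂) ++ a :: (l₁ ++ [b]) := by simp
  rw [h2, List.isChain_split]
  exact ⟨by simpa using h1.2, by simpa using h1.1⟩

/-- Moving the base point turns a product uv into vu, and these are trivial together; a closed walk
may thus be based at any of its vertices. -/
theorem chainProd_rotate_closed {α G : Type*} [Group G] {e : α → α → G} {a b : α} {l₁ l₂ : List α}
    (h : chainProd e b ((l₂ ++ a :: l₁) ++ [b]) = 1) :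
    chainProd e a ((l₁ ++ b :: l₂) ++ [a]) = 1 := by
  have h1 : (l₁ ++ b :: l₂) ++ [a] = l₁ ++ b :: (l₂ ++ [a]) := by simp
  have h2 : (l₂ ++ a :: l₁) ++ [b] = l₂ ++ a :: (l₁ ++ [b]) := by simp
  rw [h2, chainProd_append] at h
  rw [h1, chainProd_append]
  exact mul_eq_one_comm.1 h

theorem exists_topLeft (a : ℤ × ℤ) (l : List (ℤ × ℤ)) :
    ∃ b ∈ a :: l, ∀ v ∈ a :: l, v.2 < b.2 ∨ (v.2 = b.2 ∧ b.1 ≤ v.1) := by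
  induction l generalizing a with
  | nil => exact ⟨a, by simp, by simp⟩
  | cons c l ih =>
    obtain ⟨b, hb, h⟩ := ih c
    by_cases hab : a.2 < b.2 ∨ (a.2 = b.2 ∧ b.1 ≤ a.1)
    · refine ⟨b, List.mem_cons_of_mem _ hb, fun v hv => ?_⟩
      rcases List.mem_cons.1 hv with rfl | hv
      · exact hab
      · exact h v hv
    · refine ⟨a, by simp, fun v hv => ?_⟩
      rcases List.mem_cons.1 hv with rfl | hv
      · exact Or.inr ⟨rfl, le_rfl⟩
      · have := h v hv
        omega

/-- The value of a cocycle around a closed lattice walk at a top-left corner does not change when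
the corner is pushed across the adjacent square. -/
theorem chainProd_corner {G : Type*} [Group G] {U : Set ℂ} {e : ℂ → ℂ → G}
    (he : IsConvexCocycle U e) {b c d b' : ℤ × ℤ} {l : List (ℤ × ℤ)} {C : Set ℂ} (hCU : C ⊆ U)
    (hC : Convex ℝ C) (hb : latticePt b ∈ C) (hc : latticePt c ∈ C) (hd : latticePt d ∈ C)
    (hb' : latticePt b' ∈ C)
    (h : chainProd (fun p q => e (latticePt p) (latticePt q)) b' (c :: (l ++ [d]) ++ [b']) = 1) :
    chainProd (fun p q => e (latticePt p) (latticePt q)) b (c :: (l ++ [d]) ++ [b]) = 1 := by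
  have h1 : ∀ x : ℤ × ℤ, c :: (l ++ [d]) ++ [x] = (c :: l) ++ d :: [x] := fun x => by simp
  have key : ∀ x : ℤ × ℤ, latticePt x ∈ C →
      (chainProd (fun p q => e (latticePt p) (latticePt q)) x (c :: (l ++ [d]) ++ [x]) = 1 ↔
      chainProd (fun p q => e (latticePt p) (latticePt q)) c (l ++ [d]) *
        e (latticePt d) (latticePt c) = 1) := by
    intro x hx
    rw [h1, chainProd_append, List.cons_append]
    simp only [chainProd, mul_one]
    rw [mul_assoc, mul_eq_one_comm, mul_assoc, he C hCU hC _ hd _ hx _ hc]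
  rw [key b hb]
  exact (key b' hb').1 h

/-- Induction on length, then on the total height of the vertices above `m`. At a repeated vertex
the walk splits into two shorter ones. Otherwise its top-left vertex is a genuine corner, the
adjacent square lies in `U` because of the logarithm branches, and pushing the corner to the
opposite vertex keeps the product trivial or nontrivial while lowering the height. -/
theorem chainProd_closed_lattice_walk {G : Type*} [Group G] {U : Set ℂ} (hU : HasLogBranches U)
    {e : ℂ → ℂ → G} (he : IsConvexCocycle U e) (m : ℤ) (n k : ℕ) (a : ℤ × ℤ) (l : List (ℤ × ℤ))
    (hn : l.length = n) (hm : ∀ v ∈ a :: l, m ≤ v.2)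
    (hk : ((a :: l).map fun v => (v.2 - m).toNat).sum = k)
    (hc : List.IsChain (LatticeAdj U) (a :: l ++ [a])) :
    chainProd (fun p q => e (latticePt p) (latticePt q)) a (l ++ [a]) = 1 := by
  induction n using Nat.strong_induction_on generalizing k a l with
  | _ n ihn =>
  induction k using Nat.strong_induction_on generalizing a l with
  | _ k ihk =>
  by_cases hnd : (a :: l).Nodup
  swap
  · obtain ⟨x, l₁, l₂, l₃, hsplit⟩ := List.exists_append_of_not_nodup hnd
    have hloop : ∀ l' : List (ℤ × ℤ), List.IsChain (LatticeAdj U) (x :: l' ++ [x]) →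
        l'.length < n → (∀ v ∈ x :: l', v ∈ a :: l) →
        chainProd (fun p q => e (latticePt p) (latticePt q)) x (l' ++ [x]) = 1 :=
      fun l' hl' hlen hsub => ihn _ hlen _ x l' rfl (fun v hv => hm v (hsub v hv)) rfl hl'
    have hlast : ∀ l₄ : List (ℤ × ℤ), List.IsChain (LatticeAdj U) (x :: (l₂ ++ x :: l₄) ++ [x]) →
        l₂.length + l₄.length + 1 = n → (∀ v ∈ x :: (l₂ ++ x :: l₄), v ∈ a :: l) →
        chainProd (fun p q => e (latticePt p) (latticePt q)) x ((l₂ ++ x :: l₄) ++ [x]) = 1 := by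
      intro l₄ hch hlen hsub
      have h1 : (l₂ ++ x :: l₄) ++ [x] = l₂ ++ x :: (l₄ ++ [x]) := by simp
      have h2 : x :: (l₂ ++ x :: l₄) ++ [x] = (x :: l₂) ++ x :: (l₄ ++ [x]) := by simp
      rw [h2, List.isChain_split] at hch
      rw [h1, chainProd_append, hloop l₂ (by simpa using hch.1) (by omega) (fun v hv => hsub v (by
        rcases List.mem_cons.1 hv with rfl | h <;> simp [*])),
        hloop l₄ (by simpa using hch.2) (by omega) (fun v hv => hsub v (by
        rcases List.mem_cons.1 hv with rfl | h <;> simp [*])), one_mul]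
    rcases l₁ with _ | ⟨a', l₁⟩
    · obtain ⟨rfl, rfl⟩ : a = x ∧ l = l₂ ++ x :: l₃ := by simpa using hsplit
      exact hlast l₃ hc (by simp at hn; omega) fun v hv => hv
    · obtain ⟨rfl, rfl⟩ : a = a' ∧ l = l₁ ++ x :: (l₂ ++ x :: l₃) := by simpa using hsplit
      refine chainProd_rotate_closed ?_
      have h3 : (l₂ ++ x :: l₃) ++ a :: l₁ = l₂ ++ x :: (l₃ ++ a :: l₁) := by simp
      have hch := hc.rotate_closed
      rw [h3] at hch ⊢
      refine hlast (l₃ ++ a :: l₁) hch (by simp at hn ⊢; omega) fun v hv => ?_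
      simp at hv ⊢
      tauto
  obtain ⟨b, hb, htl⟩ := exists_topLeft a l
  suffices hmain : ∀ l' : List (ℤ × ℤ), (b :: l').Perm (a :: l) →
      List.IsChain (LatticeAdj U) (b :: l' ++ [b]) →
      chainProd (fun p q => e (latticePt p) (latticePt q)) b (l' ++ [b]) = 1 by
    obtain ⟨s, t, hst⟩ := List.append_of_mem hb
    rcases s with _ | ⟨a', s⟩
    · obtain ⟨rfl, rfl⟩ : a = b ∧ l = t := by simpa using hst
      exact hmain l (List.Perm.refl _) hc
    · obtain ⟨rfl, rfl⟩ : a = a' ∧ l = s ++ b :: t := by simpa using hst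
      refine chainProd_rotate_closed (hmain _ ?_ hc.rotate_closed)
      exact List.perm_append_comm (l₁ := b :: t) (l₂ := a :: s)
  intro l' hperm hch
  have hnd' : (b :: l').Nodup := hperm.nodup_iff.2 hnd
  have hlen : l'.length = n := by
    have := hperm.length_eq
    simp at this
    omega
  have hsum : ((b :: l').map fun v => (v.2 - m).toNat).sum = k := by
    rw [← hk]; exact (hperm.map _).sum_eq
  have hm' : ∀ v ∈ b :: l', m ≤ v.2 := fun v hv => hm v (hperm.mem_iff.1 hv)
  have htl' : ∀ v ∈ b :: l', v.2 < b.2 ∨ (v.2 = b.2 ∧ b.1 ≤ v.1) :=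
    fun v hv => htl v (hperm.mem_iff.1 hv)
  rcases l' with _ | ⟨c, l'⟩
  · exfalso
    have : LatticeAdj U b b := by simpa using hch
    rcases this.1 with h | h <;> omega
  rcases List.eq_nil_or_concat' l' with rfl | ⟨l', d, rfl⟩
  · have hbc : LatticeAdj U b c := by simp at hch; exact hch.1
    have h0 := he _ hbc.2 (convex_segment _ _) _ (left_mem_segment _ _ _) _ (right_mem_segment _ _ _) _
      (left_mem_segment _ _ _)
    have h1 := he _ hbc.2 (convex_segment _ _) _ (left_mem_segment _ _ _) _ (left_mem_segment _ _ _) _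
      (left_mem_segment _ _ _)
    simp [chainProd, h0, mul_eq_right.1 h1]
  have hsplit : b :: (c :: (l' ++ [d])) ++ [b] = (b :: c :: l') ++ d :: [b] := by simp
  have hbc : LatticeAdj U b c := by
    rw [List.cons_append, List.cons_append, List.isChain_cons_cons] at hch; exact hch.1
  have hdb : LatticeAdj U d b := by
    rw [hsplit, List.isChain_split] at hch; simpa using hch.2
  have hcl : List.IsChain (LatticeAdj U) (c :: (l' ++ [d])) := by
    rw [hsplit, List.isChain_split] at hch
    have := hch.1
    simp only [List.cons_append, List.isChain_cons_cons] at this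
    exact this.2
  have hcd : c ≠ d := by
    rintro rfl
    simp at hnd'
  have hbl : b ∉ c :: (l' ++ [d]) := (List.nodup_cons.1 hnd').1
  have hcm : c ∈ c :: (l' ++ [d]) := by simp
  have hdm : d ∈ c :: (l' ++ [d]) := by simp
  -- Since `b` is top-left, its neighbours on the walk can lie only to the right and below, and they
  -- are distinct.
  have hloc : (c = (b.1 + 1, b.2) ∧ d = (b.1, b.2 - 1)) ∨
      (d = (b.1 + 1, b.2) ∧ c = (b.1, b.2 - 1)) := by
    have h1 := hbc.1
    have h2 := hdb.1
    have h3 := htl' c (List.mem_cons_of_mem _ hcm)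
    have h4 := htl' d (List.mem_cons_of_mem _ hdm)
    have h5 : c.1 ≠ d.1 ∨ c.2 ≠ d.2 := by
      by_contra! h; exact hcd (Prod.ext h.1 h.2)
    simp only [Prod.ext_iff]
    omega
  have hsq : latticeSquare b ⊆ U := by
    have htop : ∀ v ∈ c :: (l' ++ [d]), v.2 ≤ b.2 := fun v hv => by
      have := htl' v (List.mem_cons_of_mem _ hv); omega
    rcases hloc with ⟨h1, h2⟩ | ⟨h1, h2⟩
    · exact hU.latticeSquare_subset (by simp) hcl hbl htop (h1 ▸ hcm) (h2 ▸ hdm) (h1 ▸ hbc)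
        (h2 ▸ hdb.symm)
    · exact hU.latticeSquare_subset (by simp) hcl hbl htop (h1 ▸ hdm) (h2 ▸ hcm) (h1 ▸ hdb.symm)
        (h2 ▸ hbc)
  have q1 : latticePt b ∈ latticeSquare b := by
    constructor <;> constructor <;> simp [latticePt]
  have q2 : latticePt (b.1 + 1, b.2) ∈ latticeSquare b := by
    constructor <;> constructor <;> simp [latticePt]
  have q3 : latticePt (b.1, b.2 - 1) ∈ latticeSquare b := by
    constructor <;> constructor <;> simp [latticePt]
  have q4 : latticePt (b.1 + 1, b.2 - 1) ∈ latticeSquare b := by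
    constructor <;> constructor <;> simp [latticePt]
  have qc : latticePt c ∈ latticeSquare b := by
    rcases hloc with ⟨h1, h2⟩ | ⟨h1, h2⟩ <;> rw [‹c = _›] <;> assumption
  have qd : latticePt d ∈ latticeSquare b := by
    rcases hloc with ⟨h1, h2⟩ | ⟨h1, h2⟩ <;> rw [‹d = _›] <;> assumption
  refine chainProd_corner he hsq (convex_latticeSquare b) q1 qc qd q4 ?_
  -- The new corner has the height of the lower neighbour, so the bound `m` survives and the
  -- truncated height strictly drops.
  have hmb : m ≤ b.2 - 1 := by
    have h1 := hm' c (List.mem_cons_of_mem _ hcm)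
    have h2 := hm' d (List.mem_cons_of_mem _ hdm)
    rcases hloc with ⟨h3, h4⟩ | ⟨h3, h4⟩
    · rw [h4] at h2; exact h2
    · rw [h4] at h1; exact h1
  have hadj : ∀ p q : ℤ × ℤ, latticePt p ∈ latticeSquare b → latticePt q ∈ latticeSquare b →
      ((q.1 = p.1 ∧ (q.2 = p.2 + 1 ∨ p.2 = q.2 + 1)) ∨
        (q.2 = p.2 ∧ (q.1 = p.1 + 1 ∨ p.1 = q.1 + 1))) → LatticeAdj U p q :=
    fun p q hp hq h => ⟨h, ((convex_latticeSquare b).segment_subset hp hq).trans hsq⟩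
  refine ihk _ ?_ (b.1 + 1, b.2 - 1) (c :: (l' ++ [d])) hlen ?_ rfl ?_
  · rw [← hsum]
    simp only [List.map_cons, List.sum_cons]
    have : (b.2 - 1 - m).toNat < (b.2 - m).toNat := by omega
    omega
  · intro v hv
    rcases List.mem_cons.1 hv with rfl | hv
    · exact hmb
    · exact hm' v (List.mem_cons_of_mem _ hv)
  · have e1 : (b.1 + 1, b.2 - 1) :: (c :: (l' ++ [d])) ++ [(b.1 + 1, b.2 - 1)] =
        ((b.1 + 1, b.2 - 1) :: c :: l') ++ d :: [(b.1 + 1, b.2 - 1)] := by simp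
    rw [e1, List.isChain_split]
    constructor
    · simp only [List.cons_append, List.isChain_cons_cons]
      refine ⟨hadj _ _ q4 qc ?_, hcl⟩
      rcases hloc with ⟨h1, h2⟩ | ⟨h1, h2⟩ <;> rw [‹c = _›] <;> simp
    · rw [List.isChain_pair]
      refine hadj _ _ qd q4 ?_
      rcases hloc with ⟨h1, h2⟩ | ⟨h1, h2⟩ <;> rw [‹d = _›] <;> simp

/-! ### From lattice walks to simple connectivity -/

/-- A path connected space has a group-valued invariant of paths which is multiplicative, invariant
under homotopies, and trivial only on null-homotopic loops. -/
theorem exists_path_invariant (X : Type) [TopologicalSpace X] [PathConnectedSpace X] :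
    ∃ (G : Type) (_ : Group G) (g : ∀ x y : X, Path x y → G),
      (∀ x y z (p : Path x y) (q : Path y z), g x z (p.trans q) = g x y p * g y z q) ∧
      (∀ x y (p q : Path x y), p.Homotopic q → g x y p = g x y q) ∧
      ∀ x (p : Path x x), g x x p = 1 → p.Homotopic (Path.refl x) := by
  obtain ⟨x₀⟩ := PathConnectedSpace.nonempty (X := X)
  -- Fixed tethers from `x₀` turn every path into a loop at `x₀`; the group is the fundamental group
  -- there.
  let s : ∀ x : X, Path.Homotopic.Quotient x₀ x := fun x => .mk (PathConnectedSpace.somePath x₀ x)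
  let g : ∀ x y : X, Path x y → Path.Homotopic.Quotient x₀ x₀ := fun x y p =>
    ((s x).trans (.mk p)).trans (s y).symm
  let G : Group (Path.Homotopic.Quotient x₀ x₀) :=
    { mul := fun p q => p.trans q
      one := Path.Homotopic.Quotient.refl x₀
      inv := fun p => p.symm
      mul_assoc := fun p q r => Path.Homotopic.Quotient.trans_assoc p q r
      one_mul := fun p => Path.Homotopic.Quotient.refl_trans p
      mul_one := fun p => Path.Homotopic.Quotient.trans_refl p
      inv_mul_cancel := fun p => Path.Homotopic.Quotient.symm_trans p }
  have cancel : ∀ {y z : X} (p : Path.Homotopic.Quotient x₀ y) (r : Path.Homotopic.Quotient y z),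
      p.symm.trans (p.trans r) = r := fun p r => by
    rw [← Path.Homotopic.Quotient.trans_assoc, Path.Homotopic.Quotient.symm_trans,
      Path.Homotopic.Quotient.refl_trans]
  refine ⟨Path.Homotopic.Quotient x₀ x₀, G, g, ?_, ?_, ?_⟩
  · intro x y z p q
    change g x z (p.trans q) = (g x y p).trans (g y z q)
    simp [g, cancel]
  · intro x y p q h
    have : (Path.Homotopic.Quotient.mk p) = .mk q := Path.Homotopic.Quotient.eq.2 h
    simp only [g, this]
  · intro x p h
    have h1 : ((s x).trans (.mk p)).trans (s x).symm = Path.Homotopic.Quotient.refl x₀ := h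
    rw [← Path.Homotopic.Quotient.eq]
    calc Path.Homotopic.Quotient.mk p
        = (s x).symm.trans ((((s x).trans (.mk p)).trans (s x).symm).trans (s x)) := by
          simp [cancel]
      _ = _ := by rw [h1]; simp

/-- Two paths in `V` with the same ends and traces in a convex subset are homotopic in `V`. -/
theorem path_homotopic_of_convex {V C : Set ℂ} (hC : Convex ℝ C) (hCV : C ⊆ V) {a b : V}
    (p q : Path a b) (hp : ∀ t, (p t : ℂ) ∈ C) (hq : ∀ t, (q t : ℂ) ∈ C) : p.Homotopic q := by
  refine ⟨⟨⟨⟨fun st => ⟨AffineMap.lineMap (p st.2 : ℂ) (q st.2 : ℂ) (st.1 : ℝ),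
    hCV (hC.lineMap_mem (hp _) (hq _) st.1.2)⟩, ?_⟩, ?_, ?_⟩, ?_⟩⟩
  · refine Continuous.subtype_mk ?_ _
    simp only [AffineMap.lineMap_apply]
    fun_prop
  · intro t; simp
  · intro t; simp
  · intro t x hx
    rcases hx with rfl | rfl <;> simp

/-- The straight path between two points of `V`. -/
noncomputable def segmentPath {V : Set ℂ} (x y : ℂ) (h : segment ℝ x y ⊆ V) :
    Path (⟨x, h (left_mem_segment ℝ x y)⟩ : V) ⟨y, h (right_mem_segment ℝ x y)⟩ where
  toFun t := ⟨AffineMap.lineMap x y (t : ℝ), h (by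
    rw [segment_eq_image_lineMap]; exact mem_image_of_mem _ t.2)⟩
  continuous_toFun := by
    refine Continuous.subtype_mk ?_ _
    simp only [AffineMap.lineMap_apply]
    fun_prop
  source' := by simp
  target' := by simp

theorem segmentPath_mem {V C : Set ℂ} {x y : ℂ} (h : segment ℝ x y ⊆ V) (hC : Convex ℝ C)
    (hx : x ∈ C) (hy : y ∈ C) (t : unitInterval) : (segmentPath x y h t : ℂ) ∈ C :=
  hC.lineMap_mem hx hy t.2

/-- Rescaling lets the unit lattice serve for every mesh size. -/
theorem HasLogBranches.preimage_mul {V : Set ℂ} (hV : HasLogBranches V) {h : ℝ} (hh : 0 < h) :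
    HasLogBranches {z | (h : ℂ) * z ∈ V} := by
  have h0 : (h : ℂ) ≠ 0 := by exact_mod_cast hh.ne'
  intro K hKV hK c hc
  obtain ⟨L, hL, hLe⟩ := hV ((fun z => (h : ℂ) * z) '' K) (by rintro _ ⟨z, hz, rfl⟩; exact hKV hz)
    (hK.image (by fun_prop)) _ hc
  refine ⟨fun z => L (h * z) - Complex.log h, ?_, fun z hz => ?_⟩
  · exact (hL.comp (by fun_prop) (mapsTo_image _ _)).sub continuousOn_const
  · rw [Complex.exp_sub, hLe _ (mem_image_of_mem _ hz), Complex.exp_log h0]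
    field_simp

/-- `LatticeWalk U E p q g`: there is a lattice walk in `U` from `p` to `q` along which the values
of `E` multiply to `g`. -/
inductive LatticeWalk {G : Type*} [Group G] (U : Set ℂ) (E : ℤ × ℤ → ℤ × ℤ → G) (p : ℤ × ℤ) :
    ℤ × ℤ → G → Prop
  | refl : LatticeWalk U E p p 1
  | step {q r : ℤ × ℤ} {g : G} : LatticeWalk U E p q g → LatticeAdj U q r →
      LatticeWalk U E p r (g * E q r)

theorem LatticeWalk.exists_list {G : Type*} [Group G] {U : Set ℂ} {E : ℤ × ℤ → ℤ × ℤ → G}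
    {p q : ℤ × ℤ} {g : G} (h : LatticeWalk U E p q g) : (p = q ∧ g = 1) ∨
      ∃ l, List.IsChain (LatticeAdj U) (p :: l ++ [q]) ∧ chainProd E p (l ++ [q]) = g := by
  induction h with
  | refl => exact Or.inl ⟨rfl, rfl⟩
  | @step q r g _ hqr ih =>
    right
    rcases ih with ⟨rfl, rfl⟩ | ⟨l, hl, rfl⟩
    · exact ⟨[], by simpa using hqr, by simp [chainProd]⟩
    · refine ⟨l ++ [q], ?_, ?_⟩
      · have : p :: (l ++ [q]) ++ [r] = (p :: l) ++ q :: [r] := by simp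
        rw [this, List.isChain_split]
        exact ⟨hl, by simpa using hqr⟩
      · have : (l ++ [q]) ++ [r] = l ++ q :: [r] := by simp
        rw [this, chainProd_append]
        simp [chainProd]

theorem LatticeWalk.eq_one {G : Type*} [Group G] {U : Set ℂ} (hU : HasLogBranches U)
    {e : ℂ → ℂ → G} (he : IsConvexCocycle U e) {p : ℤ × ℤ} {g : G}
    (h : LatticeWalk U (fun p q => e (latticePt p) (latticePt q)) p p g) : g = 1 := by
  rcases h.exists_list with ⟨-, h⟩ | ⟨l, hl, rfl⟩
  · exact h
  · obtain ⟨m, hm⟩ : ∃ m : ℤ, ∀ v ∈ p :: l, m ≤ v.2 := by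
      obtain ⟨m, hm⟩ := ((p :: l).toFinset.image Prod.snd).bddBelow
      exact ⟨m, fun v hv => hm (Finset.mem_image_of_mem _ (List.mem_toFinset.2 hv))⟩
    exact chainProd_closed_lattice_walk hU he m _ _ p l rfl hm rfl hl

theorem IsConvexCocycle.self_eq_one {G : Type*} [Group G] {U : Set ℂ} {e : ℂ → ℂ → G}
    (he : IsConvexCocycle U e) {x : ℂ} (hx : x ∈ U) : e x x = 1 := by
  have := he {x} (singleton_subset_iff.2 hx) (convex_singleton x) x rfl x rfl x rfl
  exact mul_eq_right.1 this

/-- Rounding two nearby points can change both coordinates by one. The diagonal step is replaced by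
a horizontal and a vertical one inside `C`, which the cocycle does not notice. -/
theorem LatticeWalk.diagonal {G : Type*} [Group G] {U C : Set ℂ} {e : ℂ → ℂ → G}
    (he : IsConvexCocycle U e) (hC : Convex ℝ C) (hCU : C ⊆ U) {p q r : ℤ × ℤ} {g : G}
    (h : LatticeWalk U (fun p q => e (latticePt p) (latticePt q)) p q g)
    (hq : latticePt q ∈ C) (hr : latticePt r ∈ C) (hqr : latticePt (r.1, q.2) ∈ C)
    (h1 : r.1 ≤ q.1 + 1) (h2 : q.1 ≤ r.1 + 1) (h3 : r.2 ≤ q.2 + 1) (h4 : q.2 ≤ r.2 + 1) :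
    LatticeWalk U (fun p q => e (latticePt p) (latticePt q)) p r
      (g * e (latticePt q) (latticePt r)) := by
  have aux : ∀ (q r : ℤ × ℤ) (g : G), latticePt q ∈ C → latticePt r ∈ C →
      (q = r ∨ ((r.1 = q.1 ∧ (r.2 = q.2 + 1 ∨ q.2 = r.2 + 1)) ∨
        (r.2 = q.2 ∧ (r.1 = q.1 + 1 ∨ q.1 = r.1 + 1)))) →
      LatticeWalk U (fun p q => e (latticePt p) (latticePt q)) p q g →
      LatticeWalk U (fun p q => e (latticePt p) (latticePt q)) p r
        (g * e (latticePt q) (latticePt r)) := by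
    intro q r g hq hr hor hw
    rcases hor with rfl | hor
    · rw [he.self_eq_one (hCU hq), mul_one]; exact hw
    · exact hw.step ⟨hor, (hC.segment_subset hq hr).trans hCU⟩
  rw [← he C hCU hC _ hq _ hqr _ hr, ← mul_assoc]
  refine aux _ _ _ hqr hr ?_ (aux _ _ _ hq hqr ?_ h)
  · rcases eq_or_ne q.2 r.2 with h | h
    · exact Or.inl (Prod.ext rfl h)
    · refine Or.inr (Or.inl ⟨rfl, ?_⟩)
      simp only
      omega
  · rcases eq_or_ne q.1 r.1 with h | h
    · exact Or.inl (Prod.ext h rfl)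
    · refine Or.inr (Or.inr ⟨rfl, ?_⟩)
      simp only
      omega

theorem abs_floor_sub_floor_le {x y : ℝ} (h : |x - y| ≤ 1) :
    ⌊y⌋ ≤ ⌊x⌋ + 1 ∧ ⌊x⌋ ≤ ⌊y⌋ + 1 := by
  rw [abs_le] at h
  constructor
  · rw [← Int.floor_add_one]; exact Int.floor_mono (by linarith)
  · rw [← Int.floor_add_one]; exact Int.floor_mono (by linarith)

theorem norm_sub_latticePt_floor_le {z : ℂ} : ‖z - latticePt (⌊z.re⌋, ⌊z.im⌋)‖ ≤ 2 := by
  refine (Complex.norm_le_abs_re_add_abs_im _).trans ?_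
  have h1 : |z.re - ⌊z.re⌋| ≤ 1 := by
    rw [abs_le]; constructor <;> linarith [Int.floor_le z.re, Int.lt_floor_add_one z.re]
  have h2 : |z.im - ⌊z.im⌋| ≤ 1 := by
    rw [abs_le]; constructor <;> linarith [Int.floor_le z.im, Int.lt_floor_add_one z.im]
  simp only [latticePt, Complex.sub_re, Complex.sub_im]
  linarith

/-- Chains of points: a cocycle multiplies to `1` along a closed chain with small steps. -/
theorem prod_cocycle_closed {G : Type*} [Group G] {V : Set ℂ} (hV : HasLogBranches V)
    {e : ℂ → ℂ → G} (he : IsConvexCocycle V e) {h : ℝ} (hh : 0 < h) (b : ℕ → ℂ) (n : ℕ)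
    (hb : ∀ i, Metric.ball (b i) (10 * h) ⊆ V) (hstep : ∀ i, ‖b (i + 1) - b i‖ ≤ h)
    (hn : b n = b 0) (P : ℕ → G) (hP0 : P 0 = 1) (hP : ∀ i, P (i + 1) = P i * e (b i) (b (i + 1))) :
    P n = 1 := by
  have h0 : (h : ℂ) ≠ 0 := by exact_mod_cast hh.ne'
  set U : Set ℂ := {z | (h : ℂ) * z ∈ V} with hUdef
  have hU : HasLogBranches U := hV.preimage_mul hh
  set e' : ℂ → ℂ → G := fun z w => e (h * z) (h * w) with he'def
  have he' : IsConvexCocycle U e' := by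
    intro C hCU hC x hx y hy z hz
    refine he ((fun z => (h : ℂ) * z) '' C) ?_ ?_ _ (mem_image_of_mem _ hx) _ (mem_image_of_mem _ hy) _
      (mem_image_of_mem _ hz)
    · rintro _ ⟨z, hz, rfl⟩; exact hCU hz
    · have := hC.is_linear_image (f := fun z : ℂ => (h : ℂ) * z)
        ⟨fun x y => mul_add _ _ _, fun c x => by simp [Complex.real_smul]; ring⟩
      exact this
  set w : ℕ → ℂ := fun i => b i / h with hw
  have hbw : ∀ i, b i = h * w i := fun i => by simp only [hw]; field_simp
  have hball : ∀ i, Metric.ball (w i) 10 ⊆ U := by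
    intro i z hz
    refine hb i ?_
    rw [Metric.mem_ball, Complex.dist_eq] at hz ⊢
    rw [hbw, ← mul_sub, norm_mul, Complex.norm_real, Real.norm_of_nonneg hh.le, mul_comm]
    exact mul_lt_mul_of_pos_right hz hh
  have hwstep : ∀ i, ‖w (i + 1) - w i‖ ≤ 1 := by
    intro i
    have := hstep i
    rw [hbw, hbw, ← mul_sub, norm_mul, Complex.norm_real, Real.norm_of_nonneg hh.le] at this
    exact (mul_le_iff_le_one_right hh).1 this
  set p : ℕ → ℤ × ℤ := fun i => (⌊(w i).re⌋, ⌊(w i).im⌋) with hp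
  have hpw : ∀ i, ‖w i - latticePt (p i)‖ ≤ 2 := fun i => norm_sub_latticePt_floor_le
  -- Each partial product is compared with a detour: from `w 0` to its lattice point, along the
  -- rounded walk, and back to `w i`. Every point needed at a step is within distance 3 of `w i`,
  -- well inside the ball of radius 10.
  have key : ∀ i, ∃ g, LatticeWalk U (fun p q => e' (latticePt p) (latticePt q)) (p 0) (p i) g ∧
      P i = e' (w 0) (latticePt (p 0)) * g * e' (latticePt (p i)) (w i) := by
    intro i
    have hmem : ∀ i, w i ∈ Metric.ball (w i) 10 := fun i => Metric.mem_ball_self (by norm_num)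
    have hpmem : ∀ i, latticePt (p i) ∈ Metric.ball (w i) 10 := fun i => by
      rw [Metric.mem_ball, dist_comm, Complex.dist_eq]; linarith [hpw i]
    induction i with
    | zero =>
      refine ⟨1, LatticeWalk.refl, ?_⟩
      rw [hP0, mul_one, he' _ (hball 0) (convex_ball _ _) _ (hmem 0) _ (hpmem 0) _ (hmem 0),
        he'.self_eq_one (hball 0 (hmem 0))]
    | succ i ih =>
      obtain ⟨g, hg, hPi⟩ := ih
      have hw1 : w (i + 1) ∈ Metric.ball (w i) 10 := by
        rw [Metric.mem_ball, Complex.dist_eq]; linarith [hwstep i]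
      have hp1 : latticePt (p (i + 1)) ∈ Metric.ball (w i) 10 := by
        rw [Metric.mem_ball, Complex.dist_eq]
        have h1 := norm_add_le (latticePt (p (i + 1)) - w (i + 1)) (w (i + 1) - w i)
        rw [sub_add_sub_cancel, norm_sub_rev (latticePt _) (w (i + 1))] at h1
        linarith [hpw (i + 1), hwstep i]
      have hre : |(w (i + 1)).re - (w i).re| ≤ 1 := by
        have := Complex.abs_re_le_norm (w (i + 1) - w i)
        rw [Complex.sub_re] at this; linarith [hwstep i]
      have him : |(w (i + 1)).im - (w i).im| ≤ 1 := by
        have := Complex.abs_im_le_norm (w (i + 1) - w i)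
        rw [Complex.sub_im] at this; linarith [hwstep i]
      have hre' := abs_floor_sub_floor_le hre
      have him' := abs_floor_sub_floor_le him
      have hpq : latticePt ((p (i + 1)).1, (p i).2) ∈ Metric.ball (w i) 10 := by
        rw [Metric.mem_ball, Complex.dist_eq]
        have h1 : ‖latticePt ((p (i + 1)).1, (p i).2) - latticePt (p i)‖ ≤ 1 := by
          refine (Complex.norm_le_abs_re_add_abs_im _).trans ?_
          simp only [latticePt, Complex.sub_re, Complex.sub_im, sub_self, abs_zero, add_zero]
          rw [abs_le]
          have e1 : ((p (i + 1)).1 : ℝ) ≤ (p i).1 + 1 := by exact_mod_cast hre'.2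
          have e2 : ((p i).1 : ℝ) ≤ (p (i + 1)).1 + 1 := by exact_mod_cast hre'.1
          constructor <;> linarith
        have h2 := norm_add_le (latticePt ((p (i + 1)).1, (p i).2) - latticePt (p i))
          (latticePt (p i) - w i)
        rw [sub_add_sub_cancel, norm_sub_rev (latticePt (p i)) (w i)] at h2
        linarith [hpw i]
      refine ⟨_, hg.diagonal he' (convex_ball _ _) (hball i) (hpmem i) hp1 hpq hre'.2 hre'.1
        him'.2 him'.1, ?_⟩
      have c1 := he' _ (hball i) (convex_ball _ _) _ (hpmem i) _ (hmem i) _ hw1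
      have c2 := he' _ (hball i) (convex_ball _ _) _ (hpmem i) _ hp1 _ hw1
      have c3 : e (b i) (b (i + 1)) = e' (w i) (w (i + 1)) := by
        simp only [he'def, ← hbw]
      rw [hP, hPi, c3, mul_assoc _ _ (e' (w i) _), c1, ← c2]
      simp only [mul_assoc]
  obtain ⟨g, hg, hPn⟩ := key n
  have hwn : w n = w 0 := by simp only [hw, hn]
  have hpn : p n = p 0 := by simp only [hp, hwn]
  rw [hpn] at hg
  have hw0 : w 0 ∈ Metric.ball (w 0) 10 := Metric.mem_ball_self (by norm_num)
  have hp0 : latticePt (p 0) ∈ Metric.ball (w 0) 10 := by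
      rw [Metric.mem_ball, dist_comm, Complex.dist_eq]; linarith [hpw 0]
  rw [hPn, hg.eq_one hU he', mul_one, hpn, hwn, he' _ (hball 0) (convex_ball _ _) _ hw0 _ hp0 _ hw0,
    he'.self_eq_one (hball 0 hw0)]

/-- The components of an open set with logarithm branches are simply connected. -/
theorem HasLogBranches.isSimplyConnected_connectedComponentIn {V : Set ℂ} (hVo : IsOpen V)
    (hV : HasLogBranches V) {z : ℂ} (hz : z ∈ V) : IsSimplyConnected (connectedComponentIn V z) := by
  classical
  set V₀ := connectedComponentIn V z with hV₀
  have hV₀o : IsOpen V₀ := hVo.connectedComponentIn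
  have hpc : IsPathConnected V₀ :=
    hV₀o.isConnected_iff_isPathConnected.1 (isConnected_connectedComponentIn_iff.2 hz)
  have : PathConnectedSpace V₀ := isPathConnected_iff_pathConnectedSpace.1 hpc
  rw [IsSimplyConnected, simply_connected_iff_loops_nullhomotopic]
  refine ⟨inferInstance, fun x β => ?_⟩
  obtain ⟨G, _, g, hmul, hhom, hone⟩ := exists_path_invariant V₀
  refine hone x β ?_
  have hmul_refl : ∀ x : V₀, g x x (Path.refl x) = 1 := fun x => by
    have h1 := hmul _ _ _ (Path.refl x) (Path.refl x)
    rw [Path.refl_trans_refl] at h1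
    exact mul_eq_left.1 h1.symm
  -- The invariant of the straight path, with the harmless value 1 when the segment leaves `V₀`.
  let e : ℂ → ℂ → G := fun a b => if h : segment ℝ a b ⊆ V₀ then g _ _ (segmentPath a b h) else 1
  have hein : ∀ C ⊆ V₀, Convex ℝ C → ∀ (a b : V₀) (p : Path a b), (∀ t, (p t : ℂ) ∈ C) →
      g a b p = e a b := by
    intro C hCV hC a b p hp
    have ha : (a : ℂ) ∈ C := by simpa using hp 0
    have hb : (b : ℂ) ∈ C := by simpa using hp 1
    have hs : segment ℝ (a : ℂ) b ⊆ V₀ := (hC.segment_subset ha hb).trans hCV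
    simp only [e, dif_pos hs]
    exact hhom _ _ _ _ (path_homotopic_of_convex hC hCV _ _ hp
      (fun t => segmentPath_mem hs hC ha hb t))
  -- The cocycle is needed on all of `V`, where the logarithm branches are given. A convex subset of
  -- `V` lies in `V₀` or misses it, and in the latter case all values are 1.
  have he : IsConvexCocycle V e := by
    intro C hCV hC a ha b hb c hc
    by_cases haV : a ∈ V₀
    · have hCV₀ : C ⊆ V₀ := by
        have := hC.isPreconnected.subset_connectedComponentIn ha hCV
        rwa [← connectedComponentIn_eq haV] at this
      have hab := (hC.segment_subset ha hb).trans hCV₀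
      have hbc := (hC.segment_subset hb hc).trans hCV₀
      rw [← hein C hCV₀ hC ⟨a, hCV₀ ha⟩ ⟨b, hCV₀ hb⟩ (segmentPath a b hab)
        (segmentPath_mem hab hC ha hb), ← hein C hCV₀ hC ⟨b, hCV₀ hb⟩ ⟨c, hCV₀ hc⟩
        (segmentPath b c hbc) (segmentPath_mem hbc hC hb hc), ← hmul]
      refine hein C hCV₀ hC ⟨a, hCV₀ ha⟩ ⟨c, hCV₀ hc⟩ _ fun t => ?_
      have ht : ((segmentPath a b hab).trans (segmentPath b c hbc)) t ∈
          range ((segmentPath a b hab).trans (segmentPath b c hbc)) := mem_range_self t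
      rw [Path.trans_range] at ht
      rcases ht with ⟨s, hs⟩ | ⟨s, hs⟩
      · rw [← hs]; exact segmentPath_mem hab hC ha hb s
      · rw [← hs]; exact segmentPath_mem hbc hC hb hc s
    · have hnot : ∀ y ∈ C, y ∉ V₀ := by
        intro y hy hyV
        have := hC.isPreconnected.subset_connectedComponentIn hy hCV ha
        rw [← connectedComponentIn_eq hyV] at this
        exact haV this
      have h1 : ¬ segment ℝ a b ⊆ V₀ := fun h => haV (h (left_mem_segment _ _ _))
      have h2 : ¬ segment ℝ b c ⊆ V₀ := fun h => hnot b hb (h (left_mem_segment _ _ _))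
      have h3 : ¬ segment ℝ a c ⊆ V₀ := fun h => haV (h (left_mem_segment _ _ _))
      simp only [e, dif_neg h1, dif_neg h2, dif_neg h3, mul_one]
  have hcont : Continuous fun t => (β t : ℂ) := by fun_prop
  obtain ⟨ε, hε, hεV⟩ := (isCompact_range hcont).exists_thickening_subset_open hV₀o
    (by rintro _ ⟨t, rfl⟩; exact (β t).2)
  have hball : ∀ t, Metric.ball (β t : ℂ) ε ⊆ V₀ := fun t =>
    (Metric.ball_subset_thickening (mem_range_self t) ε).trans hεV
  have huc := CompactSpace.uniformContinuous_of_continuous hcont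
  obtain ⟨d, hd, hdβ⟩ := Metric.uniformContinuous_iff.1 huc (ε / 10) (by positivity)
  obtain ⟨n, hn⟩ := exists_nat_one_div_lt hd
  let t : ℕ → unitInterval := fun i => projIcc 0 1 zero_le_one ((i : ℝ) / (n + 1))
  have ht0 : t 0 = 0 := by simp [t]
  have htn : t (n + 1) = 1 := by
    have : ((n + 1 : ℕ) : ℝ) / (n + 1) = 1 := by push_cast; field_simp
    simp only [t, this]
    exact projIcc_right (zero_le_one (α := ℝ))
  have htd : ∀ i, ∀ s ∈ uIcc (t i) (t (i + 1)), dist s (t i) < d := by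
    intro i s hs
    have h1 : dist (t (i + 1)) (t i) ≤ 1 / (n + 1) := by
      refine (abs_projIcc_sub_projIcc zero_le_one).trans (le_of_eq ?_)
      rw [← sub_div, Nat.cast_succ, add_sub_cancel_left, abs_of_pos (by positivity)]
    refine lt_of_le_of_lt (le_trans ?_ h1) hn
    have := abs_sub_left_of_mem_uIcc (a := (t i : ℝ)) (b := t (i + 1)) (c := s) ?_
    · rw [Subtype.dist_eq, Subtype.dist_eq, Real.dist_eq, Real.dist_eq]; exact this
    · rw [mem_uIcc] at hs ⊢
      exact_mod_cast hs
  have hsub : ∀ i, g _ _ (β.subpath (t i) (t (i + 1))) = e (β (t i)) (β (t (i + 1))) := by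
    intro i
    refine hein _ (hball (t i)) (convex_ball _ _) _ _ _ fun s => ?_
    have h1 : β.subpath (t i) (t (i + 1)) s ∈ range (β.subpath (t i) (t (i + 1))) :=
      mem_range_self s
    rw [Path.range_subpath] at h1
    obtain ⟨u, hu, hu'⟩ := h1
    rw [← hu']
    exact lt_trans (hdβ (htd i u hu)) (by linarith)
  have hfin := prod_cocycle_closed hV he (h := ε / 10) (by positivity)
    (fun i => (β (t i) : ℂ)) (n + 1) ?_ ?_ ?_ (fun i => g _ _ (β.subpath (t 0) (t i))) ?_ ?_
  · have h1 : ∀ (x' y' : V₀) (h1 : x' = x) (h2 : y' = x), g x' y' (β.cast h1 h2) = 1 →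
        g x x β = 1 := by
      rintro _ _ rfl rfl h; exact h
    have h2 : ∀ u v : unitInterval, u = 0 → v = 1 → g _ _ (β.subpath u v) = 1 → g x x β = 1 := by
      rintro _ _ rfl rfl h
      rw [Path.subpath_zero_one] at h
      exact h1 _ _ _ _ h
    exact h2 _ _ ht0 htn hfin
  · intro i
    have : 10 * (ε / 10) = ε := by ring
    rw [this]
    exact (hball _).trans (connectedComponentIn_subset _ _)
  · intro i
    rw [← Complex.dist_eq]
    exact (hdβ (htd i _ right_mem_uIcc)).le
  · simp only [ht0, htn]; simp
  · rw [Path.subpath_self]; exact hmul_refl _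
  · intro i
    rw [← hsub, ← hmul]
    exact hhom _ _ _ _ ⟨(Path.Homotopy.subpathTransSubpath β _ _ _).symm⟩

/-! ### Tracts over a neighbourhood of infinity -/

/-- An entire function of polynomial growth is a polynomial. -/
theorem exists_polynomial_of_growth {f : ℂ → ℂ} (hf : Differentiable ℂ f) {C M : ℝ} {k : ℕ}
    (h : ∀ z, M ≤ ‖z‖ → ‖f z‖ ≤ (C * ‖z‖) ^ k) : ∃ p : Polynomial ℂ, ∀ z, f z = p.eval z := by
  -- Cauchy estimates on circles of radius tending to infinity kill all Taylor coefficients beyond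
  -- degree `k`.
  have h0 : ∀ m, k < m → iteratedDeriv m f 0 = 0 := by
    intro m hm
    have hbound : ∀ r : ℝ, max M 1 ≤ r →
        ‖iteratedDeriv m f 0‖ ≤ m.factorial * |C| ^ k * r⁻¹ := by
      intro r hr
      have hr1 : 1 ≤ r := (le_max_right _ _).trans hr
      have hr0 : 0 < r := by linarith
      have h1 := Complex.norm_iteratedDeriv_le_of_forall_mem_sphere_norm_le m hr0
        (hf.diffContOnCl (s := Metric.ball 0 r)) (C := (|C| * r) ^ k) (by
        intro z hz
        have hz' : ‖z‖ = r := by simpa using hz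
        have h2 := h z (by rw [hz']; exact (le_max_left _ _).trans hr)
        rw [hz'] at h2
        refine h2.trans ((le_abs_self _).trans ?_)
        rw [abs_pow, abs_mul, abs_of_pos hr0])
      refine h1.trans ?_
      rw [mul_pow, mul_div_assoc, mul_assoc, mul_div_assoc]
      have h3 : r ^ k / r ^ m ≤ r⁻¹ := by
        rw [div_le_iff₀ (by positivity), inv_mul_eq_div, le_div_iff₀ hr0, ← pow_succ]
        exact pow_le_pow_right₀ hr1 hm
      gcongr
    have hlim : Tendsto (fun r : ℝ => m.factorial * |C| ^ k * r⁻¹) atTop (𝓝 0) := by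
      simpa using tendsto_inv_atTop_zero.const_mul ((m.factorial : ℝ) * |C| ^ k)
    have h2 := ge_of_tendsto hlim ((eventually_ge_atTop _).mono hbound)
    exact norm_le_zero_iff.1 h2
  refine ⟨∑ m ∈ Finset.range (k + 1), Polynomial.C ((m.factorial : ℂ)⁻¹ * iteratedDeriv m f 0) *
    Polynomial.X ^ m, fun z => ?_⟩
  rw [← Complex.taylorSeries_eq_of_entire' 0 z hf, tsum_eq_sum (s := Finset.range (k + 1))]
  · simp [Polynomial.eval_finsetSum]
  · intro m hm
    rw [h0 m (by simpa using hm)]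
    simp

theorem IsTranscendentalEntire.isOpenMap {f : ℂ → ℂ} (hf : IsTranscendentalEntire f) :
    IsOpenMap f := by
  rcases AnalyticOnNhd.is_constant_or_isOpenMap (g := f) (fun z _ => hf.1.analyticAt z) with
    ⟨w, hw⟩ | h
  · exact absurd ⟨Polynomial.C w, fun z => by simp [hw]⟩ hf.2
  · exact h

theorem convex_logHalfPlane (R : ℝ) : Convex ℝ {w : ℂ | R < w.re} := convex_halfSpace_re_gt R

theorem isOpen_logHalfPlane (R : ℝ) : IsOpen {w : ℂ | R < w.re} :=
  isOpen_lt continuous_const Complex.continuous_re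

theorem lt_norm_exp {R : ℝ} (hR : 0 < R) {w : ℂ} (hw : Real.log R < w.re) : R < ‖Complex.exp w‖ := by
  rw [Complex.norm_exp]; exact (Real.log_lt_iff_lt_exp hR).1 hw

theorem norm_lt_of_mem_singularSet {f : ℂ → ℂ} {R : ℝ} (hS : singularSet f ⊆ Metric.ball 0 R) {w : ℂ}
    (hw : R < ‖w‖) : w ∉ singularSet f := fun h => by
  have := hS h
  rw [mem_ball_zero_iff] at this
  exact lt_asymm this hw

/-- A continuous function obtained by inverting a locally injective holomorphic function is
differentiable. -/
theorem hasDerivAt_of_comp_eq {f g G : ℂ → ℂ} {f' g' w : ℂ} (hf : HasStrictDerivAt f f' (G w))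
    (hf' : f' ≠ 0) (hG : ContinuousAt G w) (hg : HasDerivAt g g' w)
    (h : ∀ᶠ x in 𝓝 w, f (G x) = g x) : HasDerivAt G (f'⁻¹ * g') w := by
  have h2 := (hf.hasStrictFDerivAt_equiv hf').eventually_left_inverse
  have h4 := (hf.to_localInverse hf').hasDerivAt
  rw [h.self_of_nhds] at h4
  refine (h4.comp w hg).congr_of_eventuallyEq ?_
  filter_upwards [hG.eventually h2, h] with x hx hx'
  rw [← hx, hx']
  rfl

/-- A lift of the exponential through `f` over the half-plane `log R < re w`. -/
structure IsTractParam (f : ℂ → ℂ) (R : ℝ) (Φ : ℂ → ℂ) : Prop where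
  cont : ContinuousOn Φ {w | Real.log R < w.re}
  comp : ∀ w, Real.log R < w.re → f (Φ w) = Complex.exp w

theorem exists_isTractParam {f : ℂ → ℂ} (hf : Differentiable ℂ f) {R : ℝ} (hR : 0 < R)
    (hS : singularSet f ⊆ Metric.ball 0 R) {w₀ z₀ : ℂ} (hw₀ : Real.log R < w₀.re)
    (h : f z₀ = Complex.exp w₀) : ∃ Φ, IsTractParam f R Φ ∧ Φ w₀ = z₀ := by
  have : ContractibleSpace {w : ℂ | Real.log R < w.re} :=
    (convex_logHalfPlane _).contractibleSpace ⟨w₀, hw₀⟩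
  obtain ⟨F, hF, hF0, hFe⟩ := exists_lift_on_isSimplyConnected hf (isOpen_logHalfPlane (Real.log R))
    (SimplyConnectedSpace.ofContractible _) (g := Complex.exp) (by fun_prop)
    (fun a ha => norm_lt_of_mem_singularSet hS (lt_norm_exp hR ha)) hw₀ h
  exact ⟨F, ⟨hF, hFe⟩, hF0⟩

namespace IsTractParam

variable {f : ℂ → ℂ} {R : ℝ} {Φ Ψ : ℂ → ℂ}

theorem eq_of_eq (hΦ : IsTractParam f R Φ) (hf : Differentiable ℂ f) (hR : 0 < R)
    (hS : singularSet f ⊆ Metric.ball 0 R) (hΨ : IsTractParam f R Ψ) {w₀ w : ℂ}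
    (hw₀ : Real.log R < w₀.re) (h : Φ w₀ = Ψ w₀) (hw : Real.log R < w.re) : Φ w = Ψ w := by
  refine eqOn_of_comp_eqOn_of_notMem_singularSet hf (convex_logHalfPlane (Real.log R)).isPreconnected
    hΦ.cont hΨ.cont (fun x hx => ?_) (fun x hx => ?_) hw₀ h hw
  · simp only [Function.comp, hΦ.comp x hx, hΨ.comp x hx]
  · rw [hΦ.comp x hx]; exact norm_lt_of_mem_singularSet hS (lt_norm_exp hR hx)

theorem translate (hΦ : IsTractParam f R Φ) (k : ℤ) :
    IsTractParam f R fun w => Φ (w + k * (2 * Real.pi * Complex.I)) := by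
  have hre : ∀ w : ℂ, (w + k * (2 * Real.pi * Complex.I)).re = w.re := fun w => by simp
  refine ⟨hΦ.cont.comp (by fun_prop) fun w hw => ?_, fun w hw => ?_⟩
  · simpa [hre] using hw
  · rw [hΦ.comp _ (by rw [hre]; exact hw), Complex.exp_periodic.int_mul]

theorem hasDerivAt (hΦ : IsTractParam f R Φ) (hf : Differentiable ℂ f) (hR : 0 < R)
    (hS : singularSet f ⊆ Metric.ball 0 R) {w : ℂ} (hw : Real.log R < w.re) :
    HasDerivAt Φ ((deriv f (Φ w))⁻¹ * f (Φ w)) w ∧ deriv f (Φ w) ≠ 0 := by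
  have h0 : deriv f (Φ w) ≠ 0 := deriv_ne_zero_of_notMem_singularSet (by
    rw [hΦ.comp w hw]; exact norm_lt_of_mem_singularSet hS (lt_norm_exp hR hw))
  refine ⟨?_, h0⟩
  have hnhds : {w : ℂ | Real.log R < w.re} ∈ 𝓝 w := (isOpen_logHalfPlane _).mem_nhds hw
  rw [hΦ.comp w hw]
  refine hasDerivAt_of_comp_eq (hf.analyticAt _).hasStrictDerivAt h0 (hΦ.cont.continuousAt hnhds)
    (Complex.hasDerivAt_exp w) ?_
  filter_upwards [hnhds] with x hx using hΦ.comp x hx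

theorem isOpen_image (hΦ : IsTractParam f R Φ) (hf : Differentiable ℂ f) (hR : 0 < R)
    (hS : singularSet f ⊆ Metric.ball 0 R) {s : Set ℂ} (hs : s ⊆ {w | Real.log R < w.re})
    (hso : IsOpen s) : IsOpen (Φ '' s) := by
  have hd : DifferentiableOn ℂ Φ {w | Real.log R < w.re} := fun w hw =>
    (hΦ.hasDerivAt hf hR hS hw).1.differentiableAt.differentiableWithinAt
  have han := hd.analyticOnNhd (isOpen_logHalfPlane _)
  rcases han.is_constant_or_isOpen (convex_logHalfPlane (Real.log R)).isPreconnected with ⟨c, hc⟩ | h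
  · have hw : Real.log R < ((Real.log R + 1 : ℝ) : ℂ).re := by simp
    obtain ⟨h1, h2⟩ := hΦ.hasDerivAt hf hR hS hw
    have h3 : HasDerivAt Φ 0 ((Real.log R + 1 : ℝ) : ℂ) := by
      refine (hasDerivAt_const _ c).congr_of_eventuallyEq ?_
      filter_upwards [(isOpen_logHalfPlane (Real.log R)).mem_nhds hw] with x hx using hc x hx
    have h4 := h1.unique h3
    rw [hΦ.comp _ hw] at h4
    exact absurd h4 (mul_ne_zero (inv_ne_zero h2) (Complex.exp_ne_zero _))
  · exact h s hs hso

/-- On a closed disc `f` is bounded, whereas |f(Φ w)| is the exponential of re w. -/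
theorem lt_norm (hΦ : IsTractParam f R Φ) (hf : Differentiable ℂ f) (M : ℝ) :
    ∃ B : ℝ, ∀ w : ℂ, Real.log R < w.re → B < w.re → M < ‖Φ w‖ := by
  obtain ⟨B, hB⟩ := (isCompact_closedBall (0 : ℂ) M).exists_bound_of_continuousOn
    hf.continuous.continuousOn
  refine ⟨Real.log (max B 1), fun w hw hBw => ?_⟩
  by_contra! h
  have h1 := hB (Φ w) (by simpa using h)
  rw [hΦ.comp w hw] at h1
  have := lt_norm_exp (lt_max_of_lt_right one_pos) hBw
  exact absurd (h1.trans (le_max_left _ _)) (not_le.2 this)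

end IsTractParam

namespace IsTractParam

variable {f : ℂ → ℂ} {R : ℝ} {Φ Ψ : ℂ → ℂ}

/-- A tract parametrization of a transcendental function is not periodic. -/
theorem not_periodic (hΦ : IsTractParam f R Φ) (hf : IsTranscendentalEntire f) (hR : 0 < R)
    (hS : singularSet f ⊆ Metric.ball 0 R) {k : ℕ} (hk : 0 < k) :
    ¬ ∀ w : ℂ, Real.log R < w.re → Φ (w + k * (2 * Real.pi * Complex.I)) = Φ w := by
  classical
  intro hper
  have hk0 : (0 : ℝ) < k := by exact_mod_cast hk
  set h : ℝ := 2 * Real.pi * k with hh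
  have hh0 : 0 < h := by positivity
  have hre : ∀ z : ℂ, (-Complex.I * z).re = z.im := fun z => by simp
  -- Rotating the half-plane upright makes the period real. As 1/Φ tends to 0 high up, it descends
  -- to a function `g` of q = exp(2πiz/h), holomorphic at q = 0 with g(0) = 0. The value 0 below the
  -- half-plane only keeps `u` periodic.
  let u : ℂ → ℂ := fun z => if Real.log R < z.im then (Φ (-Complex.I * z))⁻¹ else 0
  have hu : ∀ z : ℂ, Real.log R < z.im → u z = (Φ (-Complex.I * z))⁻¹ := fun z hz => if_pos hz
  have hup : Function.Periodic u (h : ℂ) := by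
    intro z
    by_cases hz : Real.log R < z.im
    · rw [hu z hz, hu (z + h) (by simpa using hz)]
      have h1 := hper (-Complex.I * (z + h)) (by rw [hre]; simpa using hz)
      rw [← h1]
      congr 2
      rw [hh]; push_cast; ring
    · have hz' : ¬ Real.log R < (z + h).im := by simpa using hz
      simp only [u, if_neg hz, if_neg hz']
  obtain ⟨B, hB⟩ := hΦ.lt_norm hf.1 0
  have hev : ∀ b : ℝ, ∀ᶠ z in comap Complex.im atTop, b < z.im := fun b =>
    tendsto_comap.eventually (eventually_gt_atTop b)
  have hne : ∀ z : ℂ, max (Real.log R) B < z.im → Φ (-Complex.I * z) ≠ 0 := fun z hz =>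
    norm_pos_iff.1 (hB _ (by rw [hre]; exact (le_max_left _ _).trans_lt hz)
      (by rw [hre]; exact (le_max_right _ _).trans_lt hz))
  have hzero : Tendsto u (comap Complex.im atTop) (𝓝 0) := by
    rw [Metric.tendsto_nhds]
    intro ε hε
    obtain ⟨B', hB'⟩ := hΦ.lt_norm hf.1 ε⁻¹
    filter_upwards [hev (Real.log R), hev B'] with z h1 h2
    rw [hu z h1, dist_zero_right, norm_inv]
    exact inv_lt_of_inv_lt₀ hε (hB' _ (by rw [hre]; exact h1) (by rw [hre]; exact h2))
  have hhol : ∀ᶠ z in comap Complex.im atTop, DifferentiableAt ℂ u z := by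
    filter_upwards [hev (max (Real.log R) B)] with z hz
    have hz1 : Real.log R < z.im := (le_max_left _ _).trans_lt hz
    have h1 : DifferentiableAt ℂ (fun z => (Φ (-Complex.I * z))⁻¹) z := by
      refine DifferentiableAt.inv ?_ (hne z hz)
      exact (hΦ.hasDerivAt hf.1 hR hS (by rw [hre]; exact hz1)).1.differentiableAt.comp z
        (by fun_prop)
    refine h1.congr_of_eventuallyEq ?_
    filter_upwards [(isOpen_lt continuous_const Complex.continuous_im).mem_nhds hz1] with x hx
    exact hu x hx
  set g := Function.Periodic.cuspFunction h u with hg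
  have hgd : DifferentiableAt ℂ g 0 :=
    Function.Periodic.differentiableAt_cuspFunction_zero hh0 hup hhol
      (Filter.ZeroAtFilter.boundedAtFilter hzero)
  have hg0 : g 0 = 0 := Function.Periodic.cuspFunction_zero_of_zero_at_inf hh0 hzero
  have hgan : AnalyticAt ℂ g 0 := by
    rw [Complex.analyticAt_iff_eventually_differentiableAt]
    have h1 := Function.Periodic.eventually_differentiableAt_cuspFunction_nhds_ne_zero hh0 hup hhol
    rw [eventually_nhdsWithin_iff] at h1
    filter_upwards [h1] with q hq
    rcases eq_or_ne q 0 with rfl | hq0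
    · exact hgd
    · exact hq hq0
  have him : ∀ᶠ q in 𝓝 (0 : ℂ), q ≠ 0 →
      max (Real.log R) B < (Function.Periodic.invQParam h q).im := by
    have := (Function.Periodic.invQParam_tendsto hh0).eventually (hev (max (Real.log R) B))
    rwa [eventually_nhdsWithin_iff] at this
  have hgu : ∀ q : ℂ, q ≠ 0 → g q = u (Function.Periodic.invQParam h q) := fun q hq =>
    Function.Periodic.cuspFunction_eq_of_nonzero h u hq
  obtain ⟨C, hC⟩ := hgd.isBigO_sub.bound
  -- `g` is not locally constant, hence open at 0; every `z` of large modulus is therefore a value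
  -- of Φ.
  have hopen : 𝓝 (g 0) ≤ map g (𝓝 0) := by
    refine hgan.eventually_constant_or_nhds_le_map_nhds.resolve_left fun hconst => ?_
    have h1 : ∀ᶠ q in 𝓝[≠] (0 : ℂ), False := by
      filter_upwards [nhdsWithin_le_nhds hconst, nhdsWithin_le_nhds him, self_mem_nhdsWithin]
        with q h1 h2 h3
      have h4 := h2 h3
      rw [hg0, hgu q h3, hu _ ((le_max_left _ _).trans_lt h4)] at h1
      exact hne _ h4 (inv_eq_zero.1 h1)
    exact h1.exists.elim fun _ h => h
  have hmem := hopen (image_mem_map (him.and hC))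
  rw [hg0] at hmem
  obtain ⟨η, hη, hball⟩ := Metric.mem_nhds_iff.1 hmem
  refine hf.2 (exists_polynomial_of_growth hf.1 (C := C) (M := 2 / η) (k := k) fun z hz => ?_)
  have hz0 : 0 < ‖z‖ := lt_of_lt_of_le (by positivity) hz
  have hzinv : z⁻¹ ∈ Metric.ball (0 : ℂ) η := by
    rw [mem_ball_zero_iff, norm_inv]
    refine inv_lt_of_inv_lt₀ hη (lt_of_lt_of_le ?_ hz)
    rw [inv_eq_one_div]
    gcongr
    norm_num
  obtain ⟨q, ⟨hq1, hq2⟩, hqz⟩ := hball hzinv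
  have hq0 : q ≠ 0 := by
    rintro rfl
    rw [hg0] at hqz
    exact (norm_pos_iff.1 hz0) (inv_eq_zero.1 hqz.symm)
  have hqi := hq1 hq0
  have hlog := (le_max_left _ _).trans_lt hqi
  rw [hgu q hq0, hu _ hlog, inv_inj] at hqz
  have hfz := hΦ.comp (-Complex.I * Function.Periodic.invQParam h q) (by rw [hre]; exact hlog)
  rw [hqz] at hfz
  rw [hfz, Complex.norm_exp, hre, Function.Periodic.im_invQParam]
  have hqpos : 0 < ‖q‖ := norm_pos_iff.2 hq0
  have e1 : -h / (2 * Real.pi) * Real.log ‖q‖ = -(k * Real.log ‖q‖) := by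
    rw [hh]; field_simp
  rw [e1, Real.exp_neg, mul_comm (k : ℝ), Real.exp_mul, Real.exp_log hqpos, Real.rpow_natCast,
    ← inv_pow]
  refine pow_le_pow_left₀ (by positivity) ?_ k
  -- Since g(q) = 1/z and |g(q)| ≤ C|q|, the value |f z| = |q|^{-k} is at most (C|z|)^k, so `f`
  -- would be a polynomial.
  rw [sub_zero, sub_zero, hgu q hq0, hu _ hlog, hqz, norm_inv] at hq2
  rw [inv_le_iff_one_le_mul₀ hqpos]
  rw [inv_le_iff_one_le_mul₀ hz0] at hq2
  linarith [mul_right_comm C ‖q‖ ‖z‖]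

/-- If Φ takes equal values at two points, these differ by a multiple of 2πi, and uniqueness of
lifts turns that difference into a period. -/
theorem injOn (hΦ : IsTractParam f R Φ) (hf : IsTranscendentalEntire f) (hR : 0 < R)
    (hS : singularSet f ⊆ Metric.ball 0 R) : InjOn Φ {w | Real.log R < w.re} := by
  have hre : ∀ (k : ℤ) (w : ℂ), (w + k * (2 * Real.pi * Complex.I)).re = w.re := fun k w => by simp
  have key : ∀ k : ℤ, 0 < k → ∀ w₀ : ℂ, Real.log R < w₀.re →
      Φ (w₀ + k * (2 * Real.pi * Complex.I)) ≠ Φ w₀ := by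
    intro k hk w₀ hw₀ h
    obtain ⟨n, rfl⟩ := Int.eq_ofNat_of_zero_le hk.le
    refine hΦ.not_periodic hf hR hS (k := n) (by exact_mod_cast hk) fun w hw => ?_
    have := (hΦ.translate n).eq_of_eq hf.1 hR hS hΦ hw₀ h hw
    exact_mod_cast this
  intro w₁ h₁ w₂ h₂ h
  have hexp : Complex.exp w₁ = Complex.exp w₂ := by rw [← hΦ.comp _ h₁, ← hΦ.comp _ h₂, h]
  obtain ⟨n, hn⟩ := Complex.exp_eq_exp_iff_exists_int.1 hexp
  rcases lt_trichotomy n 0 with hn0 | rfl | hn0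
  · refine absurd ?_ (key (-n) (by omega) w₁ h₁)
    rw [← h.symm]
    congr 1
    rw [hn]; push_cast; ring
  · simpa using hn
  · refine absurd ?_ (key n hn0 w₂ h₂)
    rw [← hn]; exact h

end IsTractParam

/-- The preimage of a punctured neighbourhood of infinity has logarithm branches. -/
theorem hasLogBranches_lt_norm {f : ℂ → ℂ} (hf : IsTranscendentalEntire f) {R : ℝ} (hR : 0 < R)
    (hS : singularSet f ⊆ Metric.ball 0 R) : HasLogBranches {z | R < ‖f z‖} := by
  have hopen : IsOpen {z | R < ‖f z‖} := isOpen_lt continuous_const hf.1.continuous.norm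
  set H := {w : ℂ | Real.log R < w.re} with hH
  have hparam : ∀ z, R < ‖f z‖ → ∃ Φ, IsTractParam f R Φ ∧ z ∈ Φ '' H := by
    intro z hz
    have h0 : f z ≠ 0 := norm_pos_iff.1 (hR.trans hz)
    have h1 : Real.log R < (Complex.log (f z)).re := by
      rw [Complex.log_re]; exact Real.log_lt_log hR hz
    obtain ⟨Φ, hΦ, h2⟩ := exists_isTractParam hf.1 hR hS h1 (Complex.exp_log h0).symm
    exact ⟨Φ, hΦ, _, h1, h2⟩
  refine hasLogBranches_of_components hopen fun z hz c hc => ?_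
  obtain ⟨Φ, hΦ, hzΦ⟩ := hparam z hz
  have hne : ∀ w ∈ H, Φ w - c ≠ 0 := fun w hw h => hc (by
    rw [← sub_eq_zero.1 h, mem_ofPred_eq, hΦ.comp w hw]
    exact lt_norm_exp hR hw)
  obtain ⟨ℓ, hℓ, hℓe⟩ := exists_continuousOn_log_of_convex (convex_logHalfPlane (Real.log R))
    (isOpen_logHalfPlane _) (by obtain ⟨w, hw, -⟩ := hzΦ; exact ⟨w, hw⟩)
    (hΦ.cont.sub continuousOn_const) hne
  have hinj := hΦ.injOn hf hR hS
  -- An image Ψ(H) that meets Φ(H) lies in it, because Ψ is then a translate of Φ. The other images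
  -- form a disjoint open set, so connectedness leaves the component inside Φ(H), where ℓ ∘ Φ⁻¹ is
  -- the logarithm.
  have hsub : connectedComponentIn {z | R < ‖f z‖} z ⊆ Φ '' H := by
    set O := ⋃₀ {T | ∃ Ψ, IsTractParam f R Ψ ∧ T = Ψ '' H ∧ Disjoint T (Φ '' H)} with hO
    have hOo : IsOpen O := by
      refine isOpen_sUnion ?_
      rintro _ ⟨Ψ, hΨ, rfl, -⟩
      exact hΨ.isOpen_image hf.1 hR hS Subset.rfl (isOpen_logHalfPlane _)
    refine isPreconnected_connectedComponentIn.subset_left_of_subset_union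
      (hΦ.isOpen_image hf.1 hR hS Subset.rfl (isOpen_logHalfPlane _)) hOo ?_ ?_
      ⟨z, mem_connectedComponentIn hz, hzΦ⟩
    · rw [disjoint_comm, hO, disjoint_sUnion_left]
      rintro _ ⟨Ψ, hΨ, rfl, h⟩
      exact h
    · intro x hx
      obtain ⟨Ψ, hΨ, hxΨ⟩ := hparam x (connectedComponentIn_subset {z | R < ‖f z‖} z hx)
      by_cases hd : Disjoint (Ψ '' H) (Φ '' H)
      · exact Or.inr ⟨_, ⟨Ψ, hΨ, rfl, hd⟩, hxΨ⟩
      · left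
        obtain ⟨_, ⟨w₁, hw₁, rfl⟩, w₂, hw₂, h⟩ := not_disjoint_iff.1 hd
        have hexp : Complex.exp w₁ = Complex.exp w₂ := by
          rw [← hΨ.comp _ hw₁, ← hΦ.comp _ hw₂, h]
        obtain ⟨n, hn⟩ := Complex.exp_eq_exp_iff_exists_int.1 hexp
        obtain ⟨w, hw, rfl⟩ := hxΨ
        have hre : ∀ (k : ℤ) (w : ℂ), (w + k * (2 * Real.pi * Complex.I)).re = w.re :=
          fun k w => by simp
        have hw' : Real.log R < (w + (-n : ℤ) * (2 * Real.pi * Complex.I)).re := by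
          rw [hre]; exact hw
        refine ⟨w + (-n : ℤ) * (2 * Real.pi * Complex.I), hw', ?_⟩
        refine (hΦ.translate (-n)).eq_of_eq hf.1 hR hS hΨ hw₁ ?_ hw
        rw [← h, hn]
        congr 1
        push_cast; ring
  have hleft : ∀ w ∈ H, Function.invFunOn Φ H (Φ w) = w := fun w hw => hinj.leftInvOn_invFunOn hw
  refine ⟨fun x => ℓ (Function.invFunOn Φ H x), ContinuousOn.mono ?_ hsub, fun x hx => ?_⟩
  · refine hℓ.comp ?_ ?_
    · rintro _ ⟨w, hw, rfl⟩
      rw [ContinuousWithinAt, hleft w hw]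
      intro s hs
      obtain ⟨t, hts, hto, hwt⟩ := mem_nhds_iff.1 hs
      have h1 : Φ '' (t ∩ H) ∈ 𝓝 (Φ w) :=
        (hΦ.isOpen_image hf.1 hR hS inter_subset_right (hto.inter (isOpen_logHalfPlane _))).mem_nhds
          ⟨w, ⟨hwt, hw⟩, rfl⟩
      refine mem_map.2 (mem_of_superset (nhdsWithin_le_nhds h1) ?_)
      rintro _ ⟨v, ⟨hvt, hvH⟩, rfl⟩
      rw [mem_preimage, hleft v hvH]
      exact hts hvt
    · rintro _ ⟨w, hw, rfl⟩
      rw [hleft w hw]; exact hw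
  · obtain ⟨w, hw, rfl⟩ := hsub hx
    simp only [hleft w hw]
    exact hℓe w hw

/-! ### Expansion -/

/-- A weak form of Bloch's theorem. -/
theorem exists_ball_subset_image {φ : ℂ → ℂ} {a : ℂ} {r : ℝ} (hr : 0 < r)
    (hφ : DifferentiableOn ℂ φ (Metric.ball a r)) :
    ∃ b, Metric.ball b (r * ‖deriv φ a‖ / 128) ⊆ φ '' Metric.ball a r := by
  rcases eq_or_ne (deriv φ a) 0 with h0 | h0
  · exact ⟨0, by simp [h0]⟩
  have hd : DifferentiableOn ℂ (deriv φ) (Metric.ball a r) := hφ.deriv Metric.isOpen_ball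
  have hsub : Metric.closedBall a (r / 2) ⊆ Metric.ball a r :=
    Metric.closedBall_subset_ball (by linarith)
  -- Maximising |φ'| weighted by the distance to the circle of radius r/2 gives a point `p` with
  -- |φ'| ≤ 2A on a disc of radius `s`, half the distance from `p` to that circle.
  obtain ⟨p, hp, hmax⟩ := (isCompact_closedBall a (r / 2)).exists_isMaxOn
    ⟨a, Metric.mem_closedBall_self (by positivity)⟩
    (f := fun z => (r / 2 - dist z a) * ‖deriv φ z‖)
    ((by fun_prop : Continuous fun z => r / 2 - dist z a).continuousOn.mul
      (hd.continuousOn.mono hsub).norm)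
  have hpa := hmax (Metric.mem_closedBall_self (by positivity) : a ∈ Metric.closedBall a (r / 2))
  simp only [mem_ofPred_eq, dist_self, sub_zero] at hpa
  have hpos : 0 < r / 2 * ‖deriv φ a‖ := by positivity
  have hA0 : deriv φ p ≠ 0 := fun h => by
    rw [h, norm_zero, mul_zero] at hpa; linarith
  set A := ‖deriv φ p‖ with hA
  have hApos : 0 < A := norm_pos_iff.2 hA0
  set s := (r / 2 - dist p a) / 2 with hs
  have h2s : r / 2 - dist p a = 2 * s := by rw [hs]; ring
  have hspos : 0 < s := by
    have : 0 < (r / 2 - dist p a) * A := hpos.trans_le hpa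
    have := pos_of_mul_pos_left this hApos.le
    linarith
  have hball : Metric.closedBall p s ⊆ Metric.closedBall a (r / 2) :=
    Metric.closedBall_subset_closedBall' (by linarith)
  have hbound : ∀ z ∈ Metric.closedBall p s, ‖deriv φ z‖ ≤ 2 * A := by
    intro z hz
    have h1 := hmax (hball hz)
    simp only [mem_ofPred_eq] at h1
    have h2 : s ≤ r / 2 - dist z a := by
      have := dist_triangle z p a
      rw [Metric.mem_closedBall] at hz
      linarith
    have h3 : s * ‖deriv φ z‖ ≤ s * (2 * A) := by
      calc s * ‖deriv φ z‖ ≤ (r / 2 - dist z a) * ‖deriv φ z‖ := by gcongr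
        _ ≤ _ := h1
        _ = s * (2 * A) := by rw [h2s]; ring
    exact le_of_mul_le_mul_left h3 hspos
  have hsub' : Metric.closedBall p s ⊆ Metric.ball a r := hball.trans hsub
  have hdd : ∀ z ∈ Metric.closedBall p (s / 2), ‖deriv (deriv φ) z‖ ≤ 4 * A / s := by
    intro z hz
    have h1 : Metric.closedBall z (s / 2) ⊆ Metric.closedBall p s :=
      Metric.closedBall_subset_closedBall' (by rw [Metric.mem_closedBall] at hz; linarith)
    have h2 := Complex.norm_deriv_le_of_forall_mem_sphere_norm_le (f := deriv φ) (c := z)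
      (R := s / 2) (C := 2 * A) (by positivity)
      ((hd.mono (h1.trans hsub')).diffContOnCl_ball Subset.rfl)
      (fun w hw => hbound w (h1 (Metric.sphere_subset_closedBall hw)))
    refine h2.trans (le_of_eq ?_)
    field_simp
    norm_num
  have hd1 : ∀ z ∈ Metric.closedBall p (s / 2), ‖deriv φ z - deriv φ p‖ ≤ 4 * A / s * ‖z - p‖ := by
    intro z hz
    refine (convex_closedBall p (s / 2)).norm_image_sub_le_of_norm_deriv_le (fun x hx => ?_) hdd
      (Metric.mem_closedBall_self (by positivity)) hz
    exact hd.differentiableAt (Metric.isOpen_ball.mem_nhds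
      (hsub' (Metric.closedBall_subset_closedBall (by linarith) hx)))
  have hda : ∀ z ∈ Metric.closedBall p (s / 8), HasDerivAt φ (deriv φ z) z := fun z hz =>
    (hφ.differentiableAt (Metric.isOpen_ball.mem_nhds
      (hsub' (Metric.closedBall_subset_closedBall (by linarith) hz)))).hasDerivAt
  have hlin : ∀ z ∈ Metric.closedBall p (s / 8),
      ‖(φ z - deriv φ p * z) - (φ p - deriv φ p * p)‖ ≤ A / 2 * ‖z - p‖ := by
    intro z hz
    refine (convex_closedBall p (s / 8)).norm_image_sub_le_of_norm_hasDerivWithin_le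
      (f := fun z => φ z - deriv φ p * z) (f' := fun z => deriv φ z - deriv φ p) (fun x hx => ?_)
      (fun x hx => ?_) (Metric.mem_closedBall_self (by positivity)) hz
    · have h1 := ((hda x hx).sub ((hasDerivAt_id x).const_mul (deriv φ p))).hasDerivWithinAt
        (s := Metric.closedBall p (s / 8))
      rw [mul_one] at h1
      exact h1
    · refine (hd1 x (Metric.closedBall_subset_closedBall (by linarith) hx)).trans ?_
      rw [Metric.mem_closedBall, dist_eq_norm] at hx
      calc 4 * A / s * ‖x - p‖ ≤ 4 * A / s * (s / 8) := by gcongr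
        _ = A / 2 := by field_simp; norm_num
  have hp8 : p ∈ Metric.closedBall p (s / 8) := Metric.mem_closedBall_self (by positivity)
  have hsub8 : Metric.closedBall p (s / 8) ⊆ Metric.ball a r :=
    (Metric.closedBall_subset_closedBall (by linarith)).trans hsub'
  -- On the circle of radius s/8 the linear part has modulus As/8 and the error is at most As/16.
  -- The covered disc has radius As/32, and r|φ'(a)| ≤ 4sA accounts for the 128.
  have hcov := DiffContOnCl.ball_subset_image_closedBall (f := φ) (z₀ := p) (r := s / 8)
    (ε := A * s / 16) ((hφ.mono hsub8).diffContOnCl_ball Subset.rfl) (by positivity) ?_ ?_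
  · refine ⟨φ p, (Metric.ball_subset_ball ?_).trans (hcov.trans (image_mono hsub8))⟩
    have : r / 2 * ‖deriv φ a‖ ≤ 2 * s * A := by rw [← h2s]; exact hpa
    linarith
  · intro z hz
    have hzn : ‖z - p‖ = s / 8 := by simpa [dist_eq_norm] using hz
    have h1 := hlin z (Metric.sphere_subset_closedBall hz)
    have h2 : ‖deriv φ p * (z - p)‖ = A * (s / 8) := by rw [norm_mul, hzn]
    have h3 : deriv φ p * (z - p) = (φ z - φ p) -
        ((φ z - deriv φ p * z) - (φ p - deriv φ p * p)) := by ring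
    have h4 := norm_sub_le (φ z - φ p) ((φ z - deriv φ p * z) - (φ p - deriv φ p * p))
    rw [← h3, h2] at h4
    rw [hzn] at h1
    nlinarith
  · have h1 := (hda p hp8).eventually_ne (c := φ p) hA0
    exact h1.frequently.filter_mono nhdsWithin_le_nhds

/-- A continuous logarithm of a holomorphic function is holomorphic. -/
theorem hasDerivAt_of_exp_eq {g G : ℂ → ℂ} {g' w : ℂ} (hG : ContinuousAt G w)
    (hg : HasDerivAt g g' w) (h : ∀ᶠ x in 𝓝 w, Complex.exp (G x) = g x) :
    HasDerivAt G ((g w)⁻¹ * g') w := by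
  rw [← h.self_of_nhds]
  exact hasDerivAt_of_comp_eq (Complex.hasStrictDerivAt_exp _) (Complex.exp_ne_zero _) hG hg h

/-- Functions with bounded singular set are expanding near infinity. -/
theorem norm_le_of_lt_norm {f : ℂ → ℂ} (hf : IsTranscendentalEntire f) {R : ℝ} (hR : 0 < R)
    (hS : singularSet f ⊆ Metric.ball 0 R) (h0 : ‖f 0‖ < R) {ζ : ℂ} (hζ : R < ‖f ζ‖) :
    (Real.log ‖f ζ‖ - Real.log R) * ‖f ζ‖ ≤ 512 * ‖ζ * deriv f ζ‖ := by
  have hfζ : f ζ ≠ 0 := norm_pos_iff.1 (hR.trans hζ)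
  set w₀ := Complex.log (f ζ) with hw₀
  have hw₀re : w₀.re = Real.log ‖f ζ‖ := Complex.log_re _
  have hw₀R : Real.log R < w₀.re := by rw [hw₀re]; exact Real.log_lt_log hR hζ
  obtain ⟨Φ, hΦ, hΦ0⟩ := exists_isTractParam hf.1 hR hS hw₀R (Complex.exp_log hfζ).symm
  have hne : ∀ w ∈ {w : ℂ | Real.log R < w.re}, Φ w ≠ 0 := by
    intro w hw h
    have h1 := lt_norm_exp hR hw
    rw [← hΦ.comp w hw, h] at h1
    exact lt_asymm h1 h0
  obtain ⟨G, hG, hGe⟩ := exists_continuousOn_log_of_convex (convex_logHalfPlane (Real.log R))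
    (isOpen_logHalfPlane _) ⟨w₀, hw₀R⟩ hΦ.cont hne
  have hGd : ∀ w : ℂ, Real.log R < w.re →
      HasDerivAt G ((Φ w)⁻¹ * ((deriv f (Φ w))⁻¹ * f (Φ w))) w := by
    intro w hw
    have hnhds := (isOpen_logHalfPlane (Real.log R)).mem_nhds hw
    refine hasDerivAt_of_exp_eq (hG.continuousAt hnhds) (hΦ.hasDerivAt hf.1 hR hS hw).1 ?_
    filter_upwards [hnhds] with x hx using hGe x hx
  have hf' := (hΦ.hasDerivAt hf.1 hR hS hw₀R).2
  set r := w₀.re - Real.log R with hr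
  have hrpos : 0 < r := by linarith
  have hball : Metric.ball w₀ r ⊆ {w | Real.log R < w.re} := by
    intro w hw
    rw [Metric.mem_ball, Complex.dist_eq] at hw
    have := (Complex.abs_re_le_norm (w - w₀)).trans_lt hw
    rw [Complex.sub_re, abs_lt] at this
    rw [mem_ofPred_eq]
    linarith
  obtain ⟨b, hb⟩ := exists_ball_subset_image hrpos (φ := G) (a := w₀) fun w hw =>
    (hGd w (hball hw)).differentiableAt.differentiableWithinAt
  rw [(hGd w₀ hw₀R).deriv, hΦ0] at hb
  rw [hΦ0] at hf'
  -- As exp ∘ G = Φ is injective, the image of `G` contains no two points differing by 2πi, hence no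
  -- disc of radius above 4 > π. The constant 512 is 4·128.
  have hsmall : r * ‖ζ⁻¹ * ((deriv f ζ)⁻¹ * f ζ)‖ / 128 ≤ 4 := by
    by_contra! h4
    have hπ : (b - Real.pi * Complex.I) ∈ Metric.ball b (r * ‖ζ⁻¹ * ((deriv f ζ)⁻¹ * f ζ)‖ / 128) := by
      rw [Metric.mem_ball, Complex.dist_eq]
      simp only [sub_sub_cancel_left, norm_neg, norm_mul, Complex.norm_real, Complex.norm_I, mul_one,
        Real.norm_of_nonneg Real.pi_pos.le]
      simp only [norm_mul] at h4
      linarith [Real.pi_lt_four]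
    have hπ' : (b + Real.pi * Complex.I) ∈ Metric.ball b (r * ‖ζ⁻¹ * ((deriv f ζ)⁻¹ * f ζ)‖ / 128) := by
      rw [Metric.mem_ball, Complex.dist_eq]
      simp only [add_sub_cancel_left, norm_mul, Complex.norm_real, Complex.norm_I, mul_one,
        Real.norm_of_nonneg Real.pi_pos.le]
      simp only [norm_mul] at h4
      linarith [Real.pi_lt_four]
    obtain ⟨w₁, hw₁, h1⟩ := hb hπ
    obtain ⟨w₂, hw₂, h2⟩ := hb hπ'
    have h3 : Φ w₁ = Φ w₂ := by
      rw [← hGe _ (hball hw₁), ← hGe _ (hball hw₂), h1, h2,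
        show b + Real.pi * Complex.I = (b - Real.pi * Complex.I) + 2 * Real.pi * Complex.I by ring,
        Complex.exp_periodic]
    have h5 := hΦ.injOn hf hR hS (hball hw₁) (hball hw₂) h3
    rw [h5, h2] at h1
    have h6 : (2 * Real.pi * Complex.I : ℂ) = 0 := by linear_combination h1
    exact Complex.two_pi_I_ne_zero h6
  have hζ0 : ζ ≠ 0 := by
    have := hne w₀ hw₀R
    rwa [hΦ0] at this
  have e1 : ‖ζ⁻¹ * ((deriv f ζ)⁻¹ * f ζ)‖ = ‖f ζ‖ / ‖ζ * deriv f ζ‖ := by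
    simp only [norm_mul, norm_inv]
    field_simp
  have hpos : 0 < ‖ζ * deriv f ζ‖ := norm_pos_iff.2 (mul_ne_zero hζ0 hf')
  rw [e1, mul_div_assoc', div_div, div_le_iff₀ (by positivity)] at hsmall
  rw [← hw₀re]
  linarith

/-! ### Uniformly escaping sets -/

/-- The iterates of `f` tend to infinity uniformly on `Z`. -/
def EscapesUniformly (f : ℂ → ℂ) (Z : Set ℂ) : Prop :=
  ∀ R : ℝ, ∃ N : ℕ, ∀ n ≥ N, ∀ z ∈ Z, R < ‖f^[n] z‖

theorem EscapesUniformly.image {f : ℂ → ℂ} {Z : Set ℂ} (h : EscapesUniformly f Z) (j : ℕ) :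
    EscapesUniformly f (f^[j] '' Z) := by
  intro R
  obtain ⟨N, hN⟩ := h R
  refine ⟨N, fun n hn => ?_⟩
  rintro _ ⟨z, hz, rfl⟩
  rw [← Function.iterate_add_apply]
  exact hN _ (by omega) z hz

theorem EscapesUniformly.biUnion {f : ℂ → ℂ} {ι : Type*} {s : Set ι} (hs : s.Finite)
    {Z : ι → Set ℂ} (h : ∀ i ∈ s, EscapesUniformly f (Z i)) :
    EscapesUniformly f (⋃ i ∈ s, Z i) := by
  intro R
  have h' : ∀ i, ∃ N : ℕ, i ∈ s → ∀ n ≥ N, ∀ z ∈ Z i, R < ‖f^[n] z‖ := fun i => by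
    by_cases hi : i ∈ s
    · obtain ⟨N, hN⟩ := h i hi R
      exact ⟨N, fun _ => hN⟩
    · exact ⟨0, fun h => absurd h hi⟩
  choose N hN using h'
  refine ⟨hs.toFinset.sup N, fun n hn z hz => ?_⟩
  obtain ⟨i, hi, hz⟩ := mem_iUnion₂.1 hz
  exact hN i hi n (le_trans (Finset.le_sup (hs.mem_toFinset.2 hi)) hn) z hz

/-- The bound on ‖f 0‖ keeps 0 out of the tracts, so tract parametrisations have logarithms. -/
theorem ClassB.exists_radius {f : ℂ → ℂ} (hf : ClassB f) :
    ∃ R : ℝ, 0 < R ∧ singularSet f ⊆ Metric.ball 0 R ∧ ‖f 0‖ < R := by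
  obtain ⟨R, hR⟩ := hf.2.subset_ball 0
  refine ⟨max R (‖f 0‖ + 1), lt_max_of_lt_right (by positivity),
    hR.trans (Metric.ball_subset_ball (le_max_left _ _)), lt_max_of_lt_right (by linarith)⟩

theorem IsTranscendentalEntire.isOpenMap_iterate {f : ℂ → ℂ} (hf : IsTranscendentalEntire f)
    (n : ℕ) : IsOpenMap f^[n] := by
  induction n with
  | zero => exact IsOpenMap.id
  | succ n ih => rw [Function.iterate_succ']; exact hf.isOpenMap.comp ih

/-- On no nonempty open set do the iterates of `f` escape uniformly. -/
theorem ClassB.not_escapesUniformly {f : ℂ → ℂ} (hf : ClassB f) {Y : Set ℂ} (hY : IsOpen Y)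
    (hne : Y.Nonempty) : ¬ EscapesUniformly f Y := by
  intro hesc
  obtain ⟨R, hR, hS, h0⟩ := hf.exists_radius
  -- Beyond this radius log|f| - log R exceeds 1024 = 2·512, so the expansion factor is at least 2.
  obtain ⟨N, hN⟩ := hesc (R * Real.exp 1024)
  have hRR : R ≤ R * Real.exp 1024 := le_mul_of_one_le_right hR.le (Real.one_le_exp (by norm_num))
  have hYo : IsOpen (f^[N] '' Y) := hf.1.isOpenMap_iterate N _ hY
  have hesc' : ∀ n, ∀ y ∈ f^[N] '' Y, R * Real.exp 1024 < ‖f^[n] y‖ := by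
    rintro n _ ⟨y, hy, rfl⟩
    rw [← Function.iterate_add_apply]
    exact hN _ (by omega) y hy
  obtain ⟨a, ha⟩ := hne.image f^[N]
  obtain ⟨r, hr, hball⟩ := Metric.isOpen_iff.1 hYo a ha
  have ha0 : 0 < ‖a‖ := by have := hesc' 0 a ha; simp at this; linarith
  have hfn : ∀ n, Differentiable ℂ f^[n] := fun n => hf.1.1.iterate n
  have hexpand : ∀ ζ : ℂ, R * Real.exp 1024 < ‖f ζ‖ → 2 * ‖f ζ‖ ≤ ‖ζ‖ * ‖deriv f ζ‖ := by
    intro ζ hζ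
    have h1 := norm_le_of_lt_norm hf.1 hR hS h0 (hRR.trans_lt hζ)
    have h2 := Real.log_lt_log (by positivity) hζ
    rw [Real.log_mul hR.ne' (Real.exp_pos _).ne', Real.log_exp] at h2
    rw [norm_mul] at h1
    have h3 : 1024 * ‖f ζ‖ ≤ (Real.log ‖f ζ‖ - Real.log R) * ‖f ζ‖ := by
      gcongr
      linarith
    linarith
  -- The derivative of the nth iterate in the metric |dz|/|z| grows at least like 2^n.
  have hgrow : ∀ n : ℕ, 2 ^ n * ‖f^[n] a‖ ≤ ‖a‖ * ‖deriv f^[n] a‖ := by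
    intro n
    induction n with
    | zero => simp [Function.iterate_zero]
    | succ n ih =>
      have h1 : deriv f^[n + 1] a = deriv f (f^[n] a) * deriv f^[n] a := by
        rw [Function.iterate_succ']
        exact deriv_comp a (hf.1.1 _) (hfn n a)
      have h2 := hexpand (f^[n] a) (by
        rw [← Function.iterate_succ_apply' f]; exact hesc' (n + 1) a ha)
      rw [h1, norm_mul, Function.iterate_succ_apply']
      calc 2 ^ (n + 1) * ‖f (f^[n] a)‖ = 2 ^ n * (2 * ‖f (f^[n] a)‖) := by ring
        _ ≤ 2 ^ n * (‖f^[n] a‖ * ‖deriv f (f^[n] a)‖) := by gcongr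
        _ = (2 ^ n * ‖f^[n] a‖) * ‖deriv f (f^[n] a)‖ := by ring
        _ ≤ (‖a‖ * ‖deriv f^[n] a‖) * ‖deriv f (f^[n] a)‖ := by gcongr
        _ = _ := by ring
  obtain ⟨n, hn⟩ := pow_unbounded_of_one_lt (512 * ‖a‖ / r) (one_lt_two (α := ℝ))
  have hne0 : ∀ z ∈ Metric.ball a r, f^[n] z ≠ 0 := fun z hz =>
    norm_pos_iff.1 (lt_trans (by positivity) (hesc' n z (hball hz)))
  obtain ⟨Λ, hΛ, hΛe⟩ := exists_continuousOn_log_of_convex (convex_ball a r) Metric.isOpen_ball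
    ⟨a, Metric.mem_ball_self hr⟩ (hfn n).continuous.continuousOn hne0
  have hΛd : ∀ z ∈ Metric.ball a r, HasDerivAt Λ ((f^[n] z)⁻¹ * deriv f^[n] z) z := by
    intro z hz
    have hnhds := Metric.isOpen_ball.mem_nhds hz
    refine hasDerivAt_of_exp_eq (hΛ.continuousAt hnhds) (hfn n z).hasDerivAt ?_
    filter_upwards [hnhds] with x hx using hΛe x hx
  obtain ⟨b, hb⟩ := exists_ball_subset_image hr (φ := Λ) (a := a) fun z hz =>
    (hΛd z hz).differentiableAt.differentiableWithinAt
  rw [(hΛd a (Metric.mem_ball_self hr)).deriv, norm_mul, norm_inv] at hb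
  have hfa : 0 < ‖f^[n] a‖ := norm_pos_iff.2 (hne0 a (Metric.mem_ball_self hr))
  have hbig : 4 < r * (‖f^[n] a‖⁻¹ * ‖deriv f^[n] a‖) / 128 := by
    have h1 : 2 ^ n ≤ ‖a‖ * (‖f^[n] a‖⁻¹ * ‖deriv f^[n] a‖) := by
      rw [mul_left_comm, inv_mul_eq_div, le_div_iff₀ hfa]
      exact hgrow n
    rw [div_lt_iff₀ hr] at hn
    rw [lt_div_iff₀ (by norm_num)]
    have h2 : 512 * ‖a‖ < ‖a‖ * (r * (‖f^[n] a‖⁻¹ * ‖deriv f^[n] a‖)) := by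
      refine hn.trans_le ?_
      rw [mul_left_comm, mul_comm (2 ^ n)]
      gcongr
    rw [mul_comm] at h2
    linarith [lt_of_mul_lt_mul_left h2 ha0.le]
  -- The image of log f^n contains a disc of radius above 4 > π, hence a vertical segment of length
  -- 2π; so f^n maps onto a circle about 0. That circle lies in {R < |f|}, while 0 does not, against
  -- `hasLogBranches_lt_norm`.
  have hcircle : Metric.sphere 0 (Real.exp b.re) ⊆ {z | R < ‖f z‖} := by
    intro z hz
    have hz' : ‖z‖ = ‖Complex.exp b‖ := by rw [Complex.norm_exp]; simpa using hz
    have hquot : ‖z / Complex.exp b‖ = 1 := by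
      rw [norm_div, hz', div_self (norm_ne_zero_iff.2 (Complex.exp_ne_zero b))]
    have hmem : b + (z / Complex.exp b).arg * Complex.I ∈
        Metric.ball b (r * (‖f^[n] a‖⁻¹ * ‖deriv f^[n] a‖) / 128) := by
      rw [Metric.mem_ball, Complex.dist_eq]
      simp only [add_sub_cancel_left, norm_mul, Complex.norm_real, Complex.norm_I, mul_one,
        Real.norm_eq_abs]
      linarith [Complex.abs_arg_le_pi (z / Complex.exp b), Real.pi_lt_four]
    obtain ⟨y, hy, hyz⟩ := hb hmem
    have h1 := Complex.norm_mul_exp_arg_mul_I (z / Complex.exp b)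
    rw [hquot, Complex.ofReal_one, one_mul] at h1
    have h2 := hΛe y hy
    rw [hyz, Complex.exp_add, h1, mul_div_cancel₀ _ (Complex.exp_ne_zero b)] at h2
    rw [mem_ofPred_eq, h2, ← Function.iterate_succ_apply' f]
    exact hRR.trans_lt (hesc' (n + 1) y (hball hy))
  obtain ⟨M, hM, hMe⟩ := hasLogBranches_lt_norm hf.1 hR hS _ hcircle (isCompact_sphere _ _) 0
    (by simpa using h0.le)
  have := eq_zero_of_log_zpow_sphere (Real.exp_pos b.re) (m := 1) hM fun z hz => by
    rw [hMe z hz, zpow_one]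
  exact one_ne_zero this

/-- A component of an open set is open and relatively closed in it. -/
theorem frontier_connectedComponentIn_subset {O : Set ℂ} (hO : IsOpen O) (x : ℂ) :
    frontier (connectedComponentIn O x) ⊆ Oᶜ := by
  intro y hy hyO
  rw [hO.connectedComponentIn.frontier_eq] at hy
  obtain ⟨u, hu, hu'⟩ := mem_closure_iff.1 hy.1 _ hO.connectedComponentIn
    (mem_connectedComponentIn hyO)
  refine hy.2 ?_
  rw [← connectedComponentIn_eq_of_mem hu', connectedComponentIn_eq_of_mem hu]
  exact mem_connectedComponentIn hyO

/-- The complement of a closed uniformly escaping set has no bounded components. -/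
theorem ClassB.not_isBounded_component_compl {f : ℂ → ℂ} (hf : ClassB f) {Z : Set ℂ}
    (hZ : IsClosed Z) (hesc : EscapesUniformly f Z) {c : ℂ} (hc : c ∉ Z) :
    ¬ Bornology.IsBounded (connectedComponentIn Zᶜ c) := by
  intro hb
  set Y := connectedComponentIn Zᶜ c with hYdef
  have hYo : IsOpen Y := hZ.isOpen_compl.connectedComponentIn
  obtain ⟨R, hR, hS, h0⟩ := hf.exists_radius
  refine hf.not_escapesUniformly hYo ⟨c, mem_connectedComponentIn hc⟩ fun R' => ?_
  obtain ⟨N, hN⟩ := hesc (max R R')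
  refine ⟨N + 1, fun n hn y hy => ?_⟩
  obtain ⟨m, rfl⟩ : ∃ m, n = m + 1 := ⟨n - 1, by omega⟩
  have hcont : Continuous f^[m] := hf.1.1.continuous.iterate m
  have hcpt : IsCompact (f^[m] '' closure Y) := hb.isCompact_closure.image hcont
  have ho : IsOpen (f^[m] '' Y) := hf.1.isOpenMap_iterate m _ hYo
  have hS' : singularSet f ⊆ Metric.ball 0 (max R R') :=
    hS.trans (Metric.ball_subset_ball (le_max_left _ _))
  -- Frontier points of f^m(Y) come from the frontier of `Y`, which lies in `Z`. One iterate is held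
  -- back because {R < |f|} has logarithm branches, whereas {R < |z|} does not.
  have hsub := (hasLogBranches_lt_norm hf.1 (lt_max_of_lt_left hR) hS').subset_of_frontier_subset ho
    (hcpt.isBounded.subset (image_mono subset_closure)) (by
      intro p hp
      rw [ho.frontier_eq] at hp
      obtain ⟨q, hq, rfl⟩ := closure_minimal (image_mono subset_closure) hcpt.isClosed hp.1
      have hqY : q ∉ Y := fun h => hp.2 (mem_image_of_mem _ h)
      have hqf : q ∈ frontier Y := by rw [hYo.frontier_eq]; exact ⟨hq, hqY⟩
      have hqZ : q ∈ Z := not_not.1 (frontier_connectedComponentIn_subset hZ.isOpen_compl c hqf)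
      rw [mem_ofPred_eq, ← Function.iterate_succ_apply' f]
      exact hN _ (by omega) q hqZ)
  have := hsub (mem_image_of_mem _ hy)
  rw [mem_ofPred_eq, ← Function.iterate_succ_apply' f] at this
  exact (le_max_right _ _).trans_lt this

theorem ClassB.hasLogBranches_of_escapesUniformly {f : ℂ → ℂ} (hf : ClassB f) {Z : Set ℂ}
    (hZ : IsClosed Z) (hesc : EscapesUniformly f Z) : HasLogBranches Z :=
  hasLogBranches_of_unbounded fun c hc => ⟨connectedComponentIn Zᶜ c, connectedComponentIn_subset _ _,
    isPreconnected_connectedComponentIn, mem_connectedComponentIn hc,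
    hf.not_isBounded_component_compl hZ hesc hc⟩

/-! ### Ray tails -/

/-- Ray tails are only required to tend to infinity after at least one iterate; boundedness of `f`
on discs gives the same for the tail itself. -/
theorem tendsto_cobounded_of_comp {f : ℂ → ℂ} (hf : Continuous f) {c : ℝ → ℂ}
    (h : Tendsto (fun t => f (c t)) atTop (Bornology.cobounded ℂ)) :
    Tendsto c atTop (Bornology.cobounded ℂ) := by
  rw [← tendsto_norm_atTop_iff_cobounded] at h ⊢
  rw [tendsto_atTop]
  intro M
  obtain ⟨B, hB⟩ := (isCompact_closedBall (0 : ℂ) M).exists_bound_of_continuousOn hf.continuousOn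
  filter_upwards [h.eventually_gt_atTop B] with t ht
  by_contra! hlt
  exact absurd (hB (c t) (by simpa using hlt.le)) (not_le.2 ht)

namespace IsRayTailFrom

variable {f : ℂ → ℂ} {z : ℂ} {T : Set ℂ}

theorem isClosed_image (h : IsRayTailFrom f z T) (hf : Continuous f) (j : ℕ) :
    IsClosed (f^[j] '' T) := by
  obtain ⟨t₀, c, ⟨-, hc, hinj, -, hn, -⟩, -, rfl⟩ := h
  have h1 : InjOn (fun t => f^[j] (c t)) (Ici t₀) ∧
      Tendsto (fun t => f^[j] (c t)) atTop (Bornology.cobounded ℂ) := by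
    rcases Nat.eq_zero_or_pos j with rfl | hj
    · exact ⟨hinj, tendsto_cobounded_of_comp hf (hn 1 le_rfl).2⟩
    · exact hn j hj
  rw [← image_comp, image_Ici_eq_range]
  exact (isClosedEmbedding_of_tendsto_cobounded ((hf.iterate j).comp_continuousOn hc) h1.1
    h1.2).isClosed_range

theorem isClosed (h : IsRayTailFrom f z T) (hf : Continuous f) : IsClosed T := by
  simpa using h.isClosed_image hf 0

theorem escapesUniformly (h : IsRayTailFrom f z T) : EscapesUniformly f T := by
  obtain ⟨t₀, c, ⟨-, -, -, -, -, hu⟩, -, rfl⟩ := h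
  intro R
  obtain ⟨N, hN⟩ := hu R
  refine ⟨N, fun n hn => ?_⟩
  rintro _ ⟨t, ht, rfl⟩
  exact hN n hn t ht

theorem mem (h : IsRayTailFrom f z T) : z ∈ T := by
  obtain ⟨t₀, c, -, rfl, rfl⟩ := h
  exact mem_image_of_mem _ (self_mem_Ici)

theorem isPreconnected (h : IsRayTailFrom f z T) : IsPreconnected T := by
  obtain ⟨t₀, c, ⟨-, hc, -⟩, -, rfl⟩ := h
  exact isPreconnected_Ici.image c hc

end IsRayTailFrom

theorem not_isBounded_image_Ici {c : ℝ → ℂ} {t₀ : ℝ}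
    (h : Tendsto c atTop (Bornology.cobounded ℂ)) : ¬ Bornology.IsBounded (c '' Ici t₀) := by
  intro hb
  have h1 := h (Bornology.isBounded_def.1 hb)
  have h2 : ∀ᶠ t in atTop, c t ∈ (c '' Ici t₀)ᶜ := h1
  obtain ⟨t, ht, ht'⟩ := (h2.and (eventually_ge_atTop t₀)).exists
  exact ht (mem_image_of_mem c ht')

theorem IsRayTailFrom.not_isBounded {f : ℂ → ℂ} {z : ℂ} {T : Set ℂ} (h : IsRayTailFrom f z T)
    (hf : Continuous f) : ¬ Bornology.IsBounded T := by
  obtain ⟨t₀, c, ⟨-, -, -, -, hn, -⟩, -, rfl⟩ := h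
  exact not_isBounded_image_Ici (tendsto_cobounded_of_comp hf (hn 1 le_rfl).2)

/-! ### The base domain -/

/-- The complement is one connected unbounded set, thanks to the arc. -/
theorem IsCutArc.hasLogBranches_baseDomain {f : ℂ → ℂ} {D δ : Set ℂ} (hD : IsJordanDomain D)
    (hδ : IsCutArc f D δ) : HasLogBranches (baseDomain D δ) := by
  obtain ⟨c, hc, -, ht, hc0, -, rfl, -⟩ := hδ
  refine hasLogBranches_of_unbounded fun a ha => ⟨closure D ∪ c '' Ici 0, ?_, ?_, not_not.1 ha, ?_⟩
  · rw [baseDomain, compl_compl]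
  · exact IsPreconnected.union (c 0) hc0 (mem_image_of_mem c self_mem_Ici)
      hD.2.1.isPreconnected.closure (isPreconnected_Ici.image c hc)
  · exact fun hb => not_isBounded_image_Ici ht (hb.subset subset_union_right)

theorem isOpen_baseDomain {f : ℂ → ℂ} {D δ : Set ℂ} (hδ : IsCutArc f D δ) :
    IsOpen (baseDomain D δ) :=
  (isClosed_closure.union hδ.isClosed).isOpen_compl

/-- Removing a closed uniformly escaping set from the base domain leaves no bounded components. -/
theorem not_isBounded_component_baseDomain_diff {f : ℂ → ℂ} (hf : ClassB f) {D δ Z : Set ℂ}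
    (hD : IsJordanDomain D) (hδ : IsCutArc f D δ) (hZ : IsClosed Z) (hesc : EscapesUniformly f Z)
    (hZW : Z ⊆ baseDomain D δ) {a : ℂ} (ha : a ∈ baseDomain D δ \ Z) :
    ¬ Bornology.IsBounded (connectedComponentIn (baseDomain D δ \ Z) a) := by
  intro hb
  have hWo := isOpen_baseDomain hδ
  have hVo : IsOpen (baseDomain D δ \ Z) := hWo.sdiff hZ
  set O := connectedComponentIn (baseDomain D δ \ Z) a with hO
  have hOo : IsOpen O := hVo.connectedComponentIn
  have hOsub : O ⊆ baseDomain D δ \ Z := connectedComponentIn_subset _ _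
  -- The frontier cannot enter `D`, an open set disjoint from `O`.
  have hfr : frontier O ⊆ (frontier D ∪ δ) ∪ (Z ∩ frontier O) := by
    intro y hy
    have h1 := frontier_connectedComponentIn_subset hVo a hy
    by_cases hyZ : y ∈ Z
    · exact Or.inr ⟨hyZ, hy⟩
    · left
      have h2 : y ∈ closure D ∪ δ := by
        by_contra h
        exact h1 ⟨h, hyZ⟩
      rcases h2 with h2 | h2
      · refine Or.inl ⟨h2, fun h3 => ?_⟩
        rw [hD.1.interior_eq] at h3
        obtain ⟨u, hu, hu'⟩ := mem_closure_iff.1 (frontier_subset_closure hy) D hD.1 h3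
        exact (hOsub hu').1 (Or.inl (subset_closure hu))
      · exact Or.inr h2
  obtain ⟨L, hL, hLe⟩ := hD.exists_log_frontier_union hδ (a := a) ha.1
  obtain ⟨M, hM, hMe⟩ := hf.hasLogBranches_of_escapesUniformly hZ hesc (Z ∩ frontier O)
    inter_subset_left ((isCompact_frontier_of_isBounded hb).inter_left hZ) a ha.2
  -- The two closed pieces are disjoint since `Z` lies in the base domain, so the logarithms glue
  -- with no matching condition and contradict Borsuk's criterion.
  obtain ⟨k, hk, hk1, hk2⟩ := exists_continuousOn_glue (isClosed_frontier.union hδ.isClosed)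
    (hZ.inter isClosed_frontier) hL hM (by
      rintro y ⟨hy, hyZ, -⟩
      refine absurd ?_ (hZW hyZ)
      exact hy.imp (fun h => frontier_subset_closure h) id)
  refine not_exists_log_frontier hOo hb (mem_connectedComponentIn ha) (hk.mono hfr) fun y hy => ?_
  rcases hfr hy with h | h
  · rw [hk1 h, hLe y h]
  · rw [hk2 h, hMe y h]

/-! ### The stages of the construction -/

section Stages

variable {f : ℂ → ℂ} {γ : ℂ → Set ℂ} {D δ : Set ℂ}

theorem isClosed_tailsOver (hf : Continuous f) (hS : (escapingSingularSet f).Finite)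
    (hγ : ∀ z ∈ escapingSingularSet f, IsRayTailFrom f z (γ z)) (V : Set ℂ) :
    IsClosed (tailsOver f γ V) :=
  (hS.subset inter_subset_right).isClosed_biUnion fun z hz => (hγ z hz.2).isClosed hf

theorem isOpen_handStage (hf : Continuous f) (hS : (escapingSingularSet f).Finite)
    (hγ : ∀ z ∈ escapingSingularSet f, IsRayTailFrom f z (γ z)) {W : Set ℂ} (hW : IsOpen W)
    (n : ℕ) : IsOpen (handStage f γ W n) := by
  induction n with
  | zero => exact hW
  | succ n ih => exact (ih.sdiff (isClosed_tailsOver hf hS hγ _)).preimage hf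

theorem handStage_subset_preimage (f : ℂ → ℂ) (γ : ℂ → Set ℂ) (W : Set ℂ) (n : ℕ) :
    handStage f γ W n ⊆ f^[n] ⁻¹' W := by
  induction n with
  | zero => exact Subset.rfl
  | succ n ih =>
    intro z hz
    rw [mem_preimage, Function.iterate_succ_apply]
    exact ih hz.1

/-- The images in the base domain of the tails removed up to stage `n`. -/
def removedImages (f : ℂ → ℂ) (γ : ℂ → Set ℂ) (W : Set ℂ) (n : ℕ) : Set ℂ :=
  ⋃ j ∈ Iic n, f^[j] '' removedTails f γ W j

/-- A point f^i(x) lost at stage j = n - i lies on a tail deleted there, so f^n(x) lies in the j-th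
image of that tail. -/
theorem mem_handStage_diff_of_iterate_mem {W : Set ℂ} {n : ℕ} {x : ℂ} (h : f^[n] x ∈ W)
    (hx : f^[n] x ∉ removedImages f γ W n) : x ∈ handStage f γ W n \ removedTails f γ W n := by
  have key : ∀ i j : ℕ, i + j = n →
      f^[i] x ∈ handStage f γ W j \ removedTails f γ W j := by
    intro i j
    induction j generalizing i with
    | zero =>
      rintro rfl
      refine ⟨h, fun h' => hx ?_⟩
      exact mem_biUnion (mem_Iic.2 (Nat.zero_le _)) ⟨_, h', rfl⟩
    | succ j ih =>
      intro hij
      have h1 := ih (i + 1) (by omega)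
      rw [Function.iterate_succ_apply'] at h1
      refine ⟨h1, fun h' => hx ?_⟩
      refine mem_biUnion (x := j + 1) (mem_Iic.2 (by omega)) ⟨_, h', ?_⟩
      rw [← Function.iterate_add_apply, add_comm (j + 1), hij]
  exact key 0 n (zero_add n)

theorem removedImages_eq (f : ℂ → ℂ) (γ : ℂ → Set ℂ) (W : Set ℂ) (n : ℕ) :
    removedImages f γ W n =
      ⋃ j ∈ Iic n, ⋃ z ∈ handStage f γ W j ∩ escapingSingularSet f, f^[j] '' γ z := by
  simp only [removedImages, removedTails, tailsOver, image_iUnion₂]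

theorem isClosed_removedImages (hf : Continuous f) (hS : (escapingSingularSet f).Finite)
    (hγ : ∀ z ∈ escapingSingularSet f, IsRayTailFrom f z (γ z)) (W : Set ℂ) (n : ℕ) :
    IsClosed (removedImages f γ W n) := by
  rw [removedImages_eq]
  exact (finite_Iic n).isClosed_biUnion fun j _ => (hS.subset inter_subset_right).isClosed_biUnion
    fun z hz => (hγ z hz.2).isClosed_image hf j

theorem escapesUniformly_tailsOver (hS : (escapingSingularSet f).Finite)
    (hγ : ∀ z ∈ escapingSingularSet f, IsRayTailFrom f z (γ z)) (V : Set ℂ) :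
    EscapesUniformly f (tailsOver f γ V) :=
  EscapesUniformly.biUnion (hS.subset inter_subset_right) fun z hz => (hγ z hz.2).escapesUniformly

theorem escapesUniformly_removedImages (hS : (escapingSingularSet f).Finite)
    (hγ : ∀ z ∈ escapingSingularSet f, IsRayTailFrom f z (γ z)) (W : Set ℂ) (n : ℕ) :
    EscapesUniformly f (removedImages f γ W n) :=
  EscapesUniformly.biUnion (finite_Iic n) fun j _ => (escapesUniformly_tailsOver hS hγ _).image j

/-- For j = 0 nothing is deleted, as S(f) lies in `D`. For j ≥ 1 compatibility puts the whole tail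
into the j-th preimage of the base domain. -/
theorem removedImages_subset (hD : IsCompatibleChoice f γ D δ) (n : ℕ) :
    removedImages f γ (baseDomain D δ) n ⊆ baseDomain D δ := by
  rw [removedImages_eq]
  refine iUnion₂_subset fun j _ => iUnion₂_subset fun z hz => ?_
  rw [image_subset_iff]
  rcases Nat.eq_zero_or_pos j with rfl | hj
  · exact absurd (Or.inl (subset_closure (hD.2.1 (Or.inl hz.2.1)))) hz.1
  · exact (hD.2.2.2 j hj z hz.2 (handStage_subset_preimage f γ _ j hz.1)).trans
      (connectedComponentIn_subset _ _)

/-- An escaping singular value lies on its own deleted tail. For a nonescaping one, the nth iterate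
is in P(f) \ I(f), hence in `D` and outside the base domain. -/
theorem notMem_singularSet_of_mem_handStage_diff
    (hγ : ∀ z ∈ escapingSingularSet f, IsRayTailFrom f z (γ z)) (hD : IsCompatibleChoice f γ D δ)
    {n : ℕ} {v : ℂ}
    (hv : v ∈ handStage f γ (baseDomain D δ) n \ removedTails f γ (baseDomain D δ) n) :
    v ∉ singularSet f := by
  intro hvS
  by_cases hI : v ∈ escapingSet f
  · exact hv.2 (mem_biUnion (x := v) ⟨hv.1, hvS, hI⟩ (hγ v ⟨hvS, hI⟩).mem)
  · have h1 : f^[n] v ∈ postsingularSet f := subset_closure (mem_iUnion.2 ⟨n, v, hvS, rfl⟩)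
    have h2 : f^[n] v ∉ escapingSet f := fun h => hI (by
      have h3 : Tendsto (fun m : ℕ => f^[m + n] v) atTop (Bornology.cobounded ℂ) :=
        h.congr fun m => (Function.iterate_add_apply f m n v).symm
      exact (tendsto_add_atTop_iff_nat (f := fun m : ℕ => f^[m] v) n).1 h3)
    exact handStage_subset_preimage f γ _ n hv.1
      (Or.inl (subset_closure (hD.2.1 (Or.inr ⟨h1, h2⟩))))

theorem isOpen_handStage_diff (hf : Continuous f) (hS : (escapingSingularSet f).Finite)
    (hγ : ∀ z ∈ escapingSingularSet f, IsRayTailFrom f z (γ z)) (hD : IsCompatibleChoice f γ D δ)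
    (n : ℕ) :
    IsOpen (handStage f γ (baseDomain D δ) n \ removedTails f γ (baseDomain D δ) n) :=
  (isOpen_handStage hf hS hγ (isOpen_baseDomain hD.2.2.1) n).sdiff
    (isClosed_tailsOver hf hS hγ _)

/-- Each deleted point is joined to infinity by the connected unbounded tail through it. -/
theorem hasLogBranches_compl_tailsOver (hf : Continuous f)
    (hγ : ∀ z ∈ escapingSingularSet f, IsRayTailFrom f z (γ z)) (V : Set ℂ) :
    HasLogBranches (tailsOver f γ V)ᶜ := by
  refine hasLogBranches_of_unbounded fun c hc => ?_
  obtain ⟨z, hz, hcz⟩ := mem_iUnion₂.1 (not_not.1 hc)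
  refine ⟨γ z, ?_, (hγ z hz.2).isPreconnected, hcz, (hγ z hz.2).not_isBounded hf⟩
  rw [compl_compl]
  exact subset_biUnion_of_mem (u := γ) hz

/-- Induction: deleting tails preserves logarithm branches, so the components become simply
connected; they carry no singular values, and the preimage inherits the property. -/
theorem hasLogBranches_handStage (hf : ClassB f) (hS : (escapingSingularSet f).Finite)
    (hγ : ∀ z ∈ escapingSingularSet f, IsRayTailFrom f z (γ z)) (hD : IsCompatibleChoice f γ D δ)
    (n : ℕ) : HasLogBranches (handStage f γ (baseDomain D δ) n) := by
  induction n with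
  | zero => exact hD.2.2.1.hasLogBranches_baseDomain hD.1
  | succ n ih =>
    have hVo := isOpen_handStage_diff hf.1.1.continuous hS hγ hD n
    refine hasLogBranches_preimage hf.1.1 hVo
      (fun v hv => notMem_singularSet_of_mem_handStage_diff hγ hD hv) fun v hv => ?_
    exact (ih.inter (hasLogBranches_compl_tailsOver hf.1.1.continuous hγ _)
      ).isSimplyConnected_connectedComponentIn hVo hv

theorem isSimplyConnected_component_handStage_diff (hf : ClassB f)
    (hS : (escapingSingularSet f).Finite)
    (hγ : ∀ z ∈ escapingSingularSet f, IsRayTailFrom f z (γ z)) (hD : IsCompatibleChoice f γ D δ)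
    {n : ℕ} {v : ℂ}
    (hv : v ∈ handStage f γ (baseDomain D δ) n \ removedTails f γ (baseDomain D δ) n) :
    IsSimplyConnected (connectedComponentIn
      (handStage f γ (baseDomain D δ) n \ removedTails f γ (baseDomain D δ) n) v) :=
  ((hasLogBranches_handStage hf hS hγ hD n).inter
    (hasLogBranches_compl_tailsOver hf.1.1.continuous hγ _)).isSimplyConnected_connectedComponentIn
    (isOpen_handStage_diff hf.1.1.continuous hS hγ hD n) hv

/-- The question is pushed forward by f^n to the base domain, where the deleted sets are closed and
escape uniformly: the image of a bounded component would contain an unbounded component. -/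
theorem not_isBounded_component_handStage_diff (hf : ClassB f)
    (hS : (escapingSingularSet f).Finite)
    (hγ : ∀ z ∈ escapingSingularSet f, IsRayTailFrom f z (γ z)) (hD : IsCompatibleChoice f γ D δ)
    {n : ℕ} {v : ℂ}
    (hv : v ∈ handStage f γ (baseDomain D δ) n \ removedTails f γ (baseDomain D δ) n) :
    ¬ Bornology.IsBounded (connectedComponentIn
      (handStage f γ (baseDomain D δ) n \ removedTails f γ (baseDomain D δ) n) v) := by
  intro hb
  set W := baseDomain D δ with hW
  set V := handStage f γ W n \ removedTails f γ W n with hV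
  set C := connectedComponentIn V v with hC
  set Z := removedImages f γ W n with hZ
  have hcont : Continuous f^[n] := hf.1.1.continuous.iterate n
  have hVo : IsOpen V := isOpen_handStage_diff hf.1.1.continuous hS hγ hD n
  have hCo : IsOpen C := hVo.connectedComponentIn
  have hfCo : IsOpen (f^[n] '' C) := hf.1.isOpenMap_iterate n _ hCo
  have hZesc : EscapesUniformly f Z := escapesUniformly_removedImages hS hγ W n
  have hZc : IsClosed Z := isClosed_removedImages hf.1.1.continuous hS hγ W n
  have hCV : C ⊆ V := connectedComponentIn_subset _ _
  -- The open set f^n(C) cannot consist of uniformly escaping points, so some image point avoids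
  -- `Z`.
  have hnot : ¬ f^[n] '' C ⊆ Z := fun hsub =>
    hf.not_escapesUniformly hfCo ⟨_, mem_image_of_mem _ (mem_connectedComponentIn hv)⟩ fun R => by
      obtain ⟨N, hN⟩ := hZesc R
      exact ⟨N, fun m hm z hz => hN m hm z (hsub hz)⟩
  obtain ⟨_, ⟨x, hx, rfl⟩, hxZ⟩ := not_subset.1 hnot
  have hxW : f^[n] x ∈ W := handStage_subset_preimage f γ W n (hCV hx).1
  refine not_isBounded_component_baseDomain_diff hf hD.1 hD.2.2.1 hZc hZesc
    (removedImages_subset hD n) ⟨hxW, hxZ⟩ ?_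
  have hcpt : IsCompact (f^[n] '' closure C) := hb.isCompact_closure.image hcont
  refine hcpt.isBounded.subset (Subset.trans ?_ (image_mono subset_closure))
  -- Within the base domain minus `Z` the set f^n(C) is also closed: boundary points of `C` lie
  -- outside `V`, and such points do not map into that difference.
  refine isPreconnected_connectedComponentIn.subset_left_of_subset_union hfCo
    hcpt.isClosed.isOpen_compl ?_ ?_
    ⟨_, mem_connectedComponentIn ⟨hxW, hxZ⟩, mem_image_of_mem _ hx⟩
  · exact disjoint_compl_right.mono_left (image_mono subset_closure)
  · intro y hy
    by_cases hyc : y ∈ f^[n] '' closure C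
    · left
      obtain ⟨c, hc, rfl⟩ := hyc
      have hyWZ := connectedComponentIn_subset _ _ hy
      have hcV : c ∈ V := mem_handStage_diff_of_iterate_mem hyWZ.1 hyWZ.2
      refine mem_image_of_mem _ ?_
      by_contra hcC
      exact frontier_connectedComponentIn_subset hVo v
        (by rw [hCo.frontier_eq]; exact ⟨hc, hcC⟩) hcV
    · exact Or.inr hyc

end Stages

/-! ### The proposition -/

theorem isComponentOf_inter_component {S X : Set ℂ} {z : ℂ} (hz : z ∈ S \ X) :
    connectedComponentIn (S \ X) z = connectedComponentIn (connectedComponentIn S z \ X) z := by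
  have h1 : connectedComponentIn (S \ X) z ⊆ connectedComponentIn S z :=
    connectedComponentIn_mono z sdiff_subset
  refine Subset.antisymm ?_ (connectedComponentIn_mono z
    (sdiff_subset_sdiff_left (connectedComponentIn_subset _ _)))
  exact isPreconnected_connectedComponentIn.subset_connectedComponentIn (mem_connectedComponentIn hz)
    fun y hy => ⟨h1 hy, (connectedComponentIn_subset _ _ hy).2⟩

theorem mainTheorem8 (f : ℂ → ℂ) (hf : ClassB f) (hcrin : Criniferous f)
    (hAV : juliaSet f ∩ asymptoticValues f = ∅)
    (hP : Bornology.IsBounded (postsingularSet f \ escapingSet f))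
    (hS : (escapingSingularSet f).Finite)
    (γ : ℂ → Set ℂ) (hγ : ∀ z ∈ escapingSingularSet f, IsRayTailFrom f z (γ z))
    (D δ : Set ℂ) (hD : IsCompatibleChoice f γ D δ) :
    (∀ (n : ℕ) (τ : Set ℂ), IsFundamentalHand f γ (baseDomain D δ) n τ →
      ¬ Bornology.IsBounded τ ∧ IsSimplyConnected τ) ∧
    (∀ (n : ℕ) (τ τ' : Set ℂ), IsFundamentalHand f γ (baseDomain D δ) n τ →
      IsFundamentalHand f γ (baseDomain D δ) n τ' → τ ≠ τ' → Disjoint τ τ') ∧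
    (∀ (n : ℕ) (τ : Set ℂ), 1 ≤ n → IsFundamentalHand f γ (baseDomain D δ) n τ →
      InjOn f τ ∧ ∃ τ' : Set ℂ, IsFundamentalHand f γ (baseDomain D δ) (n - 1) τ' ∧
        MapsTo f τ τ' ∧
        IsComponentOf (f '' τ) (τ' \ removedTails f γ (baseDomain D δ) n)) := by
  have hfc := hf.1.1.continuous
  have hmap : ∀ n : ℕ, ∀ z ∈ handStage f γ (baseDomain D δ) (n + 1),
      InjOn f (connectedComponentIn (handStage f γ (baseDomain D δ) (n + 1)) z) ∧
      f '' connectedComponentIn (handStage f γ (baseDomain D δ) (n + 1)) z = connectedComponentIn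
        (handStage f γ (baseDomain D δ) n \ removedTails f γ (baseDomain D δ) n) (f z) :=
    fun n z hz => injOn_component_preimage hf.1.1 (isOpen_handStage_diff hfc hS hγ hD n)
      (fun v hv => notMem_singularSet_of_mem_handStage_diff hγ hD hv) hz
      (isSimplyConnected_component_handStage_diff hf hS hγ hD hz)
  refine ⟨?_, ?_, ?_⟩
  · rintro n _ ⟨z, hz, rfl⟩
    constructor
    -- A bounded hand has bounded image, but that image is a component of the previous stage minus
    -- its tails.
    · intro hb
      refine not_isBounded_component_handStage_diff hf hS hγ hD hz ?_
      rw [← (hmap n z hz).2]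
      exact (hb.isCompact_closure.image hfc).isBounded.subset (image_mono subset_closure)
    · exact (hasLogBranches_handStage hf hS hγ hD (n + 1)).isSimplyConnected_connectedComponentIn
        (isOpen_handStage hfc hS hγ (isOpen_baseDomain hD.2.2.1) (n + 1)) hz
  · rintro n _ _ ⟨z, hz, rfl⟩ ⟨w, hw, rfl⟩ hne
    by_contra hd
    obtain ⟨u, hu, hu'⟩ := not_disjoint_iff.1 hd
    exact hne (by rw [← connectedComponentIn_eq_of_mem hu, connectedComponentIn_eq_of_mem hu'])
  · rintro n _ hn ⟨z, hz, rfl⟩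
    obtain ⟨m, rfl⟩ : ∃ m, n = m + 1 := ⟨n - 1, by omega⟩
    -- Level m + 1 is stage m + 2; it covers stage m + 1, whose components are the hands of level m,
    -- minus X_{m+1}.
    obtain ⟨hinj, himg⟩ := hmap (m + 1) z hz
    refine ⟨hinj, connectedComponentIn (handStage f γ (baseDomain D δ) (m + 1)) (f z),
      ⟨f z, hz.1, rfl⟩, ?_, ?_⟩
    · rw [mapsTo_iff_image_subset, himg]
      exact connectedComponentIn_mono _ sdiff_subset
    · rw [himg]
      exact ⟨f z, ⟨mem_connectedComponentIn hz.1, hz.2⟩, isComponentOf_inter_component hz⟩
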